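/- **Proposition 3.1.** Write $\langle a\rangle=(1+|a|^2)^{1/2}$ and $\mathbb T^2=(\mathbb R/2\pi\mathbb Z)^2$. For $u$ on $\mathbb T^2\times\mathbb R$ let $\widehat u=\mathcal F_{x,t}u$ denote its space-time Fourier transform, $$\widehat u(n,\tau)=(2\pi)^{-3}\int_{\mathbb T^2}\int_{\mathbb R}e^{-i(n\cdot x+t\tau)}u(x,t)\,dt\,dx,\qquad (n,\tau)\in\mathbb Z^2\times\mathbb R.$$ For $s,b\in\mathbb R$ and $f:\mathbb Z^2\times\mathbb R\to\mathbb C$ measurable put $$\|f\|_{\widehat X^{s,b}}=\big\|\langle n\rangle^s\langle\tau+|n|^2\rangle^b f\big\|_{\ell^2_nL^2_\tau},\qquad \|f\|_{\widehat Y^{s,b}}=\big\|\langle n\rangle^s f\big\|_{\ell^2_nL^1_\tau}+\big\|\langle\tau+|n|^2\rangle^{\frac s2+b}f\big\|_{\ell^2_nL^2_\tau},$$ $$\|f\|_{\widehat Z^{s,b}}=\big\|\mathbf 1_{\{|\tau+|n|^2|<2^{-10}|n|^2\}}f\big\|_{\widehat X^{s,b}}+\big\|\mathbf 1_{\{|\tau+|n|^2|\ge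 2^{-10}|n|^2\}}f\big\|_{\widehat Y^{s,b}},$$ and $\|u\|_{Z^{s,b}}=\|\widehat u\|_{\widehat Z^{s,b}}$. The space $Z^{s,b}$ is the completion, in this norm, of the functions on $\mathbb T^2\times\mathbb R$ that are smooth in space and Schwartz in time; for $b=\frac23$ its elements are identified with the (classes of) measurable functions $\widehat u$ with $\|\widehat u\|_{\widehat Z^{s,b}}<\infty$. Let $-\frac23<s\le-\frac12$. There is $\theta=\theta(s)>0$ such that for every smooth $\varphi:\mathbb R\to[0,1]$ with $\varphi\equiv1$ on $[-1,1]$ and $\varphi\equiv0$ outside $[-2,2]$ there is a constant $C=C(s,\varphi)$ such that, with $\varphi_T(t)=\varphi(t/T)$, for all $0<T\le\frac12$ and all $u,v\in Z^{s,\frac23}$, $$\Big\|\langle\tau+|n|^2\rangle^{-1}\mathcal F_{x,t}\big(\varphi_T\overline u\cdot\varphi_T\overline v\big)(n,\tau)\Big\|_{\widehat Z^{s,\frac23}}\le C\,T^\theta\,\|u\|_{Z^{s,\frac23}}\|v\|_{Z^{s,\frac23}}.$$ Here, if $u,v$ are smooth in space and Schwartz in time, $\mathcal F_{x,t}(\varphi_T\overline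 u\cdot\varphi_T\overline v)$ is the Fourier transform of the pointwise product. For general $u,v\in Z^{s,\frac23}$ it is given by $$\mathcal F_{x,t}\big(\varphi_T\overline u\cdot\varphi_T\overline v\big)(n,\tau)=\sum_{n_1\in\mathbb Z^2}\frac1{2\pi}\int_{\mathbb R}e^{-it\tau}\,\varphi_T(t)\overline{u_{n_1}(t)}\,\varphi_T(t)\overline{v_{-n-n_1}(t)}\,dt,\qquad u_n(t)=\int_{\mathbb R}e^{it\tau}\,\widehat u(n,\tau)\,d\tau$$ (and similarly for $v_n$), and it is part of the assertion that this series converges absolutely for every $n$ and almost every $\tau$. -/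

import Mathlib

open scoped ContDiff

noncomputable section

namespace QNLS

/-- Spatial frequencies of the torus `𝕋² = (ℝ / 2πℤ)²`. -/
abbrev Freq : Type := Fin 2 → ℤ

/-- The squared Euclidean length `|n|²` of a frequency. -/
def normSq (n : Freq) : ℝ := ∑ j, (n j : ℝ) ^ 2

/-- The Japanese bracket `⟨n⟩ = (1 + |n|²)^{1/2}` of a frequency. -/
def jbFreq (n : Freq) : ℝ := Real.sqrt (1 + normSq n)

/-- The Japanese bracket `⟨a⟩ = (1 + a²)^{1/2}` of a real number. -/
def jb (a : ℝ) : ℝ := Real.sqrt (1 + a ^ 2)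

/-- The modulation `τ + |n|²`. -/
def modulation (n : Freq) (τ : ℝ) : ℝ := τ + normSq n

/-- The mixed norm `‖f‖_{ℓ²_n L^p_τ}`, with value `∞` if it is not finite. -/
def ell2Lp (p : ENNReal) (f : Freq → ℝ → ℂ) : ENNReal :=
  (∑' n : Freq, (MeasureTheory.eLpNorm (f n) p MeasureTheory.volume) ^ 2) ^ (1 / 2 : ℝ)

/-- The Fourier-side norm of `X^{s,b}`. -/
def XhatNorm (s b : ℝ) (f : Freq → ℝ → ℂ) : ENNReal :=
  ell2Lp 2 fun n τ => ((jbFreq n ^ s * jb (modulation n τ) ^ b : ℝ) : ℂ) * f n τ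

/-- The Fourier-side norm of `Y^{s,b}`. -/
def YhatNorm (s b : ℝ) (f : Freq → ℝ → ℂ) : ENNReal :=
  ell2Lp 1 (fun n τ => ((jbFreq n ^ s : ℝ) : ℂ) * f n τ) +
    ell2Lp 2 (fun n τ => ((jb (modulation n τ) ^ (s / 2 + b) : ℝ) : ℂ) * f n τ)

/-- Restriction to low modulation, `|τ + |n|²| < 2^{-10} |n|²`. -/
def Plo (f : Freq → ℝ → ℂ) : Freq → ℝ → ℂ :=
  fun n => Set.indicator {τ : ℝ | |modulation n τ| < normSq n / 2 ^ 10} (f n)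

/-- Restriction to high modulation, `|τ + |n|²| ≥ 2^{-10} |n|²`. -/
def Phi (f : Freq → ℝ → ℂ) : Freq → ℝ → ℂ :=
  fun n => Set.indicator {τ : ℝ | normSq n / 2 ^ 10 ≤ |modulation n τ|} (f n)

/-- The Fourier-side norm of `Z^{s,b}`. -/
def ZhatNorm (s b : ℝ) (f : Freq → ℝ → ℂ) : ENNReal :=
  XhatNorm s b (Plo f) + YhatNorm s b (Phi f)

/-- `f` is (a representative of) the space-time Fourier transform of an element of `Z^{s,b}`:
it is measurable and its norm is finite. -/
structure MemZhat (s b : ℝ) (f : Freq → ℝ → ℂ) : Prop where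
  aesm : ∀ n, MeasureTheory.AEStronglyMeasurable (f n) MeasureTheory.volume
  finite : ZhatNorm s b f < ⊤

/-- Functions on `𝕋² × ℝ` that are smooth in space and Schwartz in time, as functions on
`ℝ² × ℝ` that are `2π`-periodic in both spatial variables. -/
structure IsNice (u : (Fin 2 → ℝ) → ℝ → ℂ) : Prop where
  smooth : ContDiff ℝ ∞ (fun p : (Fin 2 → ℝ) × ℝ => u p.1 p.2)
  periodic : ∀ (x : Fin 2 → ℝ) (t : ℝ) (k : Freq),
    u (fun j => x j + 2 * Real.pi * (k j : ℝ)) t = u x t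
  decay : ∀ k m : ℕ, ∃ C : ℝ, ∀ (x : Fin 2 → ℝ) (t : ℝ),
    |t| ^ k * ‖iteratedFDeriv ℝ m (fun p : (Fin 2 → ℝ) × ℝ => u p.1 p.2) (x, t)‖ ≤ C

/-- The space-time Fourier transform of a function on `𝕋² × ℝ`, normalized so that
`u(x,t) = ∑_n ∫ e^{i(n·x + tτ)} û(n,τ) dτ`. -/
def stFourier (u : (Fin 2 → ℝ) → ℝ → ℂ) : Freq → ℝ → ℂ := fun n τ =>
  (((2 * Real.pi) ^ 3 : ℝ) : ℂ)⁻¹ *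
    ∫ x in Set.Icc (0 : Fin 2 → ℝ) (fun _ => 2 * Real.pi), ∫ t : ℝ,
      Complex.exp (-Complex.I * (((∑ j, (n j : ℝ) * x j) + t * τ : ℝ) : ℂ)) * u x t

/-- The rescaled time cutoff `φ_T(t) = φ(t / T)`. -/
def cutoff (φ : ℝ → ℝ) (T t : ℝ) : ℂ := ((φ (t / T) : ℝ) : ℂ)

/-- The function `φ_T ū · φ_T v̄`. -/
def cutoffProd (φ : ℝ → ℝ) (T : ℝ) (u v : (Fin 2 → ℝ) → ℝ → ℂ) : (Fin 2 → ℝ) → ℝ → ℂ :=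
  fun x t => (cutoff φ T t * star (u x t)) * (cutoff φ T t * star (v x t))

/-- The spatial Fourier coefficient `u_n(t) = ∫ e^{itτ} û(n,τ) dτ` of `u(t)`, for `f = û`. -/
def spaceCoeff (f : Freq → ℝ → ℂ) (n : Freq) (t : ℝ) : ℂ :=
  ∫ τ : ℝ, Complex.exp (Complex.I * ((t * τ : ℝ) : ℂ)) * f n τ

/-- The contribution to the space-time Fourier transform of `φ_T ū · φ_T v̄` at `(n,τ)` of the
mode `n₁` of `u` and the mode `-n-n₁` of `v`, for `f = û` and `g = v̂`. -/
def prodTerm (φ : ℝ → ℝ) (T : ℝ) (f g : Freq → ℝ → ℂ) (n : Freq) (τ : ℝ) (n₁ : Freq) : ℂ :=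
  ((2 * Real.pi : ℝ) : ℂ)⁻¹ * ∫ t : ℝ, Complex.exp (-Complex.I * ((t * τ : ℝ) : ℂ)) *
    ((cutoff φ T t * star (spaceCoeff f n₁ t)) * (cutoff φ T t * star (spaceCoeff g (-n - n₁) t)))

/-- The space-time Fourier transform of `φ_T ū · φ_T v̄` for elements `u`, `v` of `Z^{s,b}` with
`f = û` and `g = v̂`: Fourier series in space are multiplied by convolving their coefficients. -/
def prodFourier (φ : ℝ → ℝ) (T : ℝ) (f g : Freq → ℝ → ℂ) : Freq → ℝ → ℂ :=
  fun n τ => ∑' n₁ : Freq, prodTerm φ T f g n τ n₁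

/-- Multiplication by the weight `⟨τ + |n|²⟩⁻¹`. -/
def invModulation (F : Freq → ℝ → ℂ) : Freq → ℝ → ℂ :=
  fun n τ => (((jb (modulation n τ))⁻¹ : ℝ) : ℂ) * F n τ

end QNLS

end

noncomputable section

namespace QNLS

open MeasureTheory ENNReal
open scoped Pointwise

/-! On the Fourier side the product is a sum over n₁ and an integral over temporal frequencies τ₁,
τ₂, with n + n₁ + n₂ = 0 and kernel the Fourier transform of φ_T² at ρ = τ + τ₁ + τ₂. Scaling and
one integration by parts bound this kernel by T^δ⟨ρ⟩^{-(1-δ)} (`exists_norm_cutHat_le`). This is the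
only source of the power of T. What remains is a bilinear estimate for nonnegative functions with
kernel ⟨ρ⟩^{-(1-δ)} (`exists_bilinear_le`).

Both factors are conjugated, so the modulations satisfy σ + σ₁ + σ₂ = ρ + |n|² + |n₁|² + |n₂|² and
nothing cancels on the right. Hence one of ⟨ρ⟩, ⟨σ⟩, ⟨σ₁⟩, ⟨σ₂⟩ is comparable to H = 1 + |n|² +
|n₁|² + |n₂|² or larger, and if it is that of an input, this input may be taken of high modulation
(`tripleSq_le_of_resonance`). If ⟨ρ⟩ is large, the kernel is spent on the weights and the inputs are
measured in ℓ²L¹. Otherwise ⟨ρ⟩^{-(1-δ)} is replaced by the integrable ⟨ρ⟩^{-(1+δ)} at the cost of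
H^{2δ}, which the gap s + 2/3 = 100δ pays for. All weights are powers, so after taking logarithms
every case is a linear inequality (`log_weight_two_le`, `log_weight_one_le`). These inequalities
dominate the weighted kernel by finitely many model kernels.

The model kernels are handled by Cauchy–Schwarz. Those with a high-modulation input use the square
summability of ⟨n⟩^{-7/6} on ℤ². The others are an L⁴-type Strichartz estimate and its dual, which
rest on counting the n₁ with |n₁|² + |n + n₁|² near a given number. By the parallelogram law these
lie near a circle, and a circle carries O(R^ε) lattice points by the divisor bound in ℤ[i]
(`exists_card_norm_eq_le`).

For smooth functions, integration by parts gives enough decay of the transform for membership in the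
space, and Parseval's identity on the torus identifies the transform of the pointwise product with
the convolution series (`stFourier_cutoffProd`), so the general estimate applies. -/

/-! ### Divisor bound in ℤ[i] and lattice points on circles. -/

/-- Submultisets are few: the divisor bound in multiset form. -/
theorem exists_prod_count_add_one_le {α : Type*} [DecidableEq α] (ν : α → ℕ)
    (hν : ∀ P : ℕ, {a | ν a < P}.Finite) {ε : ℝ} (hε : 0 < ε) :
    ∃ C : ℝ, 0 < C ∧ ∀ s : Multiset α, (∀ a ∈ s, 2 ≤ ν a) →
      ((∏ a ∈ s.toFinset, (s.count a + 1) : ℕ) : ℝ) ≤ C * (((s.map ν).prod : ℕ) : ℝ) ^ ε := by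
  obtain ⟨P, hP⟩ := exists_nat_ge ((2 : ℝ) ^ (1 / ε))
  have hPpos : (0 : ℝ) < P := lt_of_lt_of_le (by positivity) hP
  -- With this `D`, k + 1 ≤ D x^{kε} for every x ≥ 2. For x ≥ P one has x^ε ≥ 2 and no constant is
  -- needed, so only the finitely many elements with ν < P contribute a factor `D`.
  set D : ℝ := max 1 (1 / (ε * Real.log 2)) with hD
  have hl2 : 0 < Real.log 2 := Real.log_pos (by norm_num)
  have hD1 : 1 ≤ D := le_max_left _ _
  have hDl : 1 ≤ D * (ε * Real.log 2) := by
    have : 1 / (ε * Real.log 2) ≤ D := le_max_right _ _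
    rwa [div_le_iff₀ (by positivity)] at this
  have hk : ∀ k x : ℕ, 2 ≤ x → (k : ℝ) + 1 ≤ D * ((x : ℝ) ^ k) ^ ε := by
    intro k x hx
    have hx' : (2 : ℝ) ≤ x := by exact_mod_cast hx
    have h1 : ((2 : ℝ) ^ k) ^ ε ≤ ((x : ℝ) ^ k) ^ ε := by gcongr
    have h2 : (1 : ℝ) + k * (ε * Real.log 2) ≤ ((2 : ℝ) ^ k) ^ ε := by
      rw [← Real.rpow_natCast, ← Real.rpow_mul (by norm_num), Real.rpow_def_of_pos (by norm_num)]
      have := Real.add_one_le_exp (Real.log 2 * (k * ε))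
      linarith
    have h3 : (0 : ℝ) ≤ k := Nat.cast_nonneg k
    nlinarith [mul_le_mul_of_nonneg_left (h2.trans h1) (by linarith : 0 ≤ D),
      mul_le_mul_of_nonneg_left hDl h3]
  have hk' : ∀ k x : ℕ, P ≤ x → (k : ℝ) + 1 ≤ ((x : ℝ) ^ k) ^ ε := by
    intro k x hx
    have hx' : (P : ℝ) ≤ x := by exact_mod_cast hx
    have h0 : (2 : ℝ) ≤ (x : ℝ) ^ ε := by
      calc (2 : ℝ) = ((2 : ℝ) ^ (1 / ε)) ^ ε := by
            rw [← Real.rpow_mul (by norm_num), one_div_mul_cancel hε.ne', Real.rpow_one]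
        _ ≤ _ := by gcongr; exact hP.trans hx'
    have h1 : ((x : ℝ) ^ k) ^ ε = ((x : ℝ) ^ ε) ^ k := by
      rw [← Real.rpow_natCast, ← Real.rpow_mul (by positivity), mul_comm,
        Real.rpow_mul (by positivity), Real.rpow_natCast]
    rw [h1]
    calc (k : ℝ) + 1 ≤ 2 ^ k := by exact_mod_cast Nat.lt_two_pow_self
      _ ≤ _ := by gcongr
  refine ⟨D ^ (hν P).toFinset.card, by positivity, fun s hs => ?_⟩
  rw [Finset.prod_multiset_map_count]
  push_cast
  rw [← Real.finsetProd_rpow _ _ (fun i _ => by positivity)]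
  have hfac : ∀ a ∈ s.toFinset, ((s.count a : ℝ) + 1) ≤
      (if ν a < P then D else 1) * ((ν a : ℝ) ^ s.count a) ^ ε := by
    intro a ha
    split_ifs with h
    · exact hk _ _ (hs a (Multiset.mem_toFinset.1 ha))
    · rw [one_mul]; exact hk' _ _ (not_lt.1 h)
  refine (Finset.prod_le_prod (fun i _ => by positivity) hfac).trans ?_
  rw [Finset.prod_mul_distrib]
  gcongr
  rw [← Finset.prod_filter, Finset.prod_const]
  refine pow_le_pow_right₀ hD1 (Finset.card_le_card fun a ha => ?_)
  simpa using (Finset.mem_filter.1 ha).2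

theorem finite_gaussianInt_norm_lt (P : ℕ) : {z : GaussianInt | z.norm.natAbs < P}.Finite := by
  refine Set.Finite.subset (((Finset.Icc (-(P : ℤ)) P ×ˢ Finset.Icc (-(P : ℤ)) P).finite_toSet).image
    (fun p : ℤ × ℤ => (⟨p.1, p.2⟩ : GaussianInt))) ?_
  intro z hz
  have hz' : z.norm.natAbs < P := hz
  have h0 := GaussianInt.norm_nonneg z
  have h1 : z.re * z.re + z.im * z.im < P := by
    have : z.norm = z.re * z.re + z.im * z.im := by rw [Zsqrtd.norm_def]; ring
    omega
  refine ⟨(z.re, z.im), ?_, rfl⟩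
  simp only [Finset.coe_product, Finset.coe_Icc, Set.mem_prod, Set.mem_Icc]
  refine ⟨⟨?_, ?_⟩, ?_, ?_⟩ <;> nlinarith [mul_self_nonneg z.re, mul_self_nonneg z.im]

/-- There are few Gaussian integers of a given norm. -/
theorem exists_card_norm_eq_le {ε : ℝ} (hε : 0 < ε) :
    ∃ C : ℝ, 0 < C ∧ ∀ (m : ℕ) (F : Finset GaussianInt), 0 < m →
      (∀ z ∈ F, z.norm = m) → (F.card : ℝ) ≤ C * (m : ℝ) ^ ε := by
  classical
  let _ : StrongNormalizationMonoid GaussianInt :=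
    UniqueFactorizationMonoid.strongNormalizationMonoid
  obtain ⟨C, hC, hCb⟩ := exists_prod_count_add_one_le
    (fun z : GaussianInt => z.norm.natAbs) finite_gaussianInt_norm_lt (half_pos hε)
  -- `U` contains all units, so its cardinality bounds the number of associates of an element, which
  -- are exactly what the factor multiset fails to distinguish.
  set U := (finite_gaussianInt_norm_lt 2).toFinset with hU
  have hU1 : (1 : GaussianInt) ∈ U := by simp [hU]
  have hUpos : 0 < U.card := Finset.card_pos.2 ⟨1, hU1⟩
  refine ⟨U.card * C, by positivity, fun m F hm hF => ?_⟩
  have hF0 : ∀ z ∈ F, z ≠ 0 := by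
    rintro z hz rfl
    have := hF 0 hz
    simp at this
    omega
  have hm0 : (m : GaussianInt) ≠ 0 := by exact_mod_cast hm.ne'
  set φ : GaussianInt → Multiset GaussianInt := UniqueFactorizationMonoid.normalizedFactors
  have hfib : ∀ b ∈ F.image φ, (F.filter fun z => φ z = b).card ≤ U.card := by
    intro b hb
    obtain ⟨z, hz, rfl⟩ := Finset.mem_image.1 hb
    refine (Finset.card_le_card (t := U.image (z * ·)) ?_).trans Finset.card_image_le
    intro w hw
    obtain ⟨hwF, hw⟩ := Finset.mem_filter.1 hw
    obtain ⟨u, hu⟩ := (UniqueFactorizationMonoid.associated_iff_normalizedFactors_eq_normalizedFactors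
      (hF0 z hz) (hF0 w hwF)).2 hw.symm
    refine Finset.mem_image.2 ⟨u, ?_, hu⟩
    have := Zsqrtd.norm_eq_one_iff.2 u.isUnit
    simp [hU, this]
  -- An element z of norm m divides m, because m = z z̄. Its factors therefore form a submultiset of
  -- those of m.
  have himg : F.image φ ⊆ Finset.Iic (φ m) := by
    intro b hb
    obtain ⟨z, hz, rfl⟩ := Finset.mem_image.1 hb
    rw [Finset.mem_Iic]
    refine (UniqueFactorizationMonoid.dvd_iff_normalizedFactors_le_normalizedFactors
      (hF0 z hz) hm0).1 ⟨star z, ?_⟩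
    rw [← Zsqrtd.norm_eq_mul_conj, hF z hz]
    simp
  have hcard := (Finset.card_le_mul_card_image F U.card hfib).trans
    (Nat.mul_le_mul_left _ (Finset.card_le_card himg))
  rw [Multiset.card_Iic] at hcard
  have hirr : ∀ p ∈ φ m, 2 ≤ p.norm.natAbs := by
    intro p hp
    have hpi := UniqueFactorizationMonoid.irreducible_of_normalized_factor p hp
    have h1 : p.norm.natAbs ≠ 1 := fun h => hpi.not_isUnit (Zsqrtd.norm_eq_one_iff.1 h)
    have h0 : p.norm.natAbs ≠ 0 := by
      rw [Int.natAbs_ne_zero]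
      exact fun h => hpi.ne_zero (GaussianInt.norm_eq_zero.1 h)
    omega
  -- The norm of the rational integer m is m², which is why the divisor bound was invoked with ε/2.
  have hprod : ((φ m).map fun z => z.norm.natAbs).prod = m * m := by
    have hassoc := UniqueFactorizationMonoid.prod_normalizedFactors hm0
    obtain ⟨u, hu⟩ := hassoc
    have e1 : ((φ m).map fun z => z.norm.natAbs).prod = (φ m).prod.norm.natAbs := by
      have := map_multiset_prod ((Int.natAbsHom : ℤ →*₀ ℕ).toMonoidHom.comp
        (Zsqrtd.normMonoidHom (d := -1))) (φ m)
      exact this.symm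
    have e2 := congrArg (fun z : GaussianInt => z.norm.natAbs) hu
    simp only [Zsqrtd.norm_mul, Int.natAbs_mul, Zsqrtd.norm_eq_one_iff.2 u.isUnit, mul_one] at e2
    rw [e1, e2]
    simp [Int.natAbs_mul]
  have hfin := hCb (φ m) hirr
  rw [hprod] at hfin
  have hsq : (((m * m : ℕ) : ℝ)) ^ (ε / 2) = (m : ℝ) ^ ε := by
    push_cast
    rw [← pow_two, ← Real.rpow_natCast, ← Real.rpow_mul (by positivity)]
    congr 1; push_cast; ring
  rw [hsq] at hfin
  calc (F.card : ℝ) ≤ (U.card : ℝ) * ((∏ a ∈ (φ m).toFinset, ((φ m).count a + 1) : ℕ) : ℝ) := by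
        exact_mod_cast hcard
    _ ≤ U.card * (C * (m : ℝ) ^ ε) := by gcongr
    _ = _ := by ring

theorem normSq_nonneg (n : Freq) : 0 ≤ normSq n := Finset.sum_nonneg fun _ _ => sq_nonneg _

/-- The number of lattice points on a circle grows slower than any power of the radius. -/
theorem exists_card_normSq_eq_le {ε : ℝ} (hε : 0 < ε) :
    ∃ C : ℝ, 0 < C ∧ ∀ (m : ℕ) (F : Finset Freq), (∀ v ∈ F, normSq v = m) →
      (F.card : ℝ) ≤ C * (1 + m : ℝ) ^ ε := by
  classical
  obtain ⟨C, hC, h⟩ := exists_card_norm_eq_le hε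
  refine ⟨max C 1, by positivity, fun m F hF => ?_⟩
  rcases Nat.eq_zero_or_pos m with rfl | hm
  · have hsub : F ⊆ {0} := by
      intro v hv
      have := hF v hv
      simp only [normSq, Fin.sum_univ_two, Nat.cast_zero] at this
      have h0 : (v 0 : ℝ) = 0 := by nlinarith [sq_nonneg (v 0 : ℝ), sq_nonneg (v 1 : ℝ)]
      have h1 : (v 1 : ℝ) = 0 := by nlinarith [sq_nonneg (v 0 : ℝ), sq_nonneg (v 1 : ℝ)]
      rw [Finset.mem_singleton]
      ext j; fin_cases j
      · exact_mod_cast h0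
      · exact_mod_cast h1
    have := Finset.card_le_card hsub
    simp only [Finset.card_singleton] at this
    have h1 : (F.card : ℝ) ≤ 1 := by exact_mod_cast this
    simpa using h1.trans (le_max_right C 1)
  · have hinj : Set.InjOn (fun v : Freq => (⟨v 0, v 1⟩ : GaussianInt)) (F : Set Freq) := by
      intro v _ w _ hvw
      simp only [Zsqrtd.mk.injEq] at hvw
      ext j; fin_cases j
      · exact hvw.1
      · exact hvw.2
    have key := h m (F.image fun v : Freq => (⟨v 0, v 1⟩ : GaussianInt)) hm (by
      intro z hz
      obtain ⟨v, hv, rfl⟩ := Finset.mem_image.1 hz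
      have := hF v hv
      simp only [normSq, Fin.sum_univ_two] at this
      rw [Zsqrtd.norm_def]
      have h2 : v 0 ^ 2 + v 1 ^ 2 = (m : ℤ) := by exact_mod_cast this
      dsimp only
      linarith)
    rw [Finset.card_image_of_injOn hinj] at key
    refine key.trans ?_
    gcongr
    · exact le_max_left _ _
    · linarith

/-! ### Cauchy–Schwarz -/

theorem lintegral_mul_sq_le {α : Type*} [MeasurableSpace α] (μ : Measure α) {f g : α → ℝ≥0∞}
    (hf : AEMeasurable f μ) (hg : AEMeasurable g μ) :
    (∫⁻ a, f a * g a ∂μ) ^ 2 ≤ (∫⁻ a, f a ^ 2 ∂μ) * ∫⁻ a, g a ^ 2 ∂μ := by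
  have h := ENNReal.lintegral_mul_le_Lp_mul_Lq μ Real.HolderConjugate.two_two hf hg
  simp only [Pi.mul_apply, ENNReal.rpow_two] at h
  calc _ ≤ _ := pow_le_pow_left' h 2
    _ = _ := by
      rw [mul_pow, ← ENNReal.rpow_two, ← ENNReal.rpow_two, ← ENNReal.rpow_mul, ← ENNReal.rpow_mul]
      norm_num

theorem tsum_lintegral_mul_sq_le {α : Type*} [MeasurableSpace α] (μ : Measure α) [SFinite μ]
    {A B : Freq → α → ℝ≥0∞} (hA : ∀ n, Measurable (A n)) (hB : ∀ n, Measurable (B n)) :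
    (∑' n, ∫⁻ a, A n a * B n a ∂μ) ^ 2 ≤
      (∑' n, ∫⁻ a, A n a ^ 2 ∂μ) * ∑' n, ∫⁻ a, B n a ^ 2 ∂μ := by
  have hA' : Measurable (Function.uncurry A) := measurable_from_prod_countable_right hA
  have hB' : Measurable (Function.uncurry B) := measurable_from_prod_countable_right hB
  have key : ∀ F : Freq → α → ℝ≥0∞, (∀ n, Measurable (F n)) →
      ∫⁻ z, Function.uncurry F z ∂((Measure.count : Measure Freq).prod μ) =
        ∑' n, ∫⁻ a, F n a ∂μ := by
    intro F hF
    rw [lintegral_prod _ (measurable_from_prod_countable_right hF).aemeasurable, lintegral_count]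
    rfl
  have h := lintegral_mul_sq_le ((Measure.count : Measure Freq).prod μ)
    hA'.aemeasurable hB'.aemeasurable
  have e1 := key (fun n a => A n a * B n a) fun n => (hA n).mul (hB n)
  have e2 := key (fun n a => A n a ^ 2) fun n => (hA n).pow_const 2
  have e3 := key (fun n a => B n a ^ 2) fun n => (hB n).pow_const 2
  rw [← e1, ← e2, ← e3]
  exact h

theorem tsum_mul_sq_le (a b : Freq → ℝ≥0∞) :
    (∑' n, a n * b n) ^ 2 ≤ (∑' n, a n ^ 2) * ∑' n, b n ^ 2 := by
  have := lintegral_mul_sq_le (Measure.count : Measure Freq)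
    (measurable_of_countable a).aemeasurable (measurable_of_countable b).aemeasurable
  simpa [lintegral_count] using this

/-- Sums over the third frequency of a triple that adds up to zero. -/
theorem tsum_neg_sub (m : Freq) (a : Freq → ℝ≥0∞) : ∑' n, a (-m - n) = ∑' n, a n :=
  (Equiv.subLeft (-m)).tsum_eq a

theorem tsum_neg_sub' (m : Freq) (a : Freq → ℝ≥0∞) : ∑' n, a (-n - m) = ∑' n, a n := by
  rw [← tsum_neg_sub m a]
  exact tsum_congr fun n => by congr 1; abel

/-! ### Japanese brackets -/

theorem one_le_jb (a : ℝ) : 1 ≤ jb a := by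
  rw [jb, Real.one_le_sqrt]; nlinarith [sq_nonneg a]

theorem jb_pos (a : ℝ) : 0 < jb a := one_pos.trans_le (one_le_jb a)

theorem abs_le_jb (a : ℝ) : |a| ≤ jb a := by
  rw [jb]; exact Real.abs_le_sqrt (by linarith)

theorem jb_le_one_add_abs (a : ℝ) : jb a ≤ 1 + |a| := by
  rw [jb, Real.sqrt_le_left (by positivity)]
  nlinarith [sq_abs a, abs_nonneg a]

theorem jb_neg (a : ℝ) : jb (-a) = jb a := by simp [jb]

theorem jb_sub_comm (a b : ℝ) : jb (a - b) = jb (b - a) := by rw [← jb_neg, neg_sub]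

theorem jb_sq (a : ℝ) : jb a ^ 2 = 1 + a ^ 2 := Real.sq_sqrt (by positivity)

theorem jb_add_le (a b : ℝ) : jb (a + b) ≤ jb a + jb b := by
  have h1 := jb_sq a
  have h2 := jb_sq b
  have ha := abs_le_jb a
  have hb := abs_le_jb b
  rw [jb, Real.sqrt_le_left (by linarith [jb_pos a, jb_pos b])]
  have : a * b ≤ jb a * jb b := by
    calc a * b ≤ |a * b| := le_abs_self _
      _ = |a| * |b| := abs_mul a b
      _ ≤ _ := mul_le_mul ha hb (abs_nonneg _) (jb_pos a).le
  nlinarith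

theorem continuous_jb : Continuous jb := by unfold jb; fun_prop

@[fun_prop]
theorem measurable_jb : Measurable jb := continuous_jb.measurable

theorem jb_eq_rpow (a p : ℝ) : jb a ^ (-p) = (1 + ‖a‖ ^ 2) ^ (-p / 2) := by
  rw [jb, Real.sqrt_eq_rpow, ← Real.rpow_mul (by positivity)]
  simp only [Real.norm_eq_abs, sq_abs]
  congr 1; ring

theorem one_le_jbFreq (n : Freq) : 1 ≤ jbFreq n := by
  rw [jbFreq, Real.one_le_sqrt]; linarith [normSq_nonneg n]

theorem jbFreq_pos (n : Freq) : 0 < jbFreq n := one_pos.trans_le (one_le_jbFreq n)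

theorem jbFreq_sq (n : Freq) : jbFreq n ^ 2 = 1 + normSq n :=
  Real.sq_sqrt (by linarith [normSq_nonneg n])

theorem lintegral_jb_rpow_lt_top {p : ℝ} (hp : 1 < p) :
    ∫⁻ x, ENNReal.ofReal (jb x ^ (-p)) < ⊤ := by
  have h := integrable_rpow_neg_one_add_norm_sq (E := ℝ) (μ := volume) (r := p) (by simpa using hp)
  simp_rw [jb_eq_rpow]
  exact h.lintegral_lt_top

theorem lintegral_jb_add_rpow (p c : ℝ) :
    ∫⁻ x, ENNReal.ofReal (jb (x + c) ^ (-p)) = ∫⁻ x, ENNReal.ofReal (jb x ^ (-p)) :=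
  lintegral_add_right_eq_self (fun x => ENNReal.ofReal (jb x ^ (-p))) c

/-- By subadditivity the larger of the two brackets is at least half of ⟨a - b⟩; its negative power
is replaced by that of ⟨a - b⟩ and the other factor is kept. -/
theorem jb_rpow_mul_le {p : ℝ} (hp : 0 < p) (a b x : ℝ) :
    jb (x + a) ^ (-p) * jb (x + b) ^ (-p) ≤
      2 ^ p * jb (a - b) ^ (-p) * (jb (x + a) ^ (-p) + jb (x + b) ^ (-p)) := by
  have h : jb (a - b) ≤ jb (x + a) + jb (x + b) := by
    have := jb_add_le (x + a) (-(x + b))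
    rw [jb_neg] at this
    convert this using 2; ring
  have half : ∀ u v w : ℝ, 0 < u → 0 < v → 0 < w → w ≤ 2 * u →
      u ^ (-p) * v ^ (-p) ≤ 2 ^ p * w ^ (-p) * v ^ (-p) := by
    intro u v w hu hv hw hwu
    gcongr
    calc u ^ (-p) ≤ (w / 2) ^ (-p) :=
          Real.rpow_le_rpow_of_nonpos (by linarith) (by linarith) (by linarith)
      _ = _ := by
          rw [Real.div_rpow hw.le (by norm_num), Real.rpow_neg (by norm_num : (0 : ℝ) ≤ 2),
            div_inv_eq_mul, mul_comm]
  have pa := jb_pos (x + a)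
  have pb := jb_pos (x + b)
  have pc := jb_pos (a - b)
  have q1 : 0 ≤ 2 ^ p * jb (a - b) ^ (-p) * jb (x + a) ^ (-p) := by positivity
  have q2 : 0 ≤ 2 ^ p * jb (a - b) ^ (-p) * jb (x + b) ^ (-p) := by positivity
  rw [mul_add]
  rcases le_total (jb (x + a)) (jb (x + b)) with hab | hab
  · have := half (jb (x + b)) (jb (x + a)) (jb (a - b)) pb pa pc (by linarith)
    linarith
  · have := half (jb (x + a)) (jb (x + b)) (jb (a - b)) pa pb pc (by linarith)
    linarith

/-- Brackets of exponent above one are stable under convolution. -/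
theorem exists_lintegral_jb_mul_jb_le {p : ℝ} (hp : 1 < p) :
    ∃ C : ℝ≥0∞, C ≠ ⊤ ∧ ∀ a b : ℝ,
      ∫⁻ x, ENNReal.ofReal (jb (x + a) ^ (-p)) * ENNReal.ofReal (jb (x + b) ^ (-p)) ≤
        C * ENNReal.ofReal (jb (a - b) ^ (-p)) := by
  set I := ∫⁻ x, ENNReal.ofReal (jb x ^ (-p)) with hI
  refine ⟨ENNReal.ofReal (2 ^ p) * (I + I), ?_, fun a b => ?_⟩
  · have := lintegral_jb_rpow_lt_top hp
    exact ENNReal.mul_ne_top ENNReal.ofReal_ne_top (ENNReal.add_ne_top.2 ⟨this.ne, this.ne⟩)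
  calc _ ≤ ∫⁻ x, ENNReal.ofReal (2 ^ p * jb (a - b) ^ (-p)) *
        (ENNReal.ofReal (jb (x + a) ^ (-p)) + ENNReal.ofReal (jb (x + b) ^ (-p))) := by
        refine lintegral_mono fun x => ?_
        have := jb_pos (x + a)
        have := jb_pos (x + b)
        have := jb_pos (a - b)
        rw [← ENNReal.ofReal_mul (by positivity), ← ENNReal.ofReal_add (by positivity)
          (by positivity), ← ENNReal.ofReal_mul (by positivity)]
        exact ENNReal.ofReal_le_ofReal (jb_rpow_mul_le (by linarith) a b x)
    _ = _ := by
        rw [lintegral_const_mul _ (by fun_prop), lintegral_add_left (by fun_prop),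
          lintegral_jb_add_rpow, lintegral_jb_add_rpow, ENNReal.ofReal_mul (by positivity)]
        ring

/-- Comparison with an integral: on [m, m + 1) the bracket of x - 2c is at most four times that of c
- m/2. Half-integers appear because |n₁|² + |n + n₁|² = (|n|² + |n + 2n₁|²)/2. -/
theorem exists_tsum_jb_sub_half_le {p : ℝ} (hp : 1 < p) :
    ∃ C : ℝ≥0∞, C ≠ ⊤ ∧ ∀ c : ℝ,
      ∑' m : ℕ, ENNReal.ofReal (jb (c - m / 2) ^ (-p)) ≤ C := by
  refine ⟨ENNReal.ofReal (4 ^ p) * ∫⁻ x, ENNReal.ofReal (jb x ^ (-p)),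
    ENNReal.mul_ne_top ENNReal.ofReal_ne_top (lintegral_jb_rpow_lt_top hp).ne, fun c => ?_⟩
  have hmeas : Measurable fun x : ℝ => ENNReal.ofReal (jb (x + -(2 * c)) ^ (-p)) := by fun_prop
  have hterm : ∀ m : ℕ, ENNReal.ofReal (jb (c - m / 2) ^ (-p)) ≤
      ENNReal.ofReal (4 ^ p) * ∫⁻ x in Set.Ico (m : ℝ) (m + 1),
        ENNReal.ofReal (jb (x + -(2 * c)) ^ (-p)) := by
    intro m
    rw [← lintegral_const_mul _ hmeas]
    calc ENNReal.ofReal (jb (c - m / 2) ^ (-p))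
        = ∫⁻ _ in Set.Ico (m : ℝ) (m + 1), ENNReal.ofReal (jb (c - m / 2) ^ (-p)) := by simp
      _ ≤ _ := by
        refine setLIntegral_mono (by fun_prop) fun x hx => ?_
        have h1 : jb (x + -(2 * c)) ≤ 4 * jb (c - m / 2) := by
          have e : x + -(2 * c) = (x - m) + -((c - m / 2) + (c - m / 2)) := by ring
          have h2 := jb_add_le (x - m) (-((c - m / 2) + (c - m / 2)))
          have h3 := jb_add_le (c - m / 2) (c - m / 2)
          have h4 := jb_le_one_add_abs (x - m)
          have h5 : |x - m| ≤ 1 := by rw [abs_le]; constructor <;> linarith [hx.1, hx.2]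
          have h6 := one_le_jb (c - m / 2)
          rw [jb_neg, ← e] at h2
          linarith
        have p1 := jb_pos (x + -(2 * c))
        rw [← ENNReal.ofReal_mul (by positivity)]
        refine ENNReal.ofReal_le_ofReal ?_
        calc jb (c - m / 2) ^ (-p) ≤ (jb (x + -(2 * c)) / 4) ^ (-p) :=
              Real.rpow_le_rpow_of_nonpos (by positivity) (by linarith) (by linarith)
          _ = _ := by
            rw [Real.div_rpow p1.le (by norm_num), Real.rpow_neg (by norm_num : (0 : ℝ) ≤ 4),
              div_inv_eq_mul, mul_comm]
  calc _ ≤ ∑' m : ℕ, ENNReal.ofReal (4 ^ p) * ∫⁻ x in Set.Ico (m : ℝ) (m + 1),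
        ENNReal.ofReal (jb (x + -(2 * c)) ^ (-p)) := ENNReal.tsum_le_tsum hterm
    _ ≤ _ := by
      rw [ENNReal.tsum_mul_left, ← lintegral_iUnion (fun _ => measurableSet_Ico)]
      · exact mul_le_mul_right ((setLIntegral_le_lintegral _ _).trans
          (lintegral_jb_add_rpow p _).le) _
      · intro i j hij
        have := Set.pairwise_disjoint_Ico_intCast ℝ (i := (i : ℤ)) (j := (j : ℤ))
          (by exact_mod_cast hij)
        simpa [Function.onFun] using this

theorem norm_le_jbFreq (n : Freq) : ‖n‖ ≤ jbFreq n := by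
  rw [pi_norm_le_iff_of_nonneg (jbFreq_pos n).le]
  intro j
  rw [jbFreq, Int.norm_eq_abs]
  refine Real.abs_le_sqrt ?_
  have := Finset.single_le_sum (f := fun j => (n j : ℝ) ^ 2) (fun _ _ => sq_nonneg _)
    (Finset.mem_univ j)
  have h2 : normSq n = ∑ j, (n j : ℝ) ^ 2 := rfl
  linarith

theorem summable_jbFreq_rpow {q : ℝ} (hq : 2 < q) : Summable fun n : Freq => jbFreq n ^ (-q) := by
  refine Summable.of_norm_bounded_eventually (EisensteinSeries.summable_one_div_norm_rpow hq) ?_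
  refine (Set.finite_singleton (0 : Freq)).subset fun n hn => ?_
  by_contra h0
  refine hn ?_
  have hpos : 0 < ‖n‖ := norm_pos_iff.2 h0
  have := jbFreq_pos n
  show ‖jbFreq n ^ (-q)‖ ≤ ‖n‖ ^ (-q)
  rw [Real.norm_of_nonneg (by positivity)]
  exact Real.rpow_le_rpow_of_nonpos hpos (norm_le_jbFreq n) (by linarith)

theorem tsum_jbFreq_rpow_ne_top {q : ℝ} (hq : 2 < q) :
    ∑' n : Freq, ENNReal.ofReal (jbFreq n ^ (-q)) ≠ ⊤ := by
  rw [← ENNReal.ofReal_tsum_of_nonneg (fun n => Real.rpow_nonneg (jbFreq_pos n).le _)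
    (summable_jbFreq_rpow hq)]
  exact ENNReal.ofReal_ne_top

/-! ### Counting frequency triples near a paraboloid. -/

/-- The size of a triple of frequencies that adds up to zero, two of which are given. -/
def tripleSq (n n₁ : Freq) : ℝ := 1 + normSq n + normSq n₁ + normSq (-n - n₁)

theorem one_le_tripleSq (n n₁ : Freq) : 1 ≤ tripleSq n n₁ := by
  unfold tripleSq; linarith [normSq_nonneg n, normSq_nonneg n₁, normSq_nonneg (-n - n₁)]

theorem tripleSq_comm (n n₁ : Freq) : tripleSq n n₁ = tripleSq n₁ n := by
  unfold tripleSq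
  rw [show -n - n₁ = -n₁ - n by abel]; ring

theorem tripleSq_third (n n₁ : Freq) : tripleSq n (-n - n₁) = tripleSq n n₁ := by
  unfold tripleSq
  rw [show -n - (-n - n₁) = n₁ by abel]; ring

/-- The number of lattice points near a circle, weighted. -/
theorem exists_tsum_tripleSq_le {p e : ℝ} (hp : 1 < p) (he : 0 < e) :
    ∃ C : ℝ≥0∞, C ≠ ⊤ ∧ ∀ (n : Freq) (c : ℝ),
      ∑' n₁ : Freq, ENNReal.ofReal (tripleSq n n₁ ^ (-e)) *
        ENNReal.ofReal (jb (c - normSq n₁ - normSq (-n - n₁)) ^ (-p)) ≤ C := by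
  obtain ⟨C₁, hC₁, h₁⟩ := exists_card_normSq_eq_le he
  obtain ⟨C₂, hC₂, h₂⟩ := exists_tsum_jb_sub_half_le hp
  refine ⟨ENNReal.ofReal (C₁ * 2 ^ e) * C₂, ENNReal.mul_ne_top ENNReal.ofReal_ne_top hC₂,
    fun n c => ?_⟩
  -- By the parallelogram law |n₁|² + |n + n₁|² depends on n₁ only through m = |n + 2n₁|². The sum
  -- is grouped by m: each fibre lies on a circle, its O((1 + m)^e) points are absorbed by the
  -- negative power of the triple, which is at least (1 + m)/2, and the sum over m converges since p
  -- > 1.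
  set w : Freq → Freq := fun n₁ j => n j + 2 * n₁ j with hw
  set m : Freq → ℕ := fun n₁ => ((w n₁ 0) ^ 2 + (w n₁ 1) ^ 2).toNat with hm
  have hwm : ∀ n₁, normSq (w n₁) = m n₁ := by
    intro n₁
    have h0 : (0 : ℤ) ≤ (w n₁ 0) ^ 2 + (w n₁ 1) ^ 2 := by positivity
    have : ((m n₁ : ℤ) : ℝ) = (((w n₁ 0) ^ 2 + (w n₁ 1) ^ 2 : ℤ) : ℝ) := by
      rw [hm]; exact_mod_cast Int.toNat_of_nonneg h0
    rw [Int.cast_natCast] at this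
    rw [this, normSq, Fin.sum_univ_two]
    push_cast; rfl
  have hid : ∀ n₁, normSq n₁ + normSq (-n - n₁) = normSq n / 2 + (m n₁ : ℝ) / 2 := by
    intro n₁
    rw [← hwm]
    simp only [normSq, hw, Fin.sum_univ_two, Pi.sub_apply, Pi.neg_apply]
    push_cast; ring
  have hinj : Function.Injective w := by
    intro a b hab
    ext j
    have := congrFun hab j
    simp only [hw] at this
    omega
  rw [← ENNReal.tsum_fiberwise _ m]
  have hfib : ∀ k : ℕ, ∑' b : ↑(m ⁻¹' {k}), ENNReal.ofReal (tripleSq n b ^ (-e)) *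
      ENNReal.ofReal (jb (c - normSq b - normSq (-n - b)) ^ (-p)) ≤
      ENNReal.ofReal (C₁ * 2 ^ e) * ENNReal.ofReal (jb (c - normSq n / 2 - k / 2) ^ (-p)) := by
    intro k
    have hk0 : (0 : ℝ) < 1 + k := by positivity
    have hpt : ∀ b : ↑(m ⁻¹' {k}), ENNReal.ofReal (tripleSq n b ^ (-e)) *
      ENNReal.ofReal (jb (c - normSq b - normSq (-n - b)) ^ (-p)) ≤
        ENNReal.ofReal (2 ^ e * (1 + k) ^ (-e)) *
          ENNReal.ofReal (jb (c - normSq n / 2 - k / 2) ^ (-p)) := by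
      rintro ⟨b, hb⟩
      have hb' : m b = k := hb
      have h := hid b
      rw [hb'] at h
      have e1 : c - normSq b - normSq (-n - b) = c - normSq n / 2 - k / 2 := by linarith
      dsimp only
      rw [e1]
      gcongr
      calc tripleSq n b ^ (-e) ≤ ((1 + k) / 2) ^ (-e) := by
            refine Real.rpow_le_rpow_of_nonpos (by positivity) ?_ (by linarith)
            unfold tripleSq
            linarith [normSq_nonneg n]
        _ = _ := by
          rw [Real.div_rpow hk0.le (by norm_num), Real.rpow_neg (by norm_num : (0 : ℝ) ≤ 2),
            div_inv_eq_mul, mul_comm]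
    refine (ENNReal.tsum_le_tsum hpt).trans ?_
    rw [ENNReal.tsum_mul_right]
    gcongr
    rw [ENNReal.tsum_eq_iSup_sum]
    refine iSup_le fun F => ?_
    rw [Finset.sum_const, nsmul_eq_mul, ← ENNReal.ofReal_natCast, ← ENNReal.ofReal_mul (by positivity)]
    refine ENNReal.ofReal_le_ofReal ?_
    have hcard : (F.card : ℝ) ≤ C₁ * (1 + k) ^ e := by
      classical
      have := h₁ k (F.image (w ∘ Subtype.val)) (by
        intro v hv
        obtain ⟨b, _, rfl⟩ := Finset.mem_image.1 hv
        rw [Function.comp_apply, hwm, b.2])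
      rwa [Finset.card_image_of_injective _ (hinj.comp Subtype.val_injective)] at this
    calc (F.card : ℝ) * (2 ^ e * (1 + k) ^ (-e))
        ≤ C₁ * (1 + k) ^ e * (2 ^ e * (1 + k) ^ (-e)) := by gcongr
      _ = C₁ * 2 ^ e * ((1 + k) ^ e * (1 + k) ^ (-e)) := by ring
      _ = _ := by rw [← Real.rpow_add hk0]; simp
  calc _ ≤ _ := ENNReal.tsum_le_tsum hfib
    _ ≤ _ := by
      rw [ENNReal.tsum_mul_left]
      gcongr
      exact h₂ _

/-- The lattice point count behind the bilinear Strichartz estimate. -/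
theorem exists_tsum_lintegral_tripleSq_le {p e : ℝ} (hp : 1 < p) (he : 0 < e) :
    ∃ C : ℝ≥0∞, C ≠ ⊤ ∧ ∀ (n : Freq) (τ : ℝ),
      ∑' n₁ : Freq, ∫⁻ q : ℝ × ℝ, ENNReal.ofReal (tripleSq n n₁ ^ (-e)) *
        (ENNReal.ofReal (jb (modulation n₁ q.1) ^ (-p)) *
          (ENNReal.ofReal (jb (modulation (-n - n₁) q.2) ^ (-p)) *
            ENNReal.ofReal (jb (τ + q.1 + q.2) ^ (-p)))) ≤ C := by
  obtain ⟨C₁, hC₁, h₁⟩ := exists_lintegral_jb_mul_jb_le hp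
  obtain ⟨C₂, hC₂, h₂⟩ := exists_tsum_tripleSq_le hp he
  refine ⟨C₁ * C₁ * C₂, ENNReal.mul_ne_top (ENNReal.mul_ne_top hC₁ hC₁) hC₂, fun n τ => ?_⟩
  -- Integrating in q.2 and then in q.1 convolves the three brackets into one, centred where τ =
  -- |n₁|² + |n + n₁|².
  have hin : ∀ n₁ : Freq, ∫⁻ q : ℝ × ℝ, ENNReal.ofReal (tripleSq n n₁ ^ (-e)) *
        (ENNReal.ofReal (jb (modulation n₁ q.1) ^ (-p)) *
          (ENNReal.ofReal (jb (modulation (-n - n₁) q.2) ^ (-p)) *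
            ENNReal.ofReal (jb (τ + q.1 + q.2) ^ (-p)))) ≤
      C₁ * C₁ * (ENNReal.ofReal (tripleSq n n₁ ^ (-e)) *
        ENNReal.ofReal (jb (τ - normSq n₁ - normSq (-n - n₁)) ^ (-p))) := by
    intro n₁
    unfold modulation
    rw [lintegral_const_mul _ (by fun_prop), Measure.volume_eq_prod,
      lintegral_prod _ (by fun_prop)]
    dsimp only
    calc _ ≤ ENNReal.ofReal (tripleSq n n₁ ^ (-e)) *
          ∫⁻ x, ENNReal.ofReal (jb (x + normSq n₁) ^ (-p)) *
            (C₁ * ENNReal.ofReal (jb (x + (τ - normSq (-n - n₁))) ^ (-p))) := by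
          gcongr with x
          rw [lintegral_const_mul _ (by fun_prop)]
          gcongr
          have := h₁ (normSq (-n - n₁)) (τ + x)
          rw [jb_sub_comm] at this
          calc _ = _ := lintegral_congr fun y => by rw [add_comm (τ + x) y]
            _ ≤ _ := this
            _ = _ := by congr 4; ring
      _ = ENNReal.ofReal (tripleSq n n₁ ^ (-e)) * (C₁ *
          ∫⁻ x, ENNReal.ofReal (jb (x + normSq n₁) ^ (-p)) *
            ENNReal.ofReal (jb (x + (τ - normSq (-n - n₁))) ^ (-p))) := by
          rw [← lintegral_const_mul C₁ (by fun_prop)]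
          congr 1; exact lintegral_congr fun x => by ring
      _ ≤ ENNReal.ofReal (tripleSq n n₁ ^ (-e)) * (C₁ *
          (C₁ * ENNReal.ofReal (jb (normSq n₁ - (τ - normSq (-n - n₁))) ^ (-p)))) := by
          gcongr
          exact h₁ _ _
      _ = _ := by
          rw [jb_sub_comm, show τ - normSq (-n - n₁) - normSq n₁ =
            τ - normSq n₁ - normSq (-n - n₁) by ring]
          ring
  calc _ ≤ _ := ENNReal.tsum_le_tsum hin
    _ ≤ _ := by
      rw [ENNReal.tsum_mul_left]
      gcongr
      exact h₂ n τ

/-! ### Bilinear estimates for the model kernels. -/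

/-- Negative powers of the Japanese bracket, as extended nonnegative reals. -/
def jbE (p x : ℝ) : ℝ≥0∞ := ENNReal.ofReal (jb x ^ (-p))

/-- Negative powers of the size of a triple of frequencies. -/
def tripleE (e : ℝ) (n n₁ : Freq) : ℝ≥0∞ := ENNReal.ofReal (tripleSq n n₁ ^ (-e))

@[fun_prop]
theorem measurable_jbE (p : ℝ) : Measurable (jbE p) := by unfold jbE; fun_prop

theorem jbE_half_sq (p x : ℝ) : jbE (p / 2) x ^ 2 = jbE p x := by
  have := jb_pos x
  rw [jbE, jbE, ← ENNReal.ofReal_pow (by positivity), ← Real.rpow_natCast,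
    ← Real.rpow_mul (by positivity)]
  congr 2; push_cast; ring

theorem tripleE_half_sq (e : ℝ) (n n₁ : Freq) : tripleE (e / 2) n n₁ ^ 2 = tripleE e n n₁ := by
  have := one_le_tripleSq n n₁
  have h0 : 0 ≤ tripleSq n n₁ := by linarith
  rw [tripleE, tripleE, ← ENNReal.ofReal_pow (by positivity), ← Real.rpow_natCast,
    ← Real.rpow_mul (by positivity)]
  congr 2; push_cast; ring

/-- The integral of a negative power of the Japanese bracket. -/
def jbMass (p : ℝ) : ℝ≥0∞ := ∫⁻ x, jbE p x

theorem jbMass_ne_top {p : ℝ} (hp : 1 < p) : jbMass p ≠ ⊤ := (lintegral_jb_rpow_lt_top hp).ne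

theorem lintegral_jbE_add (p c : ℝ) : ∫⁻ x, jbE p (x + c) = jbMass p := lintegral_jb_add_rpow p c

theorem lintegral_jbE_add' (p c : ℝ) : ∫⁻ x, jbE p (c + x) = jbMass p := by
  simp_rw [add_comm c]; exact lintegral_jb_add_rpow p c

theorem lintegral_jbE_modulation (p : ℝ) (n : Freq) :
    ∫⁻ τ, jbE p (modulation n τ) = jbMass p := lintegral_jb_add_rpow p (normSq n)

@[fun_prop]
theorem measurable_modulation (n : Freq) : Measurable (modulation n) := by
  unfold modulation; fun_prop

/-- The square of the norm of `ℓ²_n L²_τ`. -/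
def sqNorm (F : Freq → ℝ → ℝ≥0∞) : ℝ≥0∞ := ∑' n, ∫⁻ τ, F n τ ^ 2

/-- The square of the norm of `ℓ²_n L¹_τ`. -/
def sqNormOne (F : Freq → ℝ → ℝ≥0∞) : ℝ≥0∞ := ∑' n, (∫⁻ τ, F n τ) ^ 2

theorem tsum_tsum_conv (a b : Freq → ℝ≥0∞) :
    ∑' n, ∑' n₁, a n₁ * b (-n - n₁) = (∑' n, a n) * ∑' n, b n := by
  rw [ENNReal.tsum_comm]
  simp_rw [ENNReal.tsum_mul_left, tsum_neg_sub' _ b]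
  rw [ENNReal.tsum_mul_right]

/-- Tonelli: integrating first in τ leaves the mass of the kernel, and the remaining convolution
over frequencies factorizes. -/
theorem tsum_lintegral_conv {F G : Freq → ℝ → ℝ≥0∞} (hF : ∀ n, Measurable (F n))
    (hG : ∀ n, Measurable (G n)) (p : ℝ) :
    ∑' n, ∫⁻ τ, ∑' n₁, ∫⁻ q : ℝ × ℝ, jbE p (τ + q.1 + q.2) * (F n₁ q.1 * G (-n - n₁) q.2) =
      jbMass p * ((∑' n, ∫⁻ τ, F n τ) * ∑' n, ∫⁻ τ, G n τ) := by
  rw [← tsum_tsum_conv, ← ENNReal.tsum_mul_left]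
  refine tsum_congr fun n => ?_
  rw [lintegral_tsum, ← ENNReal.tsum_mul_left]
  · refine tsum_congr fun n₁ => ?_
    have h1 := hF n₁
    have h2 := hG (-n - n₁)
    rw [lintegral_lintegral_swap (by fun_prop)]
    calc _ = ∫⁻ q : ℝ × ℝ, jbMass p * (F n₁ q.1 * G (-n - n₁) q.2) := by
          refine lintegral_congr fun q => ?_
          rw [lintegral_mul_const _ (by fun_prop)]
          simp_rw [add_assoc]
          rw [lintegral_jbE_add]
      _ = _ := by
          rw [lintegral_const_mul _ (by fun_prop), Measure.volume_eq_prod,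
            lintegral_prod_mul h1.aemeasurable h2.aemeasurable]
  · intro n₁
    have h1 := hF n₁
    have h2 := hG (-n - n₁)
    exact (Measurable.lintegral_prod_right' (f := fun z : ℝ × ℝ × ℝ =>
      jbE p (z.1 + z.2.1 + z.2.2) * (F n₁ z.2.1 * G (-n - n₁) z.2.2)) (by fun_prop)).aemeasurable

theorem lintegral_conv_fst {G : ℝ → ℝ≥0∞} (hG : Measurable G) (p τ : ℝ) :
    ∫⁻ q : ℝ × ℝ, jbE p (τ + q.1 + q.2) * G q.2 = jbMass p * ∫⁻ y, G y := by
  rw [Measure.volume_eq_prod, lintegral_prod_symm _ (by fun_prop)]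
  dsimp only
  rw [← lintegral_const_mul _ hG]
  refine lintegral_congr fun y => ?_
  rw [lintegral_mul_const _ (by fun_prop)]
  simp_rw [add_right_comm τ _ y]
  rw [lintegral_jbE_add']

theorem lintegral_conv_snd {F : ℝ → ℝ≥0∞} (hF : Measurable F) (p τ : ℝ) :
    ∫⁻ q : ℝ × ℝ, jbE p (τ + q.1 + q.2) * F q.1 = jbMass p * ∫⁻ y, F y := by
  rw [Measure.volume_eq_prod, lintegral_prod _ (by fun_prop)]
  dsimp only
  rw [← lintegral_const_mul _ hF]
  refine lintegral_congr fun y => ?_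
  rw [lintegral_mul_const _ (by fun_prop), lintegral_jbE_add']

/-- A Cauchy–Schwarz bound for bilinear forms whose kernel is a product of a weight and a
convolution kernel. -/
theorem tsum_lintegral_kernel_sq_le {p : ℝ} {F G : Freq → ℝ → ℝ≥0∞}
    (hF : ∀ n, Measurable (F n)) (hG : ∀ n, Measurable (G n))
    {w : Freq → ℝ → Freq → ℝ × ℝ → ℝ≥0∞} (hw : ∀ n τ n₁, Measurable (w n τ n₁)) {C : ℝ≥0∞}
    (hC : ∀ n τ, ∑' n₁, ∫⁻ q : ℝ × ℝ, w n τ n₁ q ^ 2 * jbE p (τ + q.1 + q.2) ≤ C) :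
    ∑' n, ∫⁻ τ, (∑' n₁, ∫⁻ q : ℝ × ℝ, (w n τ n₁ q * jbE p (τ + q.1 + q.2)) *
      (F n₁ q.1 * G (-n - n₁) q.2)) ^ 2 ≤ C * jbMass p * (sqNorm F * sqNorm G) := by
  -- The kernel is split into two square roots. One goes with the weight, whose square is then
  -- summed uniformly in (n, τ) by `hC`; the other goes with the inputs and disappears on
  -- integrating in τ.
  have hpt : ∀ n τ, (∑' n₁, ∫⁻ q : ℝ × ℝ, (w n τ n₁ q * jbE p (τ + q.1 + q.2)) *
      (F n₁ q.1 * G (-n - n₁) q.2)) ^ 2 ≤ C * ∑' n₁, ∫⁻ q : ℝ × ℝ,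
        jbE p (τ + q.1 + q.2) * (F n₁ q.1 ^ 2 * G (-n - n₁) q.2 ^ 2) := by
    intro n τ
    calc _ = (∑' n₁, ∫⁻ q : ℝ × ℝ, (w n τ n₁ q * jbE (p / 2) (τ + q.1 + q.2)) *
          (jbE (p / 2) (τ + q.1 + q.2) * (F n₁ q.1 * G (-n - n₁) q.2))) ^ 2 := by
          congr 1
          refine tsum_congr fun n₁ => lintegral_congr fun q => ?_
          rw [← jbE_half_sq]; ring
      _ ≤ _ := tsum_lintegral_mul_sq_le _
          (fun n₁ => by have := hw n τ n₁; fun_prop)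
          (fun n₁ => by have := hF n₁; have := hG (-n - n₁); fun_prop)
      _ ≤ _ := by
          simp_rw [mul_pow, jbE_half_sq]
          exact mul_le_mul_left (hC n τ) _
  calc _ ≤ ∑' n, ∫⁻ τ, C * ∑' n₁, ∫⁻ q : ℝ × ℝ,
        jbE p (τ + q.1 + q.2) * (F n₁ q.1 ^ 2 * G (-n - n₁) q.2 ^ 2) :=
        ENNReal.tsum_le_tsum fun n => lintegral_mono fun τ => hpt n τ
    _ = C * ∑' n, ∫⁻ τ, ∑' n₁, ∫⁻ q : ℝ × ℝ,
        jbE p (τ + q.1 + q.2) * (F n₁ q.1 ^ 2 * G (-n - n₁) q.2 ^ 2) := by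
        rw [← ENNReal.tsum_mul_left]
        refine tsum_congr fun n => lintegral_const_mul _ ?_
        refine Measurable.tsum fun n₁ => ?_
        have h1 := hF n₁
        have h2 := hG (-n - n₁)
        exact Measurable.lintegral_prod_right' (f := fun z : ℝ × ℝ × ℝ =>
          jbE p (z.1 + z.2.1 + z.2.2) * (F n₁ z.2.1 ^ 2 * G (-n - n₁) z.2.2 ^ 2)) (by fun_prop)
    _ = _ := by
        rw [tsum_lintegral_conv (fun n => (hF n).pow_const 2) (fun n => (hG n).pow_const 2),
          mul_assoc]
        rfl

/-- The bilinear Strichartz estimate for two inputs of low modulation. -/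
theorem exists_strichartz_le {p e : ℝ} (hp : 1 < p) (he : 0 < e) :
    ∃ C : ℝ≥0∞, C ≠ ⊤ ∧ ∀ F G : Freq → ℝ → ℝ≥0∞, (∀ n, Measurable (F n)) →
      (∀ n, Measurable (G n)) →
      ∑' n, ∫⁻ τ, (∑' n₁, ∫⁻ q : ℝ × ℝ, ((tripleE (e / 2) n n₁ *
        (jbE (p / 2) (modulation n₁ q.1) * jbE (p / 2) (modulation (-n - n₁) q.2))) *
          jbE p (τ + q.1 + q.2)) * (F n₁ q.1 * G (-n - n₁) q.2)) ^ 2 ≤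
      C * (sqNorm F * sqNorm G) := by
  obtain ⟨C, hC, h⟩ := exists_tsum_lintegral_tripleSq_le hp he
  refine ⟨C * jbMass p, ENNReal.mul_ne_top hC (jbMass_ne_top hp), fun F G hF hG => ?_⟩
  refine tsum_lintegral_kernel_sq_le (w := fun n τ n₁ q => tripleE (e / 2) n n₁ *
        (jbE (p / 2) (modulation n₁ q.1) * jbE (p / 2) (modulation (-n - n₁) q.2)))
    hF hG (fun n τ n₁ => by fun_prop) fun n τ => ?_
  simp_rw [mul_pow, jbE_half_sq, tripleE_half_sq, mul_assoc]
  exact h n τ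

/-- The estimate for one input of high and one of low modulation and a weight that is square
summable over the intermediate frequency. -/
theorem tsum_lintegral_weight_sq_le {p : ℝ} {F G : Freq → ℝ → ℝ≥0∞}
    (hF : ∀ n, Measurable (F n)) (hG : ∀ n, Measurable (G n)) {M : Freq → Freq → ℝ≥0∞}
    {C : ℝ≥0∞} (hM : ∀ n, ∑' n₁, M n n₁ ^ 2 ≤ C) :
    ∑' n, ∫⁻ τ, (∑' n₁, ∫⁻ q : ℝ × ℝ, ((M n n₁ * jbE (p / 2) (modulation (-n - n₁) q.2)) *
      jbE p (τ + q.1 + q.2)) * (F n₁ q.1 * G (-n - n₁) q.2)) ^ 2 ≤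
      C * jbMass p * jbMass p * jbMass p * (sqNorm F * sqNorm G) := by
  refine tsum_lintegral_kernel_sq_le
    (w := fun n τ n₁ q => M n n₁ * jbE (p / 2) (modulation (-n - n₁) q.2))
    hF hG (fun n τ n₁ => by fun_prop) fun n τ => ?_
  simp_rw [mul_pow, jbE_half_sq]
  calc _ = ∑' n₁, M n n₁ ^ 2 * (jbMass p * jbMass p) := by
        refine tsum_congr fun n₁ => ?_
        simp_rw [mul_assoc]
        rw [lintegral_const_mul _ (by fun_prop)]
        simp_rw [mul_comm (jbE p (modulation _ _))]
        rw [lintegral_conv_fst (G := fun y => jbE p (modulation (-n - n₁) y)) (by fun_prop),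
          lintegral_jbE_modulation]
    _ ≤ _ := by
        rw [ENNReal.tsum_mul_right, mul_assoc]
        exact mul_le_mul_left (hM n) _

/-- The estimate for two inputs of high modulation. -/
theorem tsum_lintegral_high_high_sq_le {p : ℝ} {F G : Freq → ℝ → ℝ≥0∞}
    (hF : ∀ n, Measurable (F n)) (hG : ∀ n, Measurable (G n)) {M : Freq → Freq → ℝ≥0∞}
    {C : ℝ≥0∞} (hM : ∀ n, ∑' n₁, M n n₁ ^ 2 ≤ C) :
    ∑' n, ∫⁻ τ, (∑' n₁, ∫⁻ q : ℝ × ℝ, ((jbE (p / 2) (modulation n τ) * M n n₁) *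
      jbE p (τ + q.1 + q.2)) * (F n₁ q.1 * G (-n - n₁) q.2)) ^ 2 ≤
      C * jbMass p * jbMass p * jbMass p * (sqNorm F * sqNorm G) := by
  set f : Freq → ℝ≥0∞ := fun n => ∫⁻ x, F n x ^ 2 with hf
  set g : Freq → ℝ≥0∞ := fun n => ∫⁻ x, G n x ^ 2 with hg
  have hpt : ∀ n τ, (∑' n₁, ∫⁻ q : ℝ × ℝ, ((jbE (p / 2) (modulation n τ) * M n n₁) *
      jbE p (τ + q.1 + q.2)) * (F n₁ q.1 * G (-n - n₁) q.2)) ^ 2 ≤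
      jbE p (modulation n τ) * (C * (jbMass p * jbMass p * ∑' n₁, f n₁ * g (-n - n₁))) := by
    intro n τ
    -- Cauchy–Schwarz is applied twice: in q, with half of the kernel attached to each input, and
    -- then in n₁ against `M`. The bounds no longer depend on τ, and the output bracket makes the
    -- τ-integral finite.
    set D : Freq → ℝ≥0∞ := fun n₁ => ∫⁻ q : ℝ × ℝ,
      (jbE (p / 2) (τ + q.1 + q.2) * F n₁ q.1) *
        (jbE (p / 2) (τ + q.1 + q.2) * G (-n - n₁) q.2) with hD
    have e : (∑' n₁, ∫⁻ q : ℝ × ℝ, ((jbE (p / 2) (modulation n τ) * M n n₁) *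
      jbE p (τ + q.1 + q.2)) * (F n₁ q.1 * G (-n - n₁) q.2)) =
        jbE (p / 2) (modulation n τ) * ∑' n₁, M n n₁ * D n₁ := by
      rw [← ENNReal.tsum_mul_left]
      refine tsum_congr fun n₁ => ?_
      have h1 := hF n₁
      have h2 := hG (-n - n₁)
      rw [hD, ← mul_assoc, ← lintegral_const_mul _ (by fun_prop)]
      refine lintegral_congr fun q => ?_
      rw [← jbE_half_sq p (τ + q.1 + q.2)]; ring
    have hD2 : ∀ n₁, D n₁ ^ 2 ≤ jbMass p * jbMass p * (f n₁ * g (-n - n₁)) := by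
      intro n₁
      have h1 := hF n₁
      have h2 := hG (-n - n₁)
      refine (lintegral_mul_sq_le _ (by fun_prop) (by fun_prop)).trans_eq ?_
      simp_rw [mul_pow, jbE_half_sq]
      rw [lintegral_conv_snd (F := fun x => F n₁ x ^ 2) (by fun_prop),
        lintegral_conv_fst (G := fun x => G (-n - n₁) x ^ 2) (by fun_prop), hf, hg]
      ring
    rw [e, mul_pow, jbE_half_sq]
    refine mul_le_mul_right ((tsum_mul_sq_le _ _).trans (mul_le_mul' (hM n) ?_)) _
    rw [← ENNReal.tsum_mul_left]
    exact ENNReal.tsum_le_tsum hD2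
  calc _ ≤ ∑' n, ∫⁻ τ, jbE p (modulation n τ) *
        (C * (jbMass p * jbMass p * ∑' n₁, f n₁ * g (-n - n₁))) :=
        ENNReal.tsum_le_tsum fun n => lintegral_mono fun τ => hpt n τ
    _ = ∑' n, (C * jbMass p * jbMass p * jbMass p) * ∑' n₁, f n₁ * g (-n - n₁) := by
        refine tsum_congr fun n => ?_
        rw [lintegral_mul_const _ (by fun_prop), lintegral_jbE_modulation]
        ring
    _ = _ := by rw [ENNReal.tsum_mul_left, tsum_tsum_conv]; rfl

/-- The dual bilinear Strichartz estimate, for one input of low modulation and an output that is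
weighted in the modulation. -/
theorem exists_strichartz_dual_le {p e : ℝ} (hp : 1 < p) (he : 0 < e) :
    ∃ C : ℝ≥0∞, C ≠ ⊤ ∧ ∀ F G : Freq → ℝ → ℝ≥0∞, (∀ n, Measurable (F n)) →
      (∀ n, Measurable (G n)) →
      ∑' n, ∫⁻ τ, (∑' n₁, ∫⁻ q : ℝ × ℝ, ((jbE (p / 2) (modulation n τ) * (tripleE (e / 2) n n₁ *
        jbE (p / 2) (modulation (-n - n₁) q.2))) *
          jbE p (τ + q.1 + q.2)) * (F n₁ q.1 * G (-n - n₁) q.2)) ^ 2 ≤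
      C * (sqNorm F * sqNorm G) := by
  obtain ⟨C, hC, h⟩ := exists_tsum_lintegral_tripleSq_le hp he
  refine ⟨C * jbMass p, ENNReal.mul_ne_top hC (jbMass_ne_top hp), fun F G hF hG => ?_⟩
  -- Here the weight stays with `F`, and `G` is isolated with half of the kernel, so that its factor
  -- is already the full norm of `G`, uniformly in (n, τ).
  have hpt : ∀ n τ, (∑' n₁, ∫⁻ q : ℝ × ℝ, ((jbE (p / 2) (modulation n τ) * (tripleE (e / 2) n n₁ *
        jbE (p / 2) (modulation (-n - n₁) q.2))) *
          jbE p (τ + q.1 + q.2)) * (F n₁ q.1 * G (-n - n₁) q.2)) ^ 2 ≤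
      (jbMass p * sqNorm G) * ∑' n₁, ∫⁻ q : ℝ × ℝ, F n₁ q.1 ^ 2 * (tripleE e n n₁ *
        (jbE p (modulation n τ) * (jbE p (modulation (-n - n₁) q.2) *
          jbE p (τ + q.1 + q.2)))) := by
    intro n τ
    calc _ = (∑' n₁, ∫⁻ q : ℝ × ℝ, (jbE (p / 2) (τ + q.1 + q.2) * G (-n - n₁) q.2) *
          ((jbE (p / 2) (modulation n τ) * (tripleE (e / 2) n n₁ *
            jbE (p / 2) (modulation (-n - n₁) q.2))) *
              (jbE (p / 2) (τ + q.1 + q.2) * F n₁ q.1))) ^ 2 := by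
          congr 1
          refine tsum_congr fun n₁ => lintegral_congr fun q => ?_
          rw [← jbE_half_sq p (τ + q.1 + q.2)]; ring
      _ ≤ _ := tsum_lintegral_mul_sq_le _
          (fun n₁ => by have := hG (-n - n₁); fun_prop) (fun n₁ => by have := hF n₁; fun_prop)
      _ = _ := by
          simp_rw [mul_pow, jbE_half_sq, tripleE_half_sq]
          congr 1
          · calc _ = ∑' n₁, jbMass p * ∫⁻ y, G (-n - n₁) y ^ 2 := tsum_congr fun n₁ =>
                  lintegral_conv_fst (G := fun x => G (-n - n₁) x ^ 2) ((hG _).pow_const 2) p τ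
              _ = _ := by
                rw [ENNReal.tsum_mul_left, tsum_neg_sub n fun m => ∫⁻ y, G m y ^ 2]
                rfl
          · refine tsum_congr fun n₁ => lintegral_congr fun q => ?_
            ring
  have hmeas : ∀ n n₁, Measurable fun z : ℝ × ℝ × ℝ => F n₁ z.2.1 ^ 2 * (tripleE e n n₁ *
        (jbE p (modulation n z.1) * (jbE p (modulation (-n - n₁) z.2.2) *
          jbE p (z.1 + z.2.1 + z.2.2)))) := by
    intro n n₁
    have := hF n₁
    fun_prop
  calc _ ≤ ∑' n, ∫⁻ τ, (jbMass p * sqNorm G) * ∑' n₁, ∫⁻ q : ℝ × ℝ, F n₁ q.1 ^ 2 *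
        (tripleE e n n₁ * (jbE p (modulation n τ) * (jbE p (modulation (-n - n₁) q.2) *
          jbE p (τ + q.1 + q.2)))) :=
        ENNReal.tsum_le_tsum fun n => lintegral_mono fun τ => hpt n τ
    _ = (jbMass p * sqNorm G) * ∑' n, ∑' n₁, ∫⁻ τ, ∫⁻ q : ℝ × ℝ, F n₁ q.1 ^ 2 *
        (tripleE e n n₁ * (jbE p (modulation n τ) * (jbE p (modulation (-n - n₁) q.2) *
          jbE p (τ + q.1 + q.2)))) := by
        rw [← ENNReal.tsum_mul_left]
        refine tsum_congr fun n => ?_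
        rw [lintegral_const_mul, lintegral_tsum]
        · exact fun n₁ => (hmeas n n₁).lintegral_prod_right'.aemeasurable
        · exact Measurable.tsum fun n₁ => (hmeas n n₁).lintegral_prod_right'
    -- Tonelli puts (n₁, x) outermost. The triple is symmetric in its frequencies, so the lattice
    -- point count applies with n₁ fixed and n as summation variable.
    _ = (jbMass p * sqNorm G) * ∑' n₁, ∫⁻ x, F n₁ x ^ 2 * ∑' n, ∫⁻ q : ℝ × ℝ,
        tripleE e n₁ n * (jbE p (modulation n q.1) * (jbE p (modulation (-n₁ - n) q.2) *
          jbE p (x + q.1 + q.2))) := by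
        rw [ENNReal.tsum_comm]
        congr 1
        refine tsum_congr fun n₁ => ?_
        have h1 := hF n₁
        simp_rw [← ENNReal.tsum_mul_left]
        rw [lintegral_tsum]
        · refine tsum_congr fun n => ?_
          have hz := hmeas n n₁
          calc _ = ∫⁻ τ, ∫⁻ x, ∫⁻ y, F n₁ x ^ 2 * (tripleE e n n₁ *
                (jbE p (modulation n τ) * (jbE p (modulation (-n - n₁) y) *
                  jbE p (τ + x + y)))) := by
                refine lintegral_congr fun τ => ?_
                rw [Measure.volume_eq_prod, lintegral_prod _ (by fun_prop)]
            _ = ∫⁻ x, ∫⁻ τ, ∫⁻ y, F n₁ x ^ 2 * (tripleE e n n₁ *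
                (jbE p (modulation n τ) * (jbE p (modulation (-n - n₁) y) *
                  jbE p (τ + x + y)))) := by
                refine lintegral_lintegral_swap ?_
                exact (Measurable.lintegral_prod_right' (f := fun z : (ℝ × ℝ) × ℝ =>
                  F n₁ z.1.2 ^ 2 * (tripleE e n n₁ * (jbE p (modulation n z.1.1) *
                    (jbE p (modulation (-n - n₁) z.2) *
                      jbE p (z.1.1 + z.1.2 + z.2))))) (by fun_prop)).aemeasurable
            _ = _ := by
                refine lintegral_congr fun x => ?_
                rw [← lintegral_const_mul _ (by fun_prop), Measure.volume_eq_prod,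
                  lintegral_prod _ (by fun_prop)]
                refine lintegral_congr fun τ => lintegral_congr fun y => ?_
                rw [tripleE, tripleE, tripleSq_comm, show -n - n₁ = -n₁ - n by abel, add_comm τ x]
        · intro n
          refine Measurable.aemeasurable ?_
          refine (h1.pow_const 2).mul (Measurable.lintegral_prod_right' (f := fun z : ℝ × ℝ × ℝ =>
            tripleE e n₁ n * (jbE p (modulation n z.2.1) * (jbE p (modulation (-n₁ - n) z.2.2) *
              jbE p (z.1 + z.2.1 + z.2.2)))) (by fun_prop))
    _ ≤ (jbMass p * sqNorm G) * ∑' n₁, ∫⁻ x, F n₁ x ^ 2 * C := by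
        gcongr with n₁ x
        exact h n₁ x
    _ = _ := by
        have : ∀ n₁, ∫⁻ x, F n₁ x ^ 2 * C = (∫⁻ x, F n₁ x ^ 2) * C := fun n₁ =>
          lintegral_mul_const _ ((hF n₁).pow_const 2)
        simp_rw [this]
        rw [ENNReal.tsum_mul_right]
        simp only [sqNorm]
        ring

/-- Cauchy–Schwarz in n₁ gives a bound uniform in n. Summability over the output frequency has to
come from a separate weight. -/
theorem tsum_lintegral_prod_sq_le {F G : Freq → ℝ → ℝ≥0∞}
    (hF : ∀ n, Measurable (F n)) (hG : ∀ n, Measurable (G n)) (n : Freq) :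
    (∑' n₁, ∫⁻ q : ℝ × ℝ, F n₁ q.1 * G (-n - n₁) q.2) ^ 2 ≤ sqNormOne F * sqNormOne G := by
  have : ∀ n₁, ∫⁻ q : ℝ × ℝ, F n₁ q.1 * G (-n - n₁) q.2 =
      (∫⁻ x, F n₁ x) * ∫⁻ x, G (-n - n₁) x := fun n₁ => by
    rw [Measure.volume_eq_prod, lintegral_prod_mul (hF _).aemeasurable (hG _).aemeasurable]
  simp_rw [this]
  refine (tsum_mul_sq_le _ _).trans_eq ?_
  rw [tsum_neg_sub n fun m => (∫⁻ x, G m x) ^ 2]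
  rfl

/-- The estimate in `L²` for inputs in `L¹`. -/
theorem tsum_lintegral_one_one_sq_le {p : ℝ} {F G : Freq → ℝ → ℝ≥0∞}
    (hF : ∀ n, Measurable (F n)) (hG : ∀ n, Measurable (G n)) (m : Freq → ℝ≥0∞) :
    ∑' n, ∫⁻ τ, (∑' n₁, ∫⁻ q : ℝ × ℝ, (m n * jbE (p / 2) (modulation n τ)) *
      (F n₁ q.1 * G (-n - n₁) q.2)) ^ 2 ≤
      (∑' n, m n ^ 2) * jbMass p * (sqNormOne F * sqNormOne G) := by
  rw [← ENNReal.tsum_mul_right, ← ENNReal.tsum_mul_right]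
  refine ENNReal.tsum_le_tsum fun n => ?_
  rw [← lintegral_jbE_modulation p n, ← lintegral_const_mul _ (by fun_prop),
    ← lintegral_mul_const _ (by fun_prop)]
  refine lintegral_mono fun τ => ?_
  dsimp only
  rw [← jbE_half_sq p, ← mul_pow]
  calc _ = ((m n * jbE (p / 2) (modulation n τ)) *
        ∑' n₁, ∫⁻ q : ℝ × ℝ, F n₁ q.1 * G (-n - n₁) q.2) ^ 2 := by
        rw [← ENNReal.tsum_mul_left]
        congr 1
        refine tsum_congr fun n₁ => ?_
        have := hF n₁
        have := hG (-n - n₁)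
        rw [lintegral_const_mul _ (by fun_prop)]
    _ ≤ _ := by
        rw [mul_pow]
        exact mul_le_mul_right (tsum_lintegral_prod_sq_le hF hG n) _

/-- The estimate in `L¹` for inputs in `L¹`. -/
theorem tsum_lintegral_one_sq_le {p : ℝ} {F G : Freq → ℝ → ℝ≥0∞}
    (hF : ∀ n, Measurable (F n)) (hG : ∀ n, Measurable (G n)) (m : Freq → ℝ≥0∞) :
    ∑' n, (∫⁻ τ, ∑' n₁, ∫⁻ q : ℝ × ℝ, (m n * (jbE p (modulation n τ) + jbE p (τ + q.1 + q.2))) *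
      (F n₁ q.1 * G (-n - n₁) q.2)) ^ 2 ≤
      (∑' n, m n ^ 2) * (2 * jbMass p) ^ 2 * (sqNormOne F * sqNormOne G) := by
  rw [← ENNReal.tsum_mul_right, ← ENNReal.tsum_mul_right]
  refine ENNReal.tsum_le_tsum fun n => ?_
  have hmeas : ∀ n₁, Measurable fun z : ℝ × ℝ × ℝ => (m n * (jbE p (modulation n z.1) +
      jbE p (z.1 + z.2.1 + z.2.2))) * (F n₁ z.2.1 * G (-n - n₁) z.2.2) := by
    intro n₁
    have := hF n₁
    have := hG (-n - n₁)
    fun_prop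
  calc _ = (∑' n₁, (m n * (2 * jbMass p)) *
        ∫⁻ q : ℝ × ℝ, F n₁ q.1 * G (-n - n₁) q.2) ^ 2 := by
        rw [lintegral_tsum fun n₁ => (hmeas n₁).lintegral_prod_right'.aemeasurable]
        congr 1
        refine tsum_congr fun n₁ => ?_
        have h1 := hF n₁
        have h2 := hG (-n - n₁)
        rw [lintegral_lintegral_swap (hmeas n₁).aemeasurable,
          ← lintegral_const_mul _ (by fun_prop)]
        refine lintegral_congr fun q => ?_
        dsimp only
        rw [lintegral_mul_const _ (by fun_prop), lintegral_const_mul _ (by fun_prop),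
          lintegral_add_left (by fun_prop), lintegral_jbE_modulation]
        simp_rw [add_assoc]
        rw [lintegral_jbE_add, two_mul]
    _ ≤ _ := by
        rw [ENNReal.tsum_mul_left, mul_pow, mul_pow]
        exact mul_le_mul_right (tsum_lintegral_prod_sq_le hF hG n) _

/-! ### Pointwise bounds for the weights -/

/-- Negative powers of the Japanese bracket of a frequency. -/
def freqE (q : ℝ) (n : Freq) : ℝ≥0∞ := ENNReal.ofReal (jbFreq n ^ (-q))

open Classical in
/-- The weight of the inputs: `⟨n⟩^s ⟨σ⟩^{2/3}` at low and `⟨σ⟩^{s/2+2/3}` at high modulation. -/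
def inE (s : ℝ) (n : Freq) (τ : ℝ) : ℝ≥0∞ :=
  if |modulation n τ| < normSq n / 2 ^ 10 then
    freqE (-s) n * jbE (-(2 / 3)) (modulation n τ)
  else jbE (-(s / 2 + 2 / 3)) (modulation n τ)

open Classical in
/-- The weight of the output in `L²`. -/
def outE (s : ℝ) (n : Freq) (τ : ℝ) : ℝ≥0∞ :=
  if |modulation n τ| < normSq n / 2 ^ 10 then
    freqE (-s) n * jbE (1 / 3) (modulation n τ)
  else jbE (1 / 3 - s / 2) (modulation n τ)

/-- The part of the bilinear kernel in which the output carries the weight `⟨σ⟩^{-p/2}`. -/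
def highKernel (δ : ℝ) (n : Freq) (τ : ℝ) (n₁ : Freq) (q : ℝ × ℝ) : ℝ≥0∞ :=
  ((jbE ((1 + δ) / 2) (modulation n τ) * freqE (7 / 6) n₁) * jbE (1 + δ) (τ + q.1 + q.2) +
    (jbE ((1 + δ) / 2) (modulation n τ) * freqE (7 / 6) (-n - n₁)) * jbE (1 + δ) (τ + q.1 + q.2)) +
  ((jbE ((1 + δ) / 2) (modulation n τ) * (tripleE (2 * δ / 2) n n₁ *
      jbE ((1 + δ) / 2) (modulation (-n - n₁) q.2))) * jbE (1 + δ) (τ + q.1 + q.2) +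
    (jbE ((1 + δ) / 2) (modulation n τ) * (tripleE (2 * δ / 2) n n₁ *
      jbE ((1 + δ) / 2) (modulation n₁ q.1))) * jbE (1 + δ) (τ + q.1 + q.2))

/-- The remaining part of the bilinear kernel, which occurs for outputs of high modulation. -/
def lowKernel (δ : ℝ) (n : Freq) (τ : ℝ) (n₁ : Freq) (q : ℝ × ℝ) : ℝ≥0∞ :=
  (tripleE (2 * δ / 2) n n₁ * (jbE ((1 + δ) / 2) (modulation n₁ q.1) *
      jbE ((1 + δ) / 2) (modulation (-n - n₁) q.2))) * jbE (1 + δ) (τ + q.1 + q.2) +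
  ((freqE (7 / 6) n₁ * jbE ((1 + δ) / 2) (modulation (-n - n₁) q.2)) *
      jbE (1 + δ) (τ + q.1 + q.2) +
    (freqE (7 / 6) (-n - n₁) * jbE ((1 + δ) / 2) (modulation n₁ q.1)) *
      jbE (1 + δ) (τ + q.1 + q.2))

theorem jbE_eq_exp (p x : ℝ) : jbE p x = ENNReal.ofReal (Real.exp (-p * Real.log (jb x))) := by
  rw [jbE, Real.rpow_def_of_pos (jb_pos x), mul_comm]

theorem freqE_eq_exp (q : ℝ) (n : Freq) :
    freqE q n = ENNReal.ofReal (Real.exp (-q * Real.log (jbFreq n))) := by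
  rw [freqE, Real.rpow_def_of_pos (jbFreq_pos n), mul_comm]

theorem tripleE_eq_exp (e : ℝ) (n n₁ : Freq) :
    tripleE e n n₁ = ENNReal.ofReal (Real.exp (-e * Real.log (tripleSq n n₁))) := by
  rw [tripleE, Real.rpow_def_of_pos (by linarith [one_le_tripleSq n n₁]), mul_comm]

theorem ofReal_exp_mul (a b : ℝ) : ENNReal.ofReal (Real.exp a) * ENNReal.ofReal (Real.exp b) =
    ENNReal.ofReal (Real.exp (a + b)) := by
  rw [← ENNReal.ofReal_mul (Real.exp_pos a).le, Real.exp_add]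

/-- The linear inequalities between the logarithms of the weights, for the output in `L²`. -/
theorem log_weight_two_le {δ κ h a a₁ a₂ x x₁ x₂ r w v₁ v₂ : ℝ} (hδ : 0 < δ) (hδ' : δ ≤ 1 / 600)
    (hκ : 0 ≤ κ) (ha : 0 ≤ a) (ha₁ : 0 ≤ a₁) (ha₂ : 0 ≤ a₂) (hx : 0 ≤ x) (hx₁ : 0 ≤ x₁)
    (hx₂ : 0 ≤ x₂) (hr : 0 ≤ r) (hh : 2 * a ≤ h) (hh₁ : 2 * a₁ ≤ h) (hh₂ : 2 * a₂ ≤ h)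
    (hw : (w = (100 * δ - 2 / 3) * a - x / 3 ∧ x ≤ 2 * a) ∨
      (w = ((100 * δ - 2 / 3) / 2 - 1 / 3) * x ∧ 2 * a - κ ≤ x))
    (hv₁ : (v₁ = (100 * δ - 2 / 3) * a₁ + 2 / 3 * x₁ ∧ x₁ ≤ 2 * a₁) ∨
      (v₁ = ((100 * δ - 2 / 3) / 2 + 2 / 3) * x₁ ∧ 2 * a₁ - κ ≤ x₁))
    (hv₂ : (v₂ = (100 * δ - 2 / 3) * a₂ + 2 / 3 * x₂ ∧ x₂ ≤ 2 * a₂) ∨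
      (v₂ = ((100 * δ - 2 / 3) / 2 + 2 / 3) * x₂ ∧ 2 * a₂ - κ ≤ x₂))
    (hmax : h - κ ≤ 2 * a₁ ∨ h - κ ≤ 2 * a₂)
    (hres : h - κ ≤ r ∨ h - κ ≤ x ∨
      (h - κ ≤ x₁ ∧ v₁ = ((100 * δ - 2 / 3) / 2 + 2 / 3) * x₁ ∧ 2 * a₁ - κ ≤ x₁) ∨
      (h - κ ≤ x₂ ∧ v₂ = ((100 * δ - 2 / 3) / 2 + 2 / 3) * x₂ ∧ 2 * a₂ - κ ≤ x₂)) :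
    w - (1 - δ) * r - 4 * κ ≤ -(1 + δ) * a - (1 + δ) / 2 * x + (100 * δ - 2 / 3) * (a₁ + a₂) ∨
    (w - (1 - δ) * r - 4 * κ ≤ -δ * h - (1 + δ) / 2 * x₁ - (1 + δ) / 2 * x₂
        - (1 + δ) * r + (v₁ + v₂) ∨
      w - (1 - δ) * r - 4 * κ ≤ -(7 / 6) * a₁ - (1 + δ) / 2 * x₂ - (1 + δ) * r + (v₁ + v₂) ∨
      w - (1 - δ) * r - 4 * κ ≤ -(7 / 6) * a₂ - (1 + δ) / 2 * x₁ - (1 + δ) * r + (v₁ + v₂)) ∨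
    (w - (1 - δ) * r - 4 * κ ≤ -(1 + δ) / 2 * x - (7 / 6) * a₁ - (1 + δ) * r + (v₁ + v₂) ∨
      w - (1 - δ) * r - 4 * κ ≤ -(1 + δ) / 2 * x - (7 / 6) * a₂ - (1 + δ) * r + (v₁ + v₂) ∨
      w - (1 - δ) * r - 4 * κ ≤ -(1 + δ) / 2 * x - δ * h - (1 + δ) / 2 * x₂
        - (1 + δ) * r + (v₁ + v₂) ∨
      w - (1 - δ) * r - 4 * κ ≤ -(1 + δ) / 2 * x - δ * h - (1 + δ) / 2 * x₁
        - (1 + δ) * r + (v₁ + v₂)) := by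
  -- The letters are logarithms: a's of ⟨n⟩'s, x's of modulations, r of ⟨ρ⟩, h of the triple, κ of
  -- 4096. For `linarith` the products δ·b are separate atoms; `E` supplies the bounds 0 ≤ δb ≤
  -- b/600 that tie them to b.
  have E : ∀ {b : ℝ}, 0 ≤ b → 0 ≤ δ * b ∧ 0 ≤ (1 / 600 - δ) * b := fun hb =>
    ⟨mul_nonneg hδ.le hb, mul_nonneg (by linarith) hb⟩
  have hhn : 0 ≤ h := by linarith
  obtain ⟨e1, f1⟩ := E hκ
  obtain ⟨e2, f2⟩ := E ha
  obtain ⟨e3, f3⟩ := E ha₁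
  obtain ⟨e4, f4⟩ := E ha₂
  obtain ⟨e5, f5⟩ := E hx
  obtain ⟨e6, f6⟩ := E hx₁
  obtain ⟨e7, f7⟩ := E hx₂
  obtain ⟨e8, f8⟩ := E hr
  obtain ⟨e9, f9⟩ := E (sub_nonneg.2 hh)
  obtain ⟨e10, f10⟩ := E (sub_nonneg.2 hh₁)
  obtain ⟨e11, f11⟩ := E (sub_nonneg.2 hh₂)
  -- Two bounds valid in both regimes of the output: `w1` extracts the square-integrable power -(1 +
  -- δ)/2 of the modulation, `w2` converts everything into modulation, for use when that is large.
  obtain ⟨w1, w2⟩ : w ≤ (100 * δ - 2 / 3 + 1 / 3 + δ) * a - (1 + δ) / 2 * x + κ ∧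
      w ≤ ((100 * δ - 2 / 3) / 2 - 1 / 3) * x := by
    rcases hw with ⟨rfl, hw⟩ | ⟨rfl, hw⟩
    · obtain ⟨e, f⟩ := E (sub_nonneg.2 hw)
      constructor <;> linarith
    · obtain ⟨e, f⟩ := E (sub_nonneg.2 hw)
      constructor <;> linarith
  -- If ⟨ρ⟩ dominates, the cutoff kernel is spent entirely on the weights and the inputs carry only
  -- ⟨n⟩^s, in L¹.
  by_cases hr2 : h - κ ≤ r
  · left
    obtain ⟨e, f⟩ := E (sub_nonneg.2 hr2)
    linarith
  right
  -- From here on the exponent 1 - δ of ⟨ρ⟩ is raised to 1 + δ, at the cost of at most 2δh.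
  have hr1 : r ≤ h - κ := (not_le.1 hr2).le
  obtain ⟨er, fr⟩ := E (sub_nonneg.2 hr1)
  -- Two inputs of high modulation: the one whose frequency is comparable to the maximum yields a
  -- gain in h, and the summable power -7/6 is put on the other frequency.
  have HH : v₁ = ((100 * δ - 2 / 3) / 2 + 2 / 3) * x₁ → 2 * a₁ - κ ≤ x₁ →
      v₂ = ((100 * δ - 2 / 3) / 2 + 2 / 3) * x₂ → 2 * a₂ - κ ≤ x₂ →
      (w - (1 - δ) * r - 4 * κ ≤ -(1 + δ) / 2 * x - (7 / 6) * a₁ - (1 + δ) * r + (v₁ + v₂) ∨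
      w - (1 - δ) * r - 4 * κ ≤ -(1 + δ) / 2 * x - (7 / 6) * a₂ - (1 + δ) * r + (v₁ + v₂)) := by
    intro l1 l1' l2 l2'
    obtain ⟨em1, fm1⟩ := E (sub_nonneg.2 l1')
    obtain ⟨em2, fm2⟩ := E (sub_nonneg.2 l2')
    rcases hmax with hm | hm <;> obtain ⟨e, f⟩ := E (sub_nonneg.2 hm)
    · right
      subst l1 l2
      linarith
    · left
      subst l1 l2
      linarith
  -- A large output modulation leads to `lowKernel` unless both inputs are high. A large input
  -- modulation leads to the dual Strichartz term if the other input is low, and to `HH` if it is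
  -- high.
  rcases hres with hr3 | hx2 | ⟨hx2, l1, l1'⟩ | ⟨hx2, l2, l2'⟩
  · exact absurd hr3 hr2
  · obtain ⟨ex, fx⟩ := E (sub_nonneg.2 hx2)
    rcases hv₁ with ⟨l1, l1'⟩ | ⟨l1, l1'⟩ <;> rcases hv₂ with ⟨l2, l2'⟩ | ⟨l2, l2'⟩ <;>
      obtain ⟨em1, fm1⟩ := E (sub_nonneg.2 l1') <;>
      obtain ⟨em2, fm2⟩ := E (sub_nonneg.2 l2')
    · refine Or.inl (Or.inl ?_)
      subst l1 l2
      linarith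
    · refine Or.inl (Or.inr (Or.inr ?_))
      subst l1 l2
      linarith
    · refine Or.inl (Or.inr (Or.inl ?_))
      subst l1 l2
      linarith
    · exact Or.inr ((HH l1 l1' l2 l2').imp_right Or.inl)
  · right
    obtain ⟨ex, fx⟩ := E (sub_nonneg.2 hx2)
    rcases hv₂ with ⟨l2, l2'⟩ | ⟨l2, l2'⟩ <;>
      obtain ⟨em1, fm1⟩ := E (sub_nonneg.2 l1') <;>
      obtain ⟨em2, fm2⟩ := E (sub_nonneg.2 l2')
    · refine Or.inr (Or.inr (Or.inl ?_))
      subst l1 l2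
      linarith
    · exact (HH l1 l1' l2 l2').imp_right Or.inl
  · right
    obtain ⟨ex, fx⟩ := E (sub_nonneg.2 hx2)
    rcases hv₁ with ⟨l1, l1'⟩ | ⟨l1, l1'⟩ <;>
      obtain ⟨em1, fm1⟩ := E (sub_nonneg.2 l1') <;>
      obtain ⟨em2, fm2⟩ := E (sub_nonneg.2 l2')
    · refine Or.inr (Or.inr (Or.inr ?_))
      subst l1 l2
      linarith
    · exact (HH l1 l1' l2 l2').imp_right Or.inl

/-- The linear inequalities between the logarithms of the weights, for the output in `L¹`. -/
theorem log_weight_one_le {δ κ h a a₁ a₂ x x₁ x₂ r v₁ v₂ : ℝ} (hδ : 0 < δ) (hδ' : δ ≤ 1 / 600)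
    (hκ : 0 ≤ κ) (ha : 0 ≤ a) (ha₁ : 0 ≤ a₁) (ha₂ : 0 ≤ a₂) (hx : 0 ≤ x) (hx₁ : 0 ≤ x₁)
    (hx₂ : 0 ≤ x₂) (hr : 0 ≤ r) (hh : 2 * a ≤ h) (hh₁ : 2 * a₁ ≤ h) (hh₂ : 2 * a₂ ≤ h)
    (hv₁ : (v₁ = (100 * δ - 2 / 3) * a₁ + 2 / 3 * x₁ ∧ x₁ ≤ 2 * a₁) ∨
      (v₁ = ((100 * δ - 2 / 3) / 2 + 2 / 3) * x₁ ∧ 2 * a₁ - κ ≤ x₁))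
    (hv₂ : (v₂ = (100 * δ - 2 / 3) * a₂ + 2 / 3 * x₂ ∧ x₂ ≤ 2 * a₂) ∨
      (v₂ = ((100 * δ - 2 / 3) / 2 + 2 / 3) * x₂ ∧ 2 * a₂ - κ ≤ x₂))
    (hmax : h - κ ≤ 2 * a₁ ∨ h - κ ≤ 2 * a₂)
    (hres : h - κ ≤ r ∨ h - κ ≤ x ∨
      (h - κ ≤ x₁ ∧ v₁ = ((100 * δ - 2 / 3) / 2 + 2 / 3) * x₁ ∧ 2 * a₁ - κ ≤ x₁) ∨
      (h - κ ≤ x₂ ∧ v₂ = ((100 * δ - 2 / 3) / 2 + 2 / 3) * x₂ ∧ 2 * a₂ - κ ≤ x₂)) :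
    ((100 * δ - 2 / 3) * a - x - (1 - δ) * r - 4 * κ ≤ 
        -(1 + δ) * a - (1 + δ) * x + (100 * δ - 2 / 3) * (a₁ + a₂) ∨
      (100 * δ - 2 / 3) * a - x - (1 - δ) * r - 4 * κ ≤ 
        -(1 + δ) * a - (1 + δ) * r + (100 * δ - 2 / 3) * (a₁ + a₂)) ∨
    ((100 * δ - 2 / 3) * a - x - (1 - δ) * r - 4 * κ ≤ 
        -(1 + δ) * x - (7 / 6) * a₁ - (1 + δ) * r + (v₁ + v₂) ∨
      (100 * δ - 2 / 3) * a - x - (1 - δ) * r - 4 * κ ≤ 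
        -(1 + δ) * x - (7 / 6) * a₂ - (1 + δ) * r + (v₁ + v₂) ∨
      (100 * δ - 2 / 3) * a - x - (1 - δ) * r - 4 * κ ≤ 
        -(1 + δ) * x - δ * h - (1 + δ) / 2 * x₂ - (1 + δ) * r + (v₁ + v₂) ∨
      (100 * δ - 2 / 3) * a - x - (1 - δ) * r - 4 * κ ≤ 
        -(1 + δ) * x - δ * h - (1 + δ) / 2 * x₁ - (1 + δ) * r + (v₁ + v₂)) := by
  have E : ∀ {b : ℝ}, 0 ≤ b → 0 ≤ δ * b ∧ 0 ≤ (1 / 600 - δ) * b := fun hb =>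
    ⟨mul_nonneg hδ.le hb, mul_nonneg (by linarith) hb⟩
  have hhn : 0 ≤ h := by linarith
  obtain ⟨e1, f1⟩ := E hκ
  obtain ⟨e2, f2⟩ := E ha
  obtain ⟨e3, f3⟩ := E ha₁
  obtain ⟨e4, f4⟩ := E ha₂
  obtain ⟨e5, f5⟩ := E hx
  obtain ⟨e6, f6⟩ := E hx₁
  obtain ⟨e7, f7⟩ := E hx₂
  obtain ⟨e8, f8⟩ := E hr
  obtain ⟨e9, f9⟩ := E (sub_nonneg.2 hh)
  obtain ⟨e10, f10⟩ := E (sub_nonneg.2 hh₁)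
  obtain ⟨e11, f11⟩ := E (sub_nonneg.2 hh₂)
  -- The larger of r and x pays for the weights, while the smaller one still receives the exponent 1
  -- + δ that makes the τ-integral converge; this is why two brackets occur in the L¹ model.
  by_cases hrx : h - κ ≤ r ∨ h - κ ≤ x
  · left
    rcases le_total r x with hrx' | hrx' <;> obtain ⟨e, f⟩ := E (sub_nonneg.2 hrx')
    · have hm : h - κ ≤ x := hrx.elim (fun hr => hr.trans hrx') id
      obtain ⟨e', f'⟩ := E (sub_nonneg.2 hm)
      right
      linarith
    · have hm : h - κ ≤ r := hrx.elim id fun hx => hx.trans hrx'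
      obtain ⟨e', f'⟩ := E (sub_nonneg.2 hm)
      left
      linarith
  right
  obtain ⟨hr2, hx2⟩ := not_or.1 hrx
  obtain ⟨er, fr⟩ := E (sub_nonneg.2 (not_le.1 hr2).le)
  obtain ⟨er', fr'⟩ := E (sub_nonneg.2 (not_le.1 hx2).le)
  have HH : v₁ = ((100 * δ - 2 / 3) / 2 + 2 / 3) * x₁ → 2 * a₁ - κ ≤ x₁ →
      v₂ = ((100 * δ - 2 / 3) / 2 + 2 / 3) * x₂ → 2 * a₂ - κ ≤ x₂ →
      ((100 * δ - 2 / 3) * a - x - (1 - δ) * r - 4 * κ ≤ 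
        -(1 + δ) * x - (7 / 6) * a₁ - (1 + δ) * r + (v₁ + v₂) ∨
      (100 * δ - 2 / 3) * a - x - (1 - δ) * r - 4 * κ ≤ 
        -(1 + δ) * x - (7 / 6) * a₂ - (1 + δ) * r + (v₁ + v₂)) := by
    intro l1 l1' l2 l2'
    obtain ⟨em1, fm1⟩ := E (sub_nonneg.2 l1')
    obtain ⟨em2, fm2⟩ := E (sub_nonneg.2 l2')
    rcases hmax with hm | hm <;> obtain ⟨e, f⟩ := E (sub_nonneg.2 hm)
    · right
      subst l1 l2
      linarith
    · left
      subst l1 l2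
      linarith
  rcases hres with hr3 | hx3 | ⟨hx2, l1, l1'⟩ | ⟨hx2, l2, l2'⟩
  · exact absurd hr3 hr2
  · exact absurd hx3 hx2
  · obtain ⟨ex, fx⟩ := E (sub_nonneg.2 hx2)
    rcases hv₂ with ⟨l2, l2'⟩ | ⟨l2, l2'⟩ <;>
      obtain ⟨em1, fm1⟩ := E (sub_nonneg.2 l1') <;>
      obtain ⟨em2, fm2⟩ := E (sub_nonneg.2 l2')
    · refine Or.inr (Or.inr (Or.inl ?_))
      subst l1 l2
      linarith
    · exact (HH l1 l1' l2 l2').imp_right Or.inl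
  · obtain ⟨ex, fx⟩ := E (sub_nonneg.2 hx2)
    rcases hv₁ with ⟨l1, l1'⟩ | ⟨l1, l1'⟩ <;>
      obtain ⟨em1, fm1⟩ := E (sub_nonneg.2 l1') <;>
      obtain ⟨em2, fm2⟩ := E (sub_nonneg.2 l2')
    · refine Or.inr (Or.inr (Or.inr ?_))
      subst l1 l2
      linarith
    · exact (HH l1 l1' l2 l2').imp_right Or.inl

/-! ### Resonance identity and domination of the weighted kernel. -/

theorem log_jb_nonneg (x : ℝ) : 0 ≤ Real.log (jb x) := Real.log_nonneg (one_le_jb x)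

theorem log_jbFreq_nonneg (n : Freq) : 0 ≤ Real.log (jbFreq n) :=
  Real.log_nonneg (one_le_jbFreq n)

theorem two_mul_log_jbFreq (n : Freq) :
    2 * Real.log (jbFreq n) = Real.log (1 + normSq n) := by
  rw [← jbFreq_sq, Real.log_pow]; norm_num

theorem log_sub_log_le {A B : ℝ} (hA : 0 < A) (hB : 0 < B) (h : A ≤ 4096 * B) :
    Real.log A - Real.log 4096 ≤ Real.log B := by
  have := Real.log_le_log hA h
  rw [Real.log_mul (by norm_num) hB.ne'] at this
  linarith

theorem log_jb_le_of_low {n : Freq} {τ : ℝ} (h : |modulation n τ| < normSq n / 2 ^ 10) :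
    Real.log (jb (modulation n τ)) ≤ 2 * Real.log (jbFreq n) := by
  rw [two_mul_log_jbFreq]
  refine Real.log_le_log (jb_pos _) ?_
  linarith [jb_le_one_add_abs (modulation n τ), normSq_nonneg n]

theorem le_log_jb_of_high {n : Freq} {τ : ℝ} (h : ¬|modulation n τ| < normSq n / 2 ^ 10) :
    2 * Real.log (jbFreq n) - Real.log 4096 ≤ Real.log (jb (modulation n τ)) := by
  rw [two_mul_log_jbFreq]
  refine log_sub_log_le (by linarith [normSq_nonneg n]) (jb_pos _) ?_
  linarith [abs_le_jb (modulation n τ), one_le_jb (modulation n τ), not_lt.1 h]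

theorem inE_eq_exp (s : ℝ) (n : Freq) (τ : ℝ) : ∃ v : ℝ, inE s n τ = ENNReal.ofReal (Real.exp v) ∧
    ((|modulation n τ| < normSq n / 2 ^ 10 ∧
        v = s * Real.log (jbFreq n) + 2 / 3 * Real.log (jb (modulation n τ))) ∨
      (¬|modulation n τ| < normSq n / 2 ^ 10 ∧
        v = (s / 2 + 2 / 3) * Real.log (jb (modulation n τ)))) := by
  by_cases h : |modulation n τ| < normSq n / 2 ^ 10
  · refine ⟨_, ?_, Or.inl ⟨h, rfl⟩⟩
    rw [inE, if_pos h, freqE_eq_exp, jbE_eq_exp, ofReal_exp_mul]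
    congr 2; ring
  · refine ⟨_, ?_, Or.inr ⟨h, rfl⟩⟩
    rw [inE, if_neg h, jbE_eq_exp]
    congr 2; ring

theorem outE_eq_exp (s : ℝ) (n : Freq) (τ : ℝ) : ∃ v : ℝ, outE s n τ = ENNReal.ofReal (Real.exp v) ∧
    ((|modulation n τ| < normSq n / 2 ^ 10 ∧
        v = s * Real.log (jbFreq n) - Real.log (jb (modulation n τ)) / 3) ∨
      (¬|modulation n τ| < normSq n / 2 ^ 10 ∧
        v = (s / 2 - 1 / 3) * Real.log (jb (modulation n τ)))) := by
  by_cases h : |modulation n τ| < normSq n / 2 ^ 10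
  · refine ⟨_, ?_, Or.inl ⟨h, rfl⟩⟩
    rw [outE, if_pos h, freqE_eq_exp, jbE_eq_exp, ofReal_exp_mul]
    congr 2; ring
  · refine ⟨_, ?_, Or.inr ⟨h, rfl⟩⟩
    rw [outE, if_neg h, jbE_eq_exp]
    congr 2; ring

/-- The algebraic heart of the estimate: with both factors conjugated, the three squared frequencies
enter with the same sign. -/
theorem modulation_add (n n₁ : Freq) (τ x y : ℝ) :
    modulation n τ + modulation n₁ x + modulation (-n - n₁) y =
      (τ + x + y) + (tripleSq n n₁ - 1) := by
  unfold modulation tripleSq; ring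

/-- The absence of resonances: one of the modulations is comparable to the largest frequency. -/
theorem tripleSq_le_of_resonance (n n₁ : Freq) (τ x y : ℝ) :
    tripleSq n n₁ ≤ 4096 * jb (τ + x + y) ∨ tripleSq n n₁ ≤ 4096 * jb (modulation n τ) ∨
    (tripleSq n n₁ ≤ 4096 * jb (modulation n₁ x) ∧ ¬|modulation n₁ x| < normSq n₁ / 2 ^ 10) ∨
    (tripleSq n n₁ ≤ 4096 * jb (modulation (-n - n₁) y) ∧
      ¬|modulation (-n - n₁) y| < normSq (-n - n₁) / 2 ^ 10) := by
  by_contra hcon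
  push Not at hcon
  obtain ⟨h1, h2, h3, h4⟩ := hcon
  have hadd := modulation_add n n₁ τ x y
  have hH := one_le_tripleSq n n₁
  -- Either the bracket is below 1/4096 of the triple, or the input is of low modulation and is
  -- bounded by 2^{-10}|n₁|². Four such small terms cannot add up to the triple minus one.
  have b3 : |modulation n₁ x| ≤ tripleSq n n₁ / 1024 := by
    by_cases h : tripleSq n n₁ ≤ 4096 * jb (modulation n₁ x)
    · have := h3 h
      have h5 : normSq n₁ ≤ tripleSq n n₁ := by
        unfold tripleSq; linarith [normSq_nonneg n, normSq_nonneg (-n - n₁)]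
      linarith
    · linarith [abs_le_jb (modulation n₁ x)]
  have b4 : |modulation (-n - n₁) y| ≤ tripleSq n n₁ / 1024 := by
    by_cases h : tripleSq n n₁ ≤ 4096 * jb (modulation (-n - n₁) y)
    · have := h4 h
      have h5 : normSq (-n - n₁) ≤ tripleSq n n₁ := by
        unfold tripleSq; linarith [normSq_nonneg n, normSq_nonneg n₁]
      linarith
    · linarith [abs_le_jb (modulation (-n - n₁) y)]
  have b1 := abs_le_jb (τ + x + y)
  have b2 := abs_le_jb (modulation n τ)
  have c1 := one_le_jb (τ + x + y)
  linarith [neg_abs_le (τ + x + y), le_abs_self (modulation n τ), le_abs_self (modulation n₁ x),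
    le_abs_self (modulation (-n - n₁) y)]

/-- The output frequency is controlled by the inputs, so one of the two input frequencies is always
comparable to the whole triple. -/
theorem normSq_neg_sub_le (n n₁ : Freq) :
    normSq n ≤ 2 * normSq n₁ + 2 * normSq (-n - n₁) := by
  simp only [normSq, Fin.sum_univ_two, Pi.sub_apply, Pi.neg_apply]
  push_cast
  nlinarith [sq_nonneg ((n₁ 0 : ℝ) - (-n 0 - n₁ 0)), sq_nonneg ((n₁ 1 : ℝ) - (-n 1 - n₁ 1))]

/-- The facts about logarithms that feed the linear inequalities. -/
theorem log_facts (s : ℝ) (n n₁ : Freq) (τ x y : ℝ) {v₁ v₂ : ℝ}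
    (hv₁ : (|modulation n₁ x| < normSq n₁ / 2 ^ 10 ∧
        v₁ = s * Real.log (jbFreq n₁) + 2 / 3 * Real.log (jb (modulation n₁ x))) ∨
      (¬|modulation n₁ x| < normSq n₁ / 2 ^ 10 ∧
        v₁ = (s / 2 + 2 / 3) * Real.log (jb (modulation n₁ x))))
    (hv₂ : (|modulation (-n - n₁) y| < normSq (-n - n₁) / 2 ^ 10 ∧
        v₂ = s * Real.log (jbFreq (-n - n₁)) + 2 / 3 * Real.log (jb (modulation (-n - n₁) y))) ∨
      (¬|modulation (-n - n₁) y| < normSq (-n - n₁) / 2 ^ 10 ∧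
        v₂ = (s / 2 + 2 / 3) * Real.log (jb (modulation (-n - n₁) y)))) :
    (2 * Real.log (jbFreq n) ≤ Real.log (tripleSq n n₁) ∧
      2 * Real.log (jbFreq n₁) ≤ Real.log (tripleSq n n₁) ∧
      2 * Real.log (jbFreq (-n - n₁)) ≤ Real.log (tripleSq n n₁)) ∧
    (Real.log (tripleSq n n₁) - Real.log 4096 ≤ 2 * Real.log (jbFreq n₁) ∨
      Real.log (tripleSq n n₁) - Real.log 4096 ≤ 2 * Real.log (jbFreq (-n - n₁))) ∧
    (Real.log (tripleSq n n₁) - Real.log 4096 ≤ Real.log (jb (τ + x + y)) ∨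
      Real.log (tripleSq n n₁) - Real.log 4096 ≤ Real.log (jb (modulation n τ)) ∨
      (Real.log (tripleSq n n₁) - Real.log 4096 ≤ Real.log (jb (modulation n₁ x)) ∧
        v₁ = (s / 2 + 2 / 3) * Real.log (jb (modulation n₁ x)) ∧
        2 * Real.log (jbFreq n₁) - Real.log 4096 ≤ Real.log (jb (modulation n₁ x))) ∨
      (Real.log (tripleSq n n₁) - Real.log 4096 ≤ Real.log (jb (modulation (-n - n₁) y)) ∧
        v₂ = (s / 2 + 2 / 3) * Real.log (jb (modulation (-n - n₁) y)) ∧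
        2 * Real.log (jbFreq (-n - n₁)) - Real.log 4096 ≤
          Real.log (jb (modulation (-n - n₁) y)))) := by
  have h0 := normSq_nonneg n
  have h1 := normSq_nonneg n₁
  have h2 := normSq_nonneg (-n - n₁)
  have hH : 0 < tripleSq n n₁ := by linarith [one_le_tripleSq n n₁]
  refine ⟨?_, ?_, ?_⟩
  · simp only [two_mul_log_jbFreq]
    refine ⟨?_, ?_, ?_⟩ <;> refine Real.log_le_log (by linarith) ?_ <;> unfold tripleSq <;> linarith
  · simp only [two_mul_log_jbFreq]
    have := normSq_neg_sub_le n n₁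
    rcases le_total (normSq n₁) (normSq (-n - n₁)) with h | h
    · right
      refine log_sub_log_le hH (by linarith) ?_
      unfold tripleSq; linarith
    · left
      refine log_sub_log_le hH (by linarith) ?_
      unfold tripleSq; linarith
  · rcases tripleSq_le_of_resonance n n₁ τ x y with h | h | ⟨h, h'⟩ | ⟨h, h'⟩
    · exact Or.inl (log_sub_log_le hH (jb_pos _) h)
    · exact Or.inr (Or.inl (log_sub_log_le hH (jb_pos _) h))
    · refine Or.inr (Or.inr (Or.inl ⟨log_sub_log_le hH (jb_pos _) h, ?_, le_log_jb_of_high h'⟩))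
      exact (hv₁.resolve_left fun h'' => h' h''.1).2
    · refine Or.inr (Or.inr (Or.inr ⟨log_sub_log_le hH (jb_pos _) h, ?_, le_log_jb_of_high h'⟩))
      exact (hv₂.resolve_left fun h'' => h' h''.1).2

/-- Turns the additive loss 4κ of the logarithmic inequalities, with κ = log 4096, into the constant
4096⁴. -/
theorem le_mul_of_exp_le {l t : ℝ} {T : ℝ≥0∞} (h : l - 4 * Real.log 4096 ≤ t)
    (hT : ENNReal.ofReal (Real.exp t) ≤ T) :
    ENNReal.ofReal (Real.exp l) ≤ ENNReal.ofReal (4096 ^ 4) * T := by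
  refine le_trans ?_ (mul_le_mul_right hT _)
  rw [← ENNReal.ofReal_mul (by positivity)]
  refine ENNReal.ofReal_le_ofReal ?_
  calc Real.exp l ≤ Real.exp (4 * Real.log 4096 + t) := Real.exp_le_exp.2 (by linarith)
    _ = _ := by
      rw [Real.exp_add, mul_comm 4, Real.exp_mul, Real.exp_log (by norm_num)]
      norm_num

/-- The pointwise bound of the trilinear kernel for the output in `L²`. -/
theorem outE_mul_le {δ : ℝ} (hδ : 0 < δ) (hδ' : δ ≤ 1 / 600) (n : Freq) (τ : ℝ) (n₁ : Freq)
    (q : ℝ × ℝ) :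
    outE (100 * δ - 2 / 3) n τ * jbE (1 - δ) (τ + q.1 + q.2) ≤ ENNReal.ofReal (4096 ^ 4) *
      ((freqE (1 + δ) n * jbE ((1 + δ) / 2) (modulation n τ)) *
          (freqE (-(100 * δ - 2 / 3)) n₁ * freqE (-(100 * δ - 2 / 3)) (-n - n₁)) +
        (lowKernel δ n τ n₁ q + highKernel δ n τ n₁ q) *
          (inE (100 * δ - 2 / 3) n₁ q.1 * inE (100 * δ - 2 / 3) (-n - n₁) q.2)) := by
  obtain ⟨w, ew, hw⟩ := outE_eq_exp (100 * δ - 2 / 3) n τ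
  obtain ⟨v₁, e₁, hv₁⟩ := inE_eq_exp (100 * δ - 2 / 3) n₁ q.1
  obtain ⟨v₂, e₂, hv₂⟩ := inE_eq_exp (100 * δ - 2 / 3) (-n - n₁) q.2
  obtain ⟨⟨hh, hh₁, hh₂⟩, hmax, hres⟩ := log_facts (100 * δ - 2 / 3) n n₁ τ q.1 q.2 hv₁ hv₂
  have key := log_weight_two_le hδ hδ' (Real.log_nonneg (by norm_num)) (log_jbFreq_nonneg n)
    (log_jbFreq_nonneg n₁) (log_jbFreq_nonneg (-n - n₁)) (log_jb_nonneg (modulation n τ))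
    (log_jb_nonneg (modulation n₁ q.1)) (log_jb_nonneg (modulation (-n - n₁) q.2))
    (log_jb_nonneg (τ + q.1 + q.2)) hh hh₁ hh₂
    (hw.imp (fun h => ⟨h.2, log_jb_le_of_low h.1⟩) fun h => ⟨h.2, le_log_jb_of_high h.1⟩)
    (hv₁.imp (fun h => ⟨h.2, log_jb_le_of_low h.1⟩) fun h => ⟨h.2, le_log_jb_of_high h.1⟩)
    (hv₂.imp (fun h => ⟨h.2, log_jb_le_of_low h.1⟩) fun h => ⟨h.2, le_log_jb_of_high h.1⟩)
    hmax hres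
  rw [ew, e₁, e₂, jbE_eq_exp, ofReal_exp_mul, lowKernel, highKernel]
  have hsub : w + -(1 - δ) * Real.log (jb (τ + q.1 + q.2)) =
    w - (1 - δ) * Real.log (jb (τ + q.1 + q.2)) := by ring
  rw [hsub]
  -- The right side is a sum of nonnegative terms, so each alternative only has to be matched with
  -- one summand; the chains of `le_self_add` and `le_add_self` select it.
  rcases key with h | (h | h | h) | (h | h | h | h)
  · refine le_mul_of_exp_le h (le_trans (le_of_eq ?_) le_self_add)
    simp only [freqE_eq_exp, jbE_eq_exp, ofReal_exp_mul]
    congr 2; ring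
  all_goals refine le_mul_of_exp_le h (le_trans ?_ le_add_self)
  · refine le_trans (le_of_eq ?_) (mul_le_mul_left (le_self_add.trans le_self_add) _)
    simp only [jbE_eq_exp, tripleE_eq_exp, ofReal_exp_mul]
    congr 2; ring
  · refine le_trans (le_of_eq ?_) (mul_le_mul_left ((le_self_add.trans le_add_self).trans le_self_add) _)
    simp only [freqE_eq_exp, jbE_eq_exp, ofReal_exp_mul]
    congr 2; ring
  · refine le_trans (le_of_eq ?_) (mul_le_mul_left ((le_add_self.trans le_add_self).trans le_self_add) _)
    simp only [freqE_eq_exp, jbE_eq_exp, ofReal_exp_mul]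
    congr 2; ring
  · refine le_trans (le_of_eq ?_) (mul_le_mul_left ((le_self_add.trans le_self_add).trans le_add_self) _)
    simp only [freqE_eq_exp, jbE_eq_exp, ofReal_exp_mul]
    congr 2; ring
  · refine le_trans (le_of_eq ?_) (mul_le_mul_left ((le_add_self.trans le_self_add).trans le_add_self) _)
    simp only [freqE_eq_exp, jbE_eq_exp, ofReal_exp_mul]
    congr 2; ring
  · refine le_trans (le_of_eq ?_) (mul_le_mul_left ((le_self_add.trans le_add_self).trans le_add_self) _)
    simp only [jbE_eq_exp, tripleE_eq_exp, ofReal_exp_mul]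
    congr 2; ring
  · refine le_trans (le_of_eq ?_) (mul_le_mul_left ((le_add_self.trans le_add_self).trans le_add_self) _)
    simp only [jbE_eq_exp, tripleE_eq_exp, ofReal_exp_mul]
    congr 2; ring

/-- The pointwise bound of the trilinear kernel for the output in `L¹`. -/
theorem freqE_mul_jbE_mul_le {δ : ℝ} (hδ : 0 < δ) (hδ' : δ ≤ 1 / 600) (n : Freq) (τ : ℝ)
    (n₁ : Freq) (q : ℝ × ℝ) :
    (freqE (-(100 * δ - 2 / 3)) n * jbE 1 (modulation n τ)) * jbE (1 - δ) (τ + q.1 + q.2) ≤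
      ENNReal.ofReal (4096 ^ 4) *
      ((freqE (1 + δ) n * (jbE (1 + δ) (modulation n τ) + jbE (1 + δ) (τ + q.1 + q.2))) *
          (freqE (-(100 * δ - 2 / 3)) n₁ * freqE (-(100 * δ - 2 / 3)) (-n - n₁)) +
        (jbE ((1 + δ) / 2) (modulation n τ) * highKernel δ n τ n₁ q) *
          (inE (100 * δ - 2 / 3) n₁ q.1 * inE (100 * δ - 2 / 3) (-n - n₁) q.2)) := by
  obtain ⟨v₁, e₁, hv₁⟩ := inE_eq_exp (100 * δ - 2 / 3) n₁ q.1
  obtain ⟨v₂, e₂, hv₂⟩ := inE_eq_exp (100 * δ - 2 / 3) (-n - n₁) q.2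
  obtain ⟨⟨hh, hh₁, hh₂⟩, hmax, hres⟩ := log_facts (100 * δ - 2 / 3) n n₁ τ q.1 q.2 hv₁ hv₂
  have key := log_weight_one_le hδ hδ' (Real.log_nonneg (by norm_num)) (log_jbFreq_nonneg n)
    (log_jbFreq_nonneg n₁) (log_jbFreq_nonneg (-n - n₁)) (log_jb_nonneg (modulation n τ))
    (log_jb_nonneg (modulation n₁ q.1)) (log_jb_nonneg (modulation (-n - n₁) q.2))
    (log_jb_nonneg (τ + q.1 + q.2)) hh hh₁ hh₂
    (hv₁.imp (fun h => ⟨h.2, log_jb_le_of_low h.1⟩) fun h => ⟨h.2, le_log_jb_of_high h.1⟩)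
    (hv₂.imp (fun h => ⟨h.2, log_jb_le_of_low h.1⟩) fun h => ⟨h.2, le_log_jb_of_high h.1⟩)
    hmax hres
  have hsub : (freqE (-(100 * δ - 2 / 3)) n * jbE 1 (modulation n τ)) *
      jbE (1 - δ) (τ + q.1 + q.2) = ENNReal.ofReal (Real.exp ((100 * δ - 2 / 3) *
        Real.log (jbFreq n) - Real.log (jb (modulation n τ)) -
          (1 - δ) * Real.log (jb (τ + q.1 + q.2)))) := by
    simp only [freqE_eq_exp, jbE_eq_exp, ofReal_exp_mul]
    congr 2; ring
  rw [hsub, e₁, e₂, highKernel]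
  rcases key with (h | h) | (h | h | h | h)
  · refine le_mul_of_exp_le h (le_trans (le_trans (le_of_eq ?_)
      (mul_le_mul_left (mul_le_mul_right le_self_add _) _)) le_self_add)
    simp only [freqE_eq_exp, jbE_eq_exp, ofReal_exp_mul]
    congr 2; ring
  · refine le_mul_of_exp_le h (le_trans (le_trans (le_of_eq ?_)
      (mul_le_mul_left (mul_le_mul_right le_add_self _) _)) le_self_add)
    simp only [freqE_eq_exp, jbE_eq_exp, ofReal_exp_mul]
    congr 2; ring
  all_goals refine le_mul_of_exp_le h (le_trans ?_ le_add_self)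
  · refine le_trans (le_of_eq ?_)
      (mul_le_mul_left (mul_le_mul_right (le_self_add.trans le_self_add) _) _)
    simp only [freqE_eq_exp, jbE_eq_exp, ofReal_exp_mul]
    congr 2; ring
  · refine le_trans (le_of_eq ?_)
      (mul_le_mul_left (mul_le_mul_right (le_add_self.trans le_self_add) _) _)
    simp only [freqE_eq_exp, jbE_eq_exp, ofReal_exp_mul]
    congr 2; ring
  · refine le_trans (le_of_eq ?_)
      (mul_le_mul_left (mul_le_mul_right (le_self_add.trans le_add_self) _) _)
    simp only [jbE_eq_exp, tripleE_eq_exp, ofReal_exp_mul]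
    congr 2; ring
  · refine le_trans (le_of_eq ?_)
      (mul_le_mul_left (mul_le_mul_right (le_add_self.trans le_add_self) _) _)
    simp only [jbE_eq_exp, tripleE_eq_exp, ofReal_exp_mul]
    congr 2; ring

/-! ### Assembly of the bilinear estimate for nonnegative functions. -/

theorem ennreal_add_sq_le (a b : ℝ≥0∞) : (a + b) ^ 2 ≤ 2 * (a ^ 2 + b ^ 2) := by
  have := ENNReal.rpow_add_le_mul_rpow_add_rpow a b (p := 2) (by norm_num)
  simp only [ENNReal.rpow_two] at this
  convert this using 2
  norm_num

/-- The bilinear operator with kernel `k` on the convolution structure of frequencies. -/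
def bil (k : Freq → ℝ → Freq → ℝ × ℝ → ℝ≥0∞) (F G : Freq → ℝ → ℝ≥0∞) (n : Freq) (τ : ℝ) : ℝ≥0∞ :=
  ∑' n₁, ∫⁻ q : ℝ × ℝ, k n τ n₁ q * (F n₁ q.1 * G (-n - n₁) q.2)

/-- Joint measurability of a kernel in the temporal frequencies. -/
def KerMeas (k : Freq → ℝ → Freq → ℝ × ℝ → ℝ≥0∞) : Prop :=
  ∀ n n₁, Measurable fun z : ℝ × ℝ × ℝ => k n z.1 n₁ z.2

theorem KerMeas.apply {k : Freq → ℝ → Freq → ℝ × ℝ → ℝ≥0∞} (hk : KerMeas k) (n τ n₁) :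
    Measurable (k n τ n₁) := (hk n n₁).comp (measurable_const.prodMk measurable_id)

theorem measurable_bil {k : Freq → ℝ → Freq → ℝ × ℝ → ℝ≥0∞} (hk : KerMeas k)
    {F G : Freq → ℝ → ℝ≥0∞} (hF : ∀ n, Measurable (F n)) (hG : ∀ n, Measurable (G n)) (n : Freq) :
    Measurable (bil k F G n) := by
  refine Measurable.tsum fun n₁ => ?_
  have h0 := hk n n₁
  have h1 := hF n₁
  have h2 := hG (-n - n₁)
  exact Measurable.lintegral_prod_right' (f := fun z : ℝ × ℝ × ℝ =>
    k n z.1 n₁ z.2 * (F n₁ z.2.1 * G (-n - n₁) z.2.2)) (by fun_prop)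

theorem bil_add {k : Freq → ℝ → Freq → ℝ × ℝ → ℝ≥0∞} (hk : KerMeas k)
    (k' : Freq → ℝ → Freq → ℝ × ℝ → ℝ≥0∞)
    {F G : Freq → ℝ → ℝ≥0∞} (hF : ∀ n, Measurable (F n)) (hG : ∀ n, Measurable (G n)) :
    bil (fun n τ n₁ q => k n τ n₁ q + k' n τ n₁ q) F G =
      fun n τ => bil k F G n τ + bil k' F G n τ := by
  funext n τ
  rw [bil, bil, bil, ← ENNReal.tsum_add]
  refine tsum_congr fun n₁ => ?_
  have h0 := hk.apply n τ n₁
  have h1 := hF n₁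
  have h2 := hG (-n - n₁)
  simp_rw [add_mul]
  rw [lintegral_add_left (by fun_prop)]

theorem mul_bil {k : Freq → ℝ → Freq → ℝ × ℝ → ℝ≥0∞} (hk : KerMeas k)
    {F G : Freq → ℝ → ℝ≥0∞} (hF : ∀ n, Measurable (F n)) (hG : ∀ n, Measurable (G n))
    (c : Freq → ℝ → ℝ≥0∞) (n : Freq) (τ : ℝ) :
    c n τ * bil k F G n τ = bil (fun n τ n₁ q => c n τ * k n τ n₁ q) F G n τ := by
  rw [bil, bil, ← ENNReal.tsum_mul_left]
  refine tsum_congr fun n₁ => ?_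
  have h0 := hk.apply n τ n₁
  have h1 := hF n₁
  have h2 := hG (-n - n₁)
  rw [← lintegral_const_mul _ (by fun_prop)]
  simp_rw [mul_assoc]

/-- The substitution n₁ ↦ -n - n₁ exchanges the two inputs. It disposes of kernel terms that are
mirror images of others. -/
theorem bil_swap {k k' : Freq → ℝ → Freq → ℝ × ℝ → ℝ≥0∞}
    (h : ∀ n τ n₁ x y, k n τ (-n - n₁) (y, x) = k' n τ n₁ (x, y))
    {F G : Freq → ℝ → ℝ≥0∞} :
    bil k F G = bil k' G F := by
  funext n τ
  rw [bil, bil, ← tsum_neg_sub n]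
  refine tsum_congr fun n₁ => ?_
  rw [Measure.volume_eq_prod, ← lintegral_prod_swap]
  refine lintegral_congr fun q => ?_
  rw [show -n - (-n - n₁) = n₁ by abel]
  simp only [Prod.fst_swap, Prod.snd_swap]
  rw [Prod.swap, h, mul_comm (F _ _)]

theorem sqNorm_add_le {F : Freq → ℝ → ℝ≥0∞} (hF : ∀ n, Measurable (F n)) (G : Freq → ℝ → ℝ≥0∞) :
    sqNorm (fun n τ => F n τ + G n τ) ≤ 2 * (sqNorm F + sqNorm G) := by
  rw [sqNorm, sqNorm, sqNorm, ← ENNReal.tsum_add, ← ENNReal.tsum_mul_left]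
  refine ENNReal.tsum_le_tsum fun n => ?_
  rw [← lintegral_add_left ((hF n).pow_const 2), ← lintegral_const_mul' _ _ (by norm_num)]
  exact lintegral_mono fun τ => ennreal_add_sq_le _ _

theorem sqNormOne_add_le {F : Freq → ℝ → ℝ≥0∞} (hF : ∀ n, Measurable (F n))
    (G : Freq → ℝ → ℝ≥0∞) :
    sqNormOne (fun n τ => F n τ + G n τ) ≤ 2 * (sqNormOne F + sqNormOne G) := by
  rw [sqNormOne, sqNormOne, sqNormOne, ← ENNReal.tsum_add, ← ENNReal.tsum_mul_left]
  refine ENNReal.tsum_le_tsum fun n => ?_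
  rw [lintegral_add_left (hF n)]
  exact ennreal_add_sq_le _ _

theorem sqNorm_mono {F G : Freq → ℝ → ℝ≥0∞} (h : ∀ n τ, F n τ ≤ G n τ) : sqNorm F ≤ sqNorm G :=
  ENNReal.tsum_le_tsum fun n => lintegral_mono fun τ => pow_le_pow_left' (h n τ) 2

theorem sqNormOne_mono {F G : Freq → ℝ → ℝ≥0∞} (h : ∀ n τ, F n τ ≤ G n τ) :
    sqNormOne F ≤ sqNormOne G :=
  ENNReal.tsum_le_tsum fun n => pow_le_pow_left' (lintegral_mono fun τ => h n τ) 2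

theorem sqNorm_const_mul {c : ℝ≥0∞} (hc : c ≠ ⊤) (F : Freq → ℝ → ℝ≥0∞) :
    sqNorm (fun n τ => c * F n τ) = c ^ 2 * sqNorm F := by
  rw [sqNorm, sqNorm, ← ENNReal.tsum_mul_left]
  refine tsum_congr fun n => ?_
  simp_rw [mul_pow]
  rw [lintegral_const_mul' _ _ (ENNReal.pow_ne_top hc)]

theorem sqNormOne_const_mul {c : ℝ≥0∞} (hc : c ≠ ⊤) (F : Freq → ℝ → ℝ≥0∞) :
    sqNormOne (fun n τ => c * F n τ) = c ^ 2 * sqNormOne F := by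
  rw [sqNormOne, sqNormOne, ← ENNReal.tsum_mul_left]
  refine tsum_congr fun n => ?_
  rw [lintegral_const_mul' _ _ hc, mul_pow]

theorem freqE_half_sq (q : ℝ) (n : Freq) : freqE q n ^ 2 = freqE (2 * q) n := by
  rw [freqE_eq_exp, freqE_eq_exp, pow_two, ofReal_exp_mul]
  congr 2; ring

theorem tsum_freqE_sq_ne_top {q : ℝ} (hq : 1 < q) : ∑' n, freqE q n ^ 2 ≠ ⊤ := by
  simp_rw [freqE_half_sq]
  exact tsum_jbFreq_rpow_ne_top (by linarith)

/-- The bound for the kernel of outputs of high modulation. -/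
theorem exists_sqNorm_bil_lowKernel_le {δ : ℝ} (hδ : 0 < δ) :
    ∃ C : ℝ≥0∞, C ≠ ⊤ ∧ ∀ F G : Freq → ℝ → ℝ≥0∞, (∀ n, Measurable (F n)) →
      (∀ n, Measurable (G n)) → sqNorm (bil (lowKernel δ) F G) ≤ C * (sqNorm F * sqNorm G) := by
  have hp : 1 < 1 + δ := by linarith
  obtain ⟨C, hC, h⟩ := exists_strichartz_le hp (show 0 < 2 * δ by linarith)
  set A := ∑' n, freqE (7 / 6) n ^ 2 with hA
  have hAt : A ≠ ⊤ := tsum_freqE_sq_ne_top (by norm_num)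
  have hm := jbMass_ne_top hp
  set B := A * jbMass (1 + δ) * jbMass (1 + δ) * jbMass (1 + δ) with hB
  have hBt : B ≠ ⊤ := by finiteness
  refine ⟨2 * (C + 2 * (B + B)), by finiteness, fun F G hF hG => ?_⟩
  unfold lowKernel
  have m1 : KerMeas fun n τ n₁ q => (tripleE (2 * δ / 2) n n₁ *
    (jbE ((1 + δ) / 2) (modulation n₁ q.1) * jbE ((1 + δ) / 2) (modulation (-n - n₁) q.2))) *
      jbE (1 + δ) (τ + q.1 + q.2) := fun n n₁ => by fun_prop
  have m2 : KerMeas fun n τ n₁ q => (freqE (7 / 6) n₁ * jbE ((1 + δ) / 2) (modulation (-n - n₁) q.2))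
      * jbE (1 + δ) (τ + q.1 + q.2) := fun n n₁ => by fun_prop
  rw [bil_add m1 _ hF hG, bil_add m2 _ hF hG]
  refine (sqNorm_add_le (measurable_bil m1 hF hG) _).trans ?_
  rw [mul_assoc, add_mul]
  refine mul_le_mul_right (add_le_add (h F G hF hG) ?_) _
  refine (sqNorm_add_le (measurable_bil m2 hF hG) _).trans ?_
  rw [mul_assoc, add_mul]
  refine mul_le_mul_right (add_le_add ?_ ?_) _
  · exact tsum_lintegral_weight_sq_le hF hG (M := fun _ n₁ => freqE (7 / 6) n₁) fun n => le_rfl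
  · rw [bil_swap (k' := fun n τ n₁ q => (freqE (7 / 6) n₁ * jbE ((1 + δ) / 2)
      (modulation (-n - n₁) q.2)) * jbE (1 + δ) (τ + q.1 + q.2))]
    · rw [mul_comm (sqNorm F)]
      exact tsum_lintegral_weight_sq_le hG hF (M := fun _ n₁ => freqE (7 / 6) n₁) fun n => le_rfl
    · intro n τ n₁ x y
      rw [show -n - (-n - n₁) = n₁ by abel, show τ + y + x = τ + x + y by ring]

theorem kerMeas_highKernel (δ : ℝ) : KerMeas (highKernel δ) := fun n n₁ => by
  unfold highKernel; fun_prop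

theorem kerMeas_lowKernel (δ : ℝ) : KerMeas (lowKernel δ) := fun n n₁ => by
  unfold lowKernel; fun_prop

/-- The bound for the kernel of outputs that are weighted in the modulation. -/
theorem exists_sqNorm_bil_highKernel_le {δ : ℝ} (hδ : 0 < δ) :
    ∃ C : ℝ≥0∞, C ≠ ⊤ ∧ ∀ F G : Freq → ℝ → ℝ≥0∞, (∀ n, Measurable (F n)) →
      (∀ n, Measurable (G n)) → sqNorm (bil (highKernel δ) F G) ≤ C * (sqNorm F * sqNorm G) := by
  have hp : 1 < 1 + δ := by linarith
  obtain ⟨C, hC, h⟩ := exists_strichartz_dual_le hp (show 0 < 2 * δ by linarith)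
  set A := ∑' n, freqE (7 / 6) n ^ 2 with hA
  have hAt : A ≠ ⊤ := tsum_freqE_sq_ne_top (by norm_num)
  have hm := jbMass_ne_top hp
  set B := A * jbMass (1 + δ) * jbMass (1 + δ) * jbMass (1 + δ) with hB
  have hBt : B ≠ ⊤ := by finiteness
  refine ⟨2 * (2 * (B + B) + 2 * (C + C)), by finiteness, fun F G hF hG => ?_⟩
  unfold highKernel
  have m1 : KerMeas fun n τ n₁ q => (jbE ((1 + δ) / 2) (modulation n τ) * freqE (7 / 6) n₁) *
      jbE (1 + δ) (τ + q.1 + q.2) := fun n n₁ => by fun_prop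
  have m2 : KerMeas fun n τ n₁ q => (jbE ((1 + δ) / 2) (modulation n τ) *
      freqE (7 / 6) (-n - n₁)) * jbE (1 + δ) (τ + q.1 + q.2) := fun n n₁ => by fun_prop
  have m3 : KerMeas fun n τ n₁ q => (jbE ((1 + δ) / 2) (modulation n τ) *
      (tripleE (2 * δ / 2) n n₁ * jbE ((1 + δ) / 2) (modulation (-n - n₁) q.2))) *
      jbE (1 + δ) (τ + q.1 + q.2) := fun n n₁ => by fun_prop
  have m12 : KerMeas fun n τ n₁ q => (jbE ((1 + δ) / 2) (modulation n τ) * freqE (7 / 6) n₁) *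
      jbE (1 + δ) (τ + q.1 + q.2) + (jbE ((1 + δ) / 2) (modulation n τ) *
      freqE (7 / 6) (-n - n₁)) * jbE (1 + δ) (τ + q.1 + q.2) := fun n n₁ => by fun_prop
  rw [bil_add m12 _ hF hG]
  refine (sqNorm_add_le (measurable_bil m12 hF hG) _).trans ?_
  rw [bil_add m1 _ hF hG, bil_add m3 _ hF hG, mul_assoc, add_mul]
  refine mul_le_mul_right (add_le_add ?_ ?_) _
  · refine (sqNorm_add_le (measurable_bil m1 hF hG) _).trans ?_
    rw [mul_assoc, add_mul]
    refine mul_le_mul_right (add_le_add ?_ ?_) _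
    · exact tsum_lintegral_high_high_sq_le hF hG (M := fun _ n₁ => freqE (7 / 6) n₁)
        fun n => le_rfl
    · exact tsum_lintegral_high_high_sq_le hF hG (M := fun n n₁ => freqE (7 / 6) (-n - n₁))
        fun n => (tsum_neg_sub n fun m => freqE (7 / 6) m ^ 2).le
  · refine (sqNorm_add_le (measurable_bil m3 hF hG) _).trans ?_
    rw [mul_assoc, add_mul]
    refine mul_le_mul_right (add_le_add (h F G hF hG) ?_) _
    rw [bil_swap (k' := fun n τ n₁ q => (jbE ((1 + δ) / 2) (modulation n τ) *
      (tripleE (2 * δ / 2) n n₁ * jbE ((1 + δ) / 2) (modulation (-n - n₁) q.2))) *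
      jbE (1 + δ) (τ + q.1 + q.2))]
    · rw [mul_comm (sqNorm F)]
      exact h G F hG hF
    · intro n τ n₁ x y
      rw [show τ + y + x = τ + x + y by ring, tripleE, tripleE, tripleSq_third]

/-- The kernel that arises from the time cutoff. -/
def cutKernel (δ : ℝ) (_n : Freq) (τ : ℝ) (_n₁ : Freq) (q : ℝ × ℝ) : ℝ≥0∞ :=
  jbE (1 - δ) (τ + q.1 + q.2)

theorem kerMeas_cutKernel (δ : ℝ) : KerMeas (cutKernel δ) := fun n n₁ => by
  unfold cutKernel; fun_prop

theorem measurable_inE (s : ℝ) (n : Freq) : Measurable (inE s n) := by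
  unfold inE
  refine Measurable.ite ?_ (by fun_prop) (by fun_prop)
  exact measurableSet_lt (by fun_prop) measurable_const

/-- The bilinear estimate, for nonnegative functions and with a fixed convolution kernel. -/
theorem exists_bilinear_le {δ : ℝ} (hδ : 0 < δ) (hδ' : δ ≤ 1 / 600) :
    ∃ C : ℝ≥0∞, C ≠ ⊤ ∧ ∀ f g : Freq → ℝ → ℝ≥0∞, (∀ n, Measurable (f n)) →
      (∀ n, Measurable (g n)) →
      sqNorm (fun n τ => outE (100 * δ - 2 / 3) n τ * bil (cutKernel δ) f g n τ) +
        sqNormOne (fun n τ => (freqE (-(100 * δ - 2 / 3)) n * jbE 1 (modulation n τ)) *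
          bil (cutKernel δ) f g n τ) ≤
      C * (sqNorm (fun n τ => inE (100 * δ - 2 / 3) n τ * f n τ) *
          sqNorm (fun n τ => inE (100 * δ - 2 / 3) n τ * g n τ) +
        sqNormOne (fun n τ => freqE (-(100 * δ - 2 / 3)) n * f n τ) *
          sqNormOne (fun n τ => freqE (-(100 * δ - 2 / 3)) n * g n τ)) := by
  have hp : 1 < 1 + δ := by linarith
  obtain ⟨C₁, hC₁, h₁⟩ := exists_sqNorm_bil_lowKernel_le hδ
  obtain ⟨C₂, hC₂, h₂⟩ := exists_sqNorm_bil_highKernel_le hδ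
  set m : Freq → ℝ≥0∞ := freqE (1 + δ) with hm
  set A := ∑' n, m n ^ 2 with hA
  have hAt : A ≠ ⊤ := tsum_freqE_sq_ne_top hp
  have hM := jbMass_ne_top hp
  set M := jbMass (1 + δ) with hMd
  set K := ENNReal.ofReal (4096 ^ 4) with hK
  have hKt : K ≠ ⊤ := ENNReal.ofReal_ne_top
  set s := 100 * δ - 2 / 3 with hs
  set D := A * M + A * (2 * M) ^ 2 + 2 * (C₁ + C₂) + M * C₂ with hD
  refine ⟨K ^ 2 * (2 * D) + K ^ 2 * (2 * D), by finiteness, fun f g hf hg => ?_⟩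
  set F := fun n τ => inE s n τ * f n τ with hFd
  set G := fun n τ => inE s n τ * g n τ with hGd
  set F₁ := fun n τ => freqE (-s) n * f n τ with hF₁d
  set G₁ := fun n τ => freqE (-s) n * g n τ with hG₁d
  have hF : ∀ n, Measurable (F n) := fun n => (measurable_inE s n).mul (hf n)
  have hG : ∀ n, Measurable (G n) := fun n => (measurable_inE s n).mul (hg n)
  have hF₁ : ∀ n, Measurable (F₁ n) := fun n => (hf n).const_mul _
  have hG₁ : ∀ n, Measurable (G₁ n) := fun n => (hg n).const_mul _
  set S := sqNorm F * sqNorm G with hS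
  set S₁ := sqNormOne F₁ * sqNormOne G₁ with hS₁
  have mr2 : KerMeas fun n τ n₁ q => m n * jbE ((1 + δ) / 2) (modulation n τ) :=
    fun n n₁ => by fun_prop
  have mr1 : KerMeas fun n τ n₁ q => m n * (jbE (1 + δ) (modulation n τ) +
    jbE (1 + δ) (τ + q.1 + q.2)) := fun n n₁ => by fun_prop
  have mlow := kerMeas_lowKernel δ
  have mhigh := kerMeas_highKernel δ
  have b2 : sqNorm (fun n τ => outE s n τ * bil (cutKernel δ) f g n τ) ≤
      K ^ 2 * (2 * D) * (S + S₁) := by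
    have hpt : ∀ n τ, outE s n τ * bil (cutKernel δ) f g n τ ≤
        K * (bil (fun n τ n₁ q => m n * jbE ((1 + δ) / 2) (modulation n τ)) F₁ G₁ n τ +
          (bil (lowKernel δ) F G n τ + bil (highKernel δ) F G n τ)) := by
      intro n τ
      rw [mul_bil (kerMeas_cutKernel δ) hf hg]
      rw [← congrFun (congrFun (bil_add mlow (highKernel δ) hF hG) n) τ]
      rw [bil, bil, bil, ← ENNReal.tsum_add, ← ENNReal.tsum_mul_left]
      refine ENNReal.tsum_le_tsum fun n₁ => ?_
      have k1 := mr2.apply n τ n₁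
      have k2 := hF₁ n₁
      have k3 := hG₁ (-n - n₁)
      rw [← lintegral_add_left (by fun_prop), ← lintegral_const_mul' _ _ hKt]
      refine lintegral_mono fun q => ?_
      calc _ = outE s n τ * jbE (1 - δ) (τ + q.1 + q.2) * (f n₁ q.1 * g (-n - n₁) q.2) := rfl
        _ ≤ _ := mul_le_mul_left (outE_mul_le hδ hδ' n τ n₁ q) _
        _ = _ := by simp only [hFd, hGd, hF₁d, hG₁d, hm, hK, hs]; ring
    refine (sqNorm_mono hpt).trans ?_
    rw [sqNorm_const_mul hKt, mul_assoc]
    refine mul_le_mul_right ?_ _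
    refine (sqNorm_add_le (measurable_bil mr2 hF₁ hG₁) _).trans ?_
    rw [mul_assoc]
    refine mul_le_mul_right ?_ _
    calc _ ≤ A * M * S₁ + 2 * (C₁ * S + C₂ * S) :=
          add_le_add (tsum_lintegral_one_one_sq_le hF₁ hG₁ m)
            ((sqNorm_add_le (measurable_bil mlow hF hG) _).trans
              (mul_le_mul_right (add_le_add (h₁ F G hF hG) (h₂ F G hF hG)) _))
      -- The added nonnegative terms complete the bound to exactly D(S + S₁), so that the L² and L¹
      -- outputs share one constant.
      _ ≤ A * M * S₁ + 2 * (C₁ * S + C₂ * S) + (A * M * S + 2 * (C₁ + C₂) * S₁ +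
          (A * (2 * M) ^ 2 + M * C₂) * (S + S₁)) := le_self_add
      _ = _ := by rw [hD]; ring
  have b1 : sqNormOne (fun n τ => (freqE (-s) n * jbE 1 (modulation n τ)) *
      bil (cutKernel δ) f g n τ) ≤ K ^ 2 * (2 * D) * (S + S₁) := by
    have hpt : ∀ n τ, (freqE (-s) n * jbE 1 (modulation n τ)) * bil (cutKernel δ) f g n τ ≤
        K * (bil (fun n τ n₁ q => m n * (jbE (1 + δ) (modulation n τ) +
          jbE (1 + δ) (τ + q.1 + q.2))) F₁ G₁ n τ +
          jbE ((1 + δ) / 2) (modulation n τ) * bil (highKernel δ) F G n τ) := by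
      intro n τ
      rw [mul_bil (kerMeas_cutKernel δ) hf hg (fun n τ => freqE (-s) n * jbE 1 (modulation n τ)),
        mul_bil mhigh hF hG (fun n τ => jbE ((1 + δ) / 2) (modulation n τ))]
      rw [bil, bil, bil, ← ENNReal.tsum_add, ← ENNReal.tsum_mul_left]
      refine ENNReal.tsum_le_tsum fun n₁ => ?_
      have k1 := mr1.apply n τ n₁
      have k2 := hF₁ n₁
      have k3 := hG₁ (-n - n₁)
      rw [← lintegral_add_left (by fun_prop), ← lintegral_const_mul' _ _ hKt]
      refine lintegral_mono fun q => ?_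
      calc _ = (freqE (-s) n * jbE 1 (modulation n τ)) * jbE (1 - δ) (τ + q.1 + q.2) *
            (f n₁ q.1 * g (-n - n₁) q.2) := rfl
        _ ≤ _ := mul_le_mul_left (freqE_mul_jbE_mul_le hδ hδ' n τ n₁ q) _
        _ = _ := by simp only [hFd, hGd, hF₁d, hG₁d, hm, hK, hs]; ring
    refine (sqNormOne_mono hpt).trans ?_
    rw [sqNormOne_const_mul hKt, mul_assoc]
    refine mul_le_mul_right ?_ _
    refine (sqNormOne_add_le (measurable_bil mr1 hF₁ hG₁) _).trans ?_
    rw [mul_assoc]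
    refine mul_le_mul_right ?_ _
    -- Cauchy–Schwarz in τ against ⟨σ⟩^{-(1+δ)/2} reduces this L¹ output to the L² bound for
    -- `highKernel`.
    have hcs : sqNormOne (fun n τ => jbE ((1 + δ) / 2) (modulation n τ) *
        bil (highKernel δ) F G n τ) ≤ M * (C₂ * S) := by
      refine le_trans ?_ (mul_le_mul_right (h₂ F G hF hG) _)
      rw [sqNormOne, sqNorm, ← ENNReal.tsum_mul_left]
      refine ENNReal.tsum_le_tsum fun n => ?_
      refine (lintegral_mul_sq_le _ (by fun_prop)
        (measurable_bil mhigh hF hG n).aemeasurable).trans_eq ?_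
      simp_rw [jbE_half_sq]
      rw [lintegral_jbE_modulation]
    calc _ ≤ A * (2 * M) ^ 2 * S₁ + M * (C₂ * S) :=
          add_le_add (tsum_lintegral_one_sq_le hF₁ hG₁ m) hcs
      _ ≤ A * (2 * M) ^ 2 * S₁ + M * (C₂ * S) + (A * (2 * M) ^ 2 * S + M * C₂ * S₁ +
          (A * M + 2 * (C₁ + C₂)) * (S + S₁)) := le_self_add
      _ = _ := by rw [hD]; ring
  rw [add_mul]
  exact add_le_add b2 b1

/-! ### Translation into Z-norms. -/

theorem ell2Lp_two (g : Freq → ℝ → ℂ) :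
    ell2Lp 2 g = sqNorm (fun n τ => ‖g n τ‖ₑ) ^ (1 / 2 : ℝ) := by
  rw [ell2Lp, sqNorm]
  congr 1
  refine tsum_congr fun n => ?_
  rw [eLpNorm_eq_lintegral_rpow_enorm_toReal (by norm_num) (by norm_num)]
  simp only [ENNReal.toReal_ofNat, ENNReal.rpow_two]
  rw [← ENNReal.rpow_two, ← ENNReal.rpow_mul]
  norm_num

theorem ell2Lp_one (g : Freq → ℝ → ℂ) :
    ell2Lp 1 g = sqNormOne (fun n τ => ‖g n τ‖ₑ) ^ (1 / 2 : ℝ) := by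
  rw [ell2Lp, sqNormOne]
  congr 1
  refine tsum_congr fun n => ?_
  rw [eLpNorm_one_eq_lintegral_enorm]

theorem rpow_half_sq (a : ℝ≥0∞) : (a ^ (1 / 2 : ℝ)) ^ 2 = a := by
  rw [← ENNReal.rpow_two, ← ENNReal.rpow_mul]; norm_num

theorem sq_rpow_half (a : ℝ≥0∞) : (a ^ 2) ^ (1 / 2 : ℝ) = a := by
  rw [← ENNReal.rpow_two, ← ENNReal.rpow_mul]; norm_num

theorem enorm_ofReal_mul {w : ℝ} (hw : 0 ≤ w) (z : ℂ) :
    ‖((w : ℝ) : ℂ) * z‖ₑ = ENNReal.ofReal w * ‖z‖ₑ := by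
  rw [enorm_mul, ← ofReal_norm, Complex.norm_real, Real.norm_of_nonneg hw]

theorem enorm_weight_mul (s b : ℝ) (n : Freq) (τ : ℝ) (z : ℂ) :
    ‖((jbFreq n ^ s * jb (modulation n τ) ^ b : ℝ) : ℂ) * z‖ₑ =
      freqE (-s) n * jbE (-b) (modulation n τ) * ‖z‖ₑ := by
  have h1 := jbFreq_pos n
  have h2 := jb_pos (modulation n τ)
  rw [enorm_ofReal_mul (by positivity), ENNReal.ofReal_mul (by positivity), freqE, jbE,
    neg_neg, neg_neg]

theorem enorm_freq_mul (s : ℝ) (n : Freq) (z : ℂ) :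
    ‖((jbFreq n ^ s : ℝ) : ℂ) * z‖ₑ = freqE (-s) n * ‖z‖ₑ := by
  have h1 := jbFreq_pos n
  rw [enorm_ofReal_mul (by positivity), freqE, neg_neg]

theorem enorm_jb_mul (b : ℝ) (n : Freq) (τ : ℝ) (z : ℂ) :
    ‖((jb (modulation n τ) ^ b : ℝ) : ℂ) * z‖ₑ = jbE (-b) (modulation n τ) * ‖z‖ₑ := by
  have h2 := jb_pos (modulation n τ)
  rw [enorm_ofReal_mul (by positivity), jbE, neg_neg]

theorem enorm_invModulation (P : Freq → ℝ → ℂ) (n : Freq) (τ : ℝ) :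
    ‖invModulation P n τ‖ₑ = jbE 1 (modulation n τ) * ‖P n τ‖ₑ := by
  have h2 := jb_pos (modulation n τ)
  rw [invModulation, enorm_ofReal_mul (by positivity), jbE, Real.rpow_neg_one]

theorem Plo_of_low {f : Freq → ℝ → ℂ} {n : Freq} {τ : ℝ}
    (h : |modulation n τ| < normSq n / 2 ^ 10) : Plo f n τ = f n τ :=
  Set.indicator_of_mem (s := {τ : ℝ | |modulation n τ| < normSq n / 2 ^ 10}) h _

theorem Plo_of_high {f : Freq → ℝ → ℂ} {n : Freq} {τ : ℝ}
    (h : ¬|modulation n τ| < normSq n / 2 ^ 10) : Plo f n τ = 0 :=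
  Set.indicator_of_notMem (s := {τ : ℝ | |modulation n τ| < normSq n / 2 ^ 10}) h _

theorem Phi_of_low {f : Freq → ℝ → ℂ} {n : Freq} {τ : ℝ}
    (h : |modulation n τ| < normSq n / 2 ^ 10) : Phi f n τ = 0 :=
  Set.indicator_of_notMem (s := {τ : ℝ | normSq n / 2 ^ 10 ≤ |modulation n τ|}) (not_le.2 h) _

theorem Phi_of_high {f : Freq → ℝ → ℂ} {n : Freq} {τ : ℝ}
    (h : ¬|modulation n τ| < normSq n / 2 ^ 10) : Phi f n τ = f n τ :=
  Set.indicator_of_mem (s := {τ : ℝ | normSq n / 2 ^ 10 ≤ |modulation n τ|}) (not_lt.1 h) _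

theorem jbE_mul_jbE (p q x : ℝ) : jbE p x * jbE q x = jbE (p + q) x := by
  rw [jbE_eq_exp, jbE_eq_exp, jbE_eq_exp, ofReal_exp_mul]
  congr 2; ring

theorem jbE_zero (x : ℝ) : jbE 0 x = 1 := by simp [jbE]

theorem freqE_pos (q : ℝ) (n : Freq) : 0 < freqE q n :=
  ENNReal.ofReal_pos.2 (Real.rpow_pos_of_pos (jbFreq_pos n) _)

theorem jbE_pos (q x : ℝ) : 0 < jbE q x :=
  ENNReal.ofReal_pos.2 (Real.rpow_pos_of_pos (jb_pos x) _)

theorem measurableSet_low (n : Freq) :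
    MeasurableSet {τ : ℝ | |modulation n τ| < normSq n / 2 ^ 10} :=
  measurableSet_lt (by fun_prop) measurable_const

/-- The norms of an input that enter the bilinear estimate are controlled by its `Z`-norm. -/
theorem sqNorm_inE_le {s : ℝ} {f : Freq → ℝ → ℂ} (hf : ∀ n, Measurable (f n)) :
    sqNorm (fun n τ => inE s n τ * ‖f n τ‖ₑ) ≤ ZhatNorm s (2 / 3) f ^ 2 := by
  have hlo : ∀ n, Measurable (Plo f n) := fun n => (hf n).indicator (measurableSet_low n)
  set X := sqNorm fun n τ => ‖((jbFreq n ^ s * jb (modulation n τ) ^ (2 / 3 : ℝ) : ℝ) : ℂ) *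
    Plo f n τ‖ₑ with hX
  set Y := sqNorm fun n τ => ‖((jb (modulation n τ) ^ (s / 2 + 2 / 3) : ℝ) : ℂ) *
    Phi f n τ‖ₑ with hY
  have h1 : sqNorm (fun n τ => inE s n τ * ‖f n τ‖ₑ) ≤ X + Y := by
    rw [hX, hY, sqNorm, sqNorm, sqNorm, ← ENNReal.tsum_add]
    refine ENNReal.tsum_le_tsum fun n => ?_
    simp_rw [enorm_weight_mul, enorm_jb_mul]
    have := hlo n
    rw [← lintegral_add_left (by fun_prop)]
    refine lintegral_mono fun τ => ?_
    by_cases h : |modulation n τ| < normSq n / 2 ^ 10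
    · rw [Plo_of_low h, Phi_of_low h, inE, if_pos h]
      exact le_self_add
    · rw [Plo_of_high h, Phi_of_high h, inE, if_neg h]
      exact le_add_self
  refine h1.trans ?_
  have h2 : X ^ (1 / 2 : ℝ) + Y ^ (1 / 2 : ℝ) ≤ ZhatNorm s (2 / 3) f := by
    rw [ZhatNorm, XhatNorm, YhatNorm, ell2Lp_two, ell2Lp_two]
    exact add_le_add le_rfl le_add_self
  calc X + Y = (X ^ (1 / 2 : ℝ)) ^ 2 + (Y ^ (1 / 2 : ℝ)) ^ 2 := by
        rw [rpow_half_sq, rpow_half_sq]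
    _ ≤ (X ^ (1 / 2 : ℝ)) ^ 2 + (Y ^ (1 / 2 : ℝ)) ^ 2 +
        2 * X ^ (1 / 2 : ℝ) * Y ^ (1 / 2 : ℝ) := le_self_add
    _ = (X ^ (1 / 2 : ℝ) + Y ^ (1 / 2 : ℝ)) ^ 2 := by ring
    _ ≤ _ := pow_le_pow_left' h2 2

/-- At low modulation, Cauchy–Schwarz against ⟨σ⟩^{-2/3}, which is square integrable as 4/3 > 1; at
high modulation the L¹ norm is part of the Y-norm. -/
theorem sqNormOne_freqE_le {s : ℝ} {f : Freq → ℝ → ℂ} (hf : ∀ n, Measurable (f n)) :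
    sqNormOne (fun n τ => freqE (-s) n * ‖f n τ‖ₑ) ≤
      2 * (jbMass (4 / 3) + 1) * ZhatNorm s (2 / 3) f ^ 2 := by
  have hlo : ∀ n, Measurable (Plo f n) := fun n => (hf n).indicator (measurableSet_low n)
  set a : Freq → ℝ → ℝ≥0∞ := fun n τ =>
    ‖((jbFreq n ^ s * jb (modulation n τ) ^ (2 / 3 : ℝ) : ℝ) : ℂ) * Plo f n τ‖ₑ with ha
  set b : Freq → ℝ → ℝ≥0∞ := fun n τ => ‖((jbFreq n ^ s : ℝ) : ℂ) * Phi f n τ‖ₑ with hb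
  have ham : ∀ n, Measurable (a n) := fun n => by
    have := hlo n
    simp only [ha, enorm_weight_mul]
    fun_prop
  have hpt : ∀ n τ, freqE (-s) n * ‖f n τ‖ₑ ≤ jbE (2 / 3) (modulation n τ) * a n τ + b n τ := by
    intro n τ
    simp only [ha, hb, enorm_weight_mul, enorm_freq_mul]
    by_cases h : |modulation n τ| < normSq n / 2 ^ 10
    · rw [Plo_of_low h]
      refine le_trans (le_of_eq ?_) le_self_add
      calc _ = freqE (-s) n * (jbE (2 / 3) (modulation n τ) * jbE (-(2 / 3)) (modulation n τ)) *
            ‖f n τ‖ₑ := by rw [jbE_mul_jbE, add_neg_cancel, jbE_zero, mul_one]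
        _ = _ := by ring
    · rw [Phi_of_high h]
      exact le_add_self
  refine (sqNormOne_mono hpt).trans ?_
  refine (sqNormOne_add_le (F := fun n τ => jbE (2 / 3) (modulation n τ) * a n τ)
    (fun n => by have := ham n; fun_prop) _).trans ?_
  rw [mul_assoc, add_mul, one_mul]
  refine mul_le_mul_right (add_le_add ?_ ?_) _
  · have h1 : sqNorm a ≤ ZhatNorm s (2 / 3) f ^ 2 := by
      rw [← rpow_half_sq (sqNorm a), ha, ← ell2Lp_two]
      exact pow_le_pow_left' le_self_add 2
    refine le_trans ?_ (mul_le_mul_right h1 _)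
    rw [sqNormOne, sqNorm, ← ENNReal.tsum_mul_left]
    refine ENNReal.tsum_le_tsum fun n => ?_
    refine (lintegral_mul_sq_le _ (by fun_prop) (ham n).aemeasurable).trans_eq ?_
    have : ∀ τ, jbE (2 / 3) (modulation n τ) ^ 2 = jbE (4 / 3) (modulation n τ) := fun τ => by
      rw [pow_two, jbE_mul_jbE]; norm_num
    simp_rw [this]
    rw [lintegral_jbE_modulation]
  · rw [← rpow_half_sq (sqNormOne _), hb, ← ell2Lp_one]
    exact pow_le_pow_left' (le_self_add.trans le_add_self) 2

/-- The `Z`-norm of the output is controlled by the norms that occur in the bilinear estimate. -/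
theorem ZhatNorm_invModulation_le {s : ℝ} {P : Freq → ℝ → ℂ} {B : Freq → ℝ → ℝ≥0∞}
    (hP : ∀ n, ∀ᵐ τ : ℝ, ‖P n τ‖ₑ ≤ B n τ) :
    ZhatNorm s (2 / 3) (invModulation P) ≤
      3 * (sqNorm (fun n τ => outE s n τ * B n τ) +
        sqNormOne (fun n τ => (freqE (-s) n * jbE 1 (modulation n τ)) * B n τ)) ^ (1 / 2 : ℝ) := by
  set E := sqNorm (fun n τ => outE s n τ * B n τ) +
        sqNormOne (fun n τ => (freqE (-s) n * jbE 1 (modulation n τ)) * B n τ) with hE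
  have h1 : ell2Lp 2 (fun n τ => ((jbFreq n ^ s * jb (modulation n τ) ^ (2 / 3 : ℝ) : ℝ) : ℂ) *
      Plo (invModulation P) n τ) ≤ E ^ (1 / 2 : ℝ) := by
    rw [ell2Lp_two]
    refine ENNReal.rpow_le_rpow (le_trans ?_ le_self_add) (by norm_num)
    refine ENNReal.tsum_le_tsum fun n => lintegral_mono_ae ?_
    filter_upwards [hP n] with τ hτ
    refine pow_le_pow_left' ?_ 2
    rw [enorm_weight_mul]
    by_cases h : |modulation n τ| < normSq n / 2 ^ 10
    · rw [Plo_of_low h, enorm_invModulation, outE, if_pos h]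
      calc _ = freqE (-s) n * (jbE (-(2 / 3)) (modulation n τ) * jbE 1 (modulation n τ)) *
            ‖P n τ‖ₑ := by ring
        _ ≤ _ := by
          rw [jbE_mul_jbE, show -(2 / 3) + (1 : ℝ) = 1 / 3 by norm_num]
          exact mul_le_mul_right hτ _
    · rw [Plo_of_high h]; simp
  have h2 : ell2Lp 1 (fun n τ => ((jbFreq n ^ s : ℝ) : ℂ) * Phi (invModulation P) n τ) ≤
      E ^ (1 / 2 : ℝ) := by
    rw [ell2Lp_one]
    refine ENNReal.rpow_le_rpow (le_trans ?_ le_add_self) (by norm_num)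
    refine ENNReal.tsum_le_tsum fun n => pow_le_pow_left' (lintegral_mono_ae ?_) 2
    filter_upwards [hP n] with τ hτ
    rw [enorm_freq_mul]
    by_cases h : |modulation n τ| < normSq n / 2 ^ 10
    · rw [Phi_of_low h]; simp
    · rw [Phi_of_high h, enorm_invModulation, mul_assoc]
      gcongr
  have h3 : ell2Lp 2 (fun n τ => ((jb (modulation n τ) ^ (s / 2 + 2 / 3) : ℝ) : ℂ) *
      Phi (invModulation P) n τ) ≤ E ^ (1 / 2 : ℝ) := by
    rw [ell2Lp_two]
    refine ENNReal.rpow_le_rpow (le_trans ?_ le_self_add) (by norm_num)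
    refine ENNReal.tsum_le_tsum fun n => lintegral_mono_ae ?_
    filter_upwards [hP n] with τ hτ
    refine pow_le_pow_left' ?_ 2
    rw [enorm_jb_mul]
    by_cases h : |modulation n τ| < normSq n / 2 ^ 10
    · rw [Phi_of_low h]; simp
    · rw [Phi_of_high h, enorm_invModulation, outE, if_neg h, ← mul_assoc, jbE_mul_jbE,
        show -(s / 2 + 2 / 3) + 1 = 1 / 3 - s / 2 by ring]
      gcongr
  calc _ ≤ E ^ (1 / 2 : ℝ) + (E ^ (1 / 2 : ℝ) + E ^ (1 / 2 : ℝ)) :=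
        add_le_add h1 (add_le_add h2 h3)
    _ = _ := by ring

theorem outE_pos (s : ℝ) (n : Freq) (τ : ℝ) : 0 < outE s n τ := by
  unfold outE
  split_ifs
  · exact ENNReal.mul_pos (freqE_pos _ _).ne' (jbE_pos _ _).ne'
  · exact jbE_pos _ _

theorem measurable_outE (s : ℝ) (n : Freq) : Measurable (outE s n) := by
  unfold outE
  exact Measurable.ite (measurableSet_low n) (by fun_prop) (by fun_prop)

/-- The bilinear estimate in terms of the `Z`-norms of the inputs. -/
theorem exists_bilinear_ZhatNorm_le {δ : ℝ} (hδ : 0 < δ) (hδ' : δ ≤ 1 / 600) :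
    ∃ C : ℝ≥0∞, C ≠ ⊤ ∧ ∀ f g : Freq → ℝ → ℂ, (∀ n, Measurable (f n)) →
      (∀ n, Measurable (g n)) →
      sqNorm (fun n τ => outE (100 * δ - 2 / 3) n τ *
          bil (cutKernel δ) (fun n τ => ‖f n τ‖ₑ) (fun n τ => ‖g n τ‖ₑ) n τ) +
        sqNormOne (fun n τ => (freqE (-(100 * δ - 2 / 3)) n * jbE 1 (modulation n τ)) *
          bil (cutKernel δ) (fun n τ => ‖f n τ‖ₑ) (fun n τ => ‖g n τ‖ₑ) n τ) ≤
      (C * (ZhatNorm (100 * δ - 2 / 3) (2 / 3) f * ZhatNorm (100 * δ - 2 / 3) (2 / 3) g)) ^ 2 := by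
  obtain ⟨C, hC, h⟩ := exists_bilinear_le hδ hδ'
  set s := 100 * δ - 2 / 3 with hs
  set L := 2 * (jbMass (4 / 3) + 1) with hL
  have hM : jbMass (4 / 3) ≠ ⊤ := jbMass_ne_top (by norm_num)
  have hLt : L ≠ ⊤ := by finiteness
  refine ⟨(C * (1 + L ^ 2)) ^ (1 / 2 : ℝ), ENNReal.rpow_ne_top_of_nonneg (by norm_num)
    (by finiteness), fun f g hf hg => ?_⟩
  refine (h _ _ (fun n => (hf n).enorm) (fun n => (hg n).enorm)).trans ?_
  rw [mul_pow, rpow_half_sq, mul_assoc]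
  refine mul_le_mul_right ?_ _
  calc _ ≤ ZhatNorm s (2 / 3) f ^ 2 * ZhatNorm s (2 / 3) g ^ 2 +
        (L * ZhatNorm s (2 / 3) f ^ 2) * (L * ZhatNorm s (2 / 3) g ^ 2) :=
        add_le_add (mul_le_mul' (sqNorm_inE_le hf) (sqNorm_inE_le hg))
          (mul_le_mul' (sqNormOne_freqE_le hf) (sqNormOne_freqE_le hg))
    _ = _ := by ring

/-- The output weight never vanishes, so finiteness of the weighted norm forces finiteness almost
everywhere. This yields the absolute convergence of the product series. -/
theorem ae_bil_lt_top {s : ℝ} {B : Freq → ℝ → ℝ≥0∞} (hB : ∀ n, Measurable (B n))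
    (h : sqNorm (fun n τ => outE s n τ * B n τ) ≠ ⊤) (n : Freq) : ∀ᵐ τ : ℝ, B n τ < ⊤ := by
  have h1 : ∫⁻ τ, (outE s n τ * B n τ) ^ 2 ≠ ⊤ := ENNReal.ne_top_of_tsum_ne_top h n
  have h2 := ae_lt_top (((measurable_outE s n).mul (hB n)).pow_const 2) h1
  filter_upwards [h2] with τ hτ
  by_contra hcon
  rw [not_lt, top_le_iff] at hcon
  simp [hcon, ENNReal.mul_top (outE_pos s n τ).ne'] at hτ

/-! ### The time cutoff -/

/-- The Fourier integral of the squared time cutoff. -/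
def cutHat (φ : ℝ → ℝ) (T ρ : ℝ) : ℂ :=
  ∫ t : ℝ, Complex.exp (-Complex.I * ((t * ρ : ℝ) : ℂ)) * (cutoff φ T t * cutoff φ T t)

theorem norm_exp_neg_I_mul (x : ℝ) : ‖Complex.exp (-Complex.I * (x : ℂ))‖ = 1 := by
  rw [show -Complex.I * (x : ℂ) = ((-x : ℝ) : ℂ) * Complex.I by push_cast; ring]
  exact Complex.norm_exp_ofReal_mul_I _

/-- One integration by parts; the constant is ‖ψ‖₁ + ‖ψ'‖₁. First-order decay suffices because the
kernel only needs the exponent 1 - δ. -/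
theorem exists_norm_fourier_mul_le {ψ : ℝ → ℂ} (hψ : ContDiff ℝ 1 ψ) (hc : HasCompactSupport ψ) :
    ∃ C : ℝ, 0 ≤ C ∧ ∀ ξ : ℝ,
      ‖∫ t : ℝ, Complex.exp (-Complex.I * ((t * ξ : ℝ) : ℂ)) * ψ t‖ * (1 + |ξ|) ≤ C := by
  have hi : Integrable ψ := hψ.continuous.integrable_of_hasCompactSupport hc
  have hd : Integrable (deriv ψ) :=
    (hψ.continuous_deriv le_rfl).integrable_of_hasCompactSupport hc.deriv
  have hexp : ∀ ξ : ℝ, Continuous fun t : ℝ => Complex.exp (-Complex.I * ((t * ξ : ℝ) : ℂ)) := by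
    intro ξ; fun_prop
  have hb : ∀ {g : ℝ → ℂ}, Integrable g → ∀ ξ : ℝ,
      Integrable fun t : ℝ => Complex.exp (-Complex.I * ((t * ξ : ℝ) : ℂ)) * g t := by
    intro g hg ξ
    refine hg.bdd_mul (c := 1) (hexp ξ).aestronglyMeasurable (Filter.Eventually.of_forall fun t => ?_)
    exact (norm_exp_neg_I_mul _).le
  refine ⟨(∫ t, ‖ψ t‖) + ∫ t, ‖deriv ψ t‖, by positivity, fun ξ => ?_⟩
  have hle : ∀ g : ℝ → ℂ, ‖∫ t : ℝ, Complex.exp (-Complex.I * ((t * ξ : ℝ) : ℂ)) * g t‖ ≤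
      ∫ t, ‖g t‖ := by
    intro g
    refine (norm_integral_le_integral_norm _).trans_eq ?_
    simp_rw [norm_mul, norm_exp_neg_I_mul, one_mul]
  have hparts : ∫ t : ℝ, Complex.exp (-Complex.I * ((t * ξ : ℝ) : ℂ)) * deriv ψ t =
      Complex.I * ξ * ∫ t : ℝ, Complex.exp (-Complex.I * ((t * ξ : ℝ) : ℂ)) * ψ t := by
    have hder : ∀ t : ℝ, HasDerivAt (fun t : ℝ => Complex.exp (-Complex.I * ((t * ξ : ℝ) : ℂ)))
        (Complex.exp (-Complex.I * ((t * ξ : ℝ) : ℂ)) * (-Complex.I * ξ)) t := by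
      intro t
      have h1 : HasDerivAt (fun t : ℝ => t * ξ) ξ t := by simpa using (hasDerivAt_id t).mul_const ξ
      exact (h1.ofReal_comp.const_mul (-Complex.I)).cexp
    rw [integral_mul_deriv_eq_deriv_mul_of_integrable (fun t _ => hder t)
      (fun t _ => (hψ.differentiable (by norm_num) t).hasDerivAt) (hb hd ξ) ?_ (hb hi ξ)]
    · rw [← integral_const_mul, ← integral_neg]
      congr 1; funext t; ring
    · refine ((hb hi ξ).const_mul (-Complex.I * ξ)).congr (Filter.Eventually.of_forall fun t => ?_)
      simp only [Pi.mul_apply]; ring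
  have h1 := hle (deriv ψ)
  rw [hparts, norm_mul, norm_mul, Complex.norm_I, one_mul, Complex.norm_real, Real.norm_eq_abs] at h1
  have h2 := hle ψ
  linarith

/-- The bound of the Fourier transform of the time cutoff that yields a power of `T`. -/
theorem exists_norm_cutHat_le {φ : ℝ → ℝ} (hφ : ContDiff ℝ ∞ φ)
    (hs : ∀ t, t ∉ Set.Icc (-2 : ℝ) 2 → φ t = 0) :
    ∃ C : ℝ, 0 ≤ C ∧ ∀ δ T : ℝ, 0 < δ → δ ≤ 1 → 0 < T → T ≤ 1 → ∀ ρ : ℝ,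
      ‖cutHat φ T ρ‖ ≤ C * T ^ δ * jb ρ ^ (-(1 - δ)) := by
  have hc : HasCompactSupport fun t => ((φ t : ℝ) : ℂ) * ((φ t : ℝ) : ℂ) := by
    refine HasCompactSupport.intro isCompact_Icc (K := Set.Icc (-2 : ℝ) 2) fun t ht => ?_
    simp [hs t ht]
  have hψ : ContDiff ℝ 1 fun t => ((φ t : ℝ) : ℂ) * ((φ t : ℝ) : ℂ) := by
    have h1 : ContDiff ℝ 1 fun t => ((φ t : ℝ) : ℂ) :=
      Complex.ofRealCLM.contDiff.comp (hφ.of_le (by exact_mod_cast le_top))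
    exact h1.mul h1
  obtain ⟨C, hC, h⟩ := exists_norm_fourier_mul_le hψ hc
  refine ⟨C, hC, fun δ T hδ hδ' hT hT' ρ => ?_⟩
  -- Scaling: the transform for the parameter T is T times the transform of φ² at Tρ.
  have hscale : cutHat φ T ρ = T * ∫ t : ℝ, Complex.exp (-Complex.I * ((t * (T * ρ) : ℝ) : ℂ)) *
      (((φ t : ℝ) : ℂ) * ((φ t : ℝ) : ℂ)) := by
    have := Measure.integral_comp_div (fun t : ℝ =>
      Complex.exp (-Complex.I * ((t * (T * ρ) : ℝ) : ℂ)) * (((φ t : ℝ) : ℂ) * ((φ t : ℝ) : ℂ))) T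
    rw [abs_of_pos hT, Complex.real_smul] at this
    rw [← this, cutHat]
    congr 1; funext t
    rw [cutoff, show t / T * (T * ρ) = t * ρ by field_simp]
  have hTρ := h (T * ρ)
  set Ψ := ‖∫ t : ℝ, Complex.exp (-Complex.I * ((t * (T * ρ) : ℝ) : ℂ)) *
      (((φ t : ℝ) : ℂ) * ((φ t : ℝ) : ℂ))‖ with hΨ
  rw [hscale, norm_mul, Complex.norm_real, Real.norm_of_nonneg hT.le]
  have hj := jb_pos ρ
  have hx1 : 1 ≤ 1 + |T * ρ| := by linarith [abs_nonneg (T * ρ)]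
  have hx : T * jb ρ ≤ 1 + |T * ρ| := by
    rw [abs_mul, abs_of_pos hT]
    have := jb_le_one_add_abs ρ
    nlinarith
  -- Only the power 1 - δ of the decay is used. It consumes T^{1-δ} from the prefactor T and leaves
  -- the gain T^δ.
  have hx2 : (T * jb ρ) ^ (1 - δ) ≤ 1 + |T * ρ| := by
    calc (T * jb ρ) ^ (1 - δ) ≤ (1 + |T * ρ|) ^ (1 - δ) :=
          Real.rpow_le_rpow (by positivity) hx (by linarith)
      _ ≤ (1 + |T * ρ|) ^ (1 : ℝ) := Real.rpow_le_rpow_of_exponent_le hx1 (by linarith)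
      _ = _ := Real.rpow_one _
  have hΨ0 : 0 ≤ Ψ := norm_nonneg _
  have hpos : 0 < (T * jb ρ) ^ (1 - δ) := by positivity
  have key : Ψ * (T * jb ρ) ^ (1 - δ) ≤ C := (mul_le_mul_of_nonneg_left hx2 hΨ0).trans hTρ
  have e : T = T ^ δ * T ^ (1 - δ) := by
    rw [← Real.rpow_add hT]; simp
  have e' : jb ρ ^ (1 - δ) * jb ρ ^ (-(1 - δ)) = 1 := by
    rw [← Real.rpow_add hj]; simp
  rw [Real.mul_rpow hT.le hj.le] at key
  calc T * Ψ = T ^ δ * T ^ (1 - δ) * Ψ * (jb ρ ^ (1 - δ) * jb ρ ^ (-(1 - δ))) := by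
        rw [e', mul_one, ← e]
    _ = (Ψ * (T ^ (1 - δ) * jb ρ ^ (1 - δ))) * (T ^ δ * jb ρ ^ (-(1 - δ))) := by ring
    _ ≤ C * (T ^ δ * jb ρ ^ (-(1 - δ))) := by gcongr
    _ = _ := by ring

theorem integrable_cutoff_sq {φ : ℝ → ℝ} (hφ : Continuous φ)
    (hs : ∀ t, t ∉ Set.Icc (-2 : ℝ) 2 → φ t = 0) {T : ℝ} (hT : 0 < T) :
    Integrable fun t => cutoff φ T t * cutoff φ T t := by
  refine Continuous.integrable_of_hasCompactSupport (by unfold cutoff; fun_prop) ?_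
  refine HasCompactSupport.intro isCompact_Icc (K := Set.Icc (-(2 * T)) (2 * T)) fun t ht => ?_
  have : φ (t / T) = 0 := by
    refine hs _ fun h => ht ?_
    rw [Set.mem_Icc, le_div_iff₀ hT, div_le_iff₀ hT] at h
    constructor <;> linarith [h.1, h.2]
  simp [cutoff, this]

/-- The contribution of two modes, as an integral over their temporal frequencies. -/
theorem enorm_prodTerm_le {φ : ℝ → ℝ} (hφ : Continuous φ)
    (hs : ∀ t, t ∉ Set.Icc (-2 : ℝ) 2 → φ t = 0) {T : ℝ} (hT : 0 < T) {f g : Freq → ℝ → ℂ}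
    (hf : ∀ n, Integrable (f n)) (hg : ∀ n, Integrable (g n)) (n : Freq) (τ : ℝ) (n₁ : Freq) :
    ‖prodTerm φ T f g n τ n₁‖ₑ ≤ ∫⁻ q : ℝ × ℝ, ‖cutHat φ T (τ + q.1 + q.2)‖ₑ *
      (‖f n₁ q.1‖ₑ * ‖g (-n - n₁) q.2‖ₑ) := by
  set m := -n - n₁ with hm
  set c : ℝ → ℂ := fun t => cutoff φ T t * cutoff φ T t with hc
  have hstar : ∀ (h : ℝ → ℂ) (t : ℝ), star (∫ τ : ℝ, Complex.exp (Complex.I * ((t * τ : ℝ) : ℂ)) *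
      h τ) = ∫ τ : ℝ, Complex.exp (-Complex.I * ((t * τ : ℝ) : ℂ)) * star (h τ) := by
    intro h t
    rw [← starRingEnd_apply, ← integral_conj]
    congr 1; funext x
    rw [map_mul, ← Complex.exp_conj, map_mul, Complex.conj_I, Complex.conj_ofReal]
    rfl
  have hkey : ∫ t : ℝ, Complex.exp (-Complex.I * ((t * τ : ℝ) : ℂ)) *
      ((cutoff φ T t * star (spaceCoeff f n₁ t)) * (cutoff φ T t * star (spaceCoeff g m t))) =
      ∫ q : ℝ × ℝ, cutHat φ T (τ + q.1 + q.2) * (star (f n₁ q.1) * star (g m q.2)) := by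
    -- Conjugation turns the inverse transforms of the inputs into forward ones, so the three phases
    -- add up to τ + q.1 + q.2.
    calc _ = ∫ t : ℝ, ∫ q : ℝ × ℝ,
          Complex.exp (-Complex.I * ((t * (τ + q.1 + q.2) : ℝ) : ℂ)) * c t *
            (star (f n₁ q.1) * star (g m q.2)) := by
          congr 1; funext t
          rw [spaceCoeff, spaceCoeff, hstar, hstar]
          calc _ = (Complex.exp (-Complex.I * ((t * τ : ℝ) : ℂ)) * c t) *
                ((∫ x : ℝ, Complex.exp (-Complex.I * ((t * x : ℝ) : ℂ)) * star (f n₁ x)) *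
                  ∫ y : ℝ, Complex.exp (-Complex.I * ((t * y : ℝ) : ℂ)) * star (g m y)) := by
                rw [hc]; ring
            _ = _ := by
              rw [← integral_prod_mul, ← integral_const_mul, Measure.volume_eq_prod]
              congr 1; funext q
              have : -Complex.I * ((t * (τ + q.1 + q.2) : ℝ) : ℂ) =
                  -Complex.I * ((t * τ : ℝ) : ℂ) + (-Complex.I * ((t * q.1 : ℝ) : ℂ) +
                    -Complex.I * ((t * q.2 : ℝ) : ℂ)) := by push_cast; ring
              rw [this, Complex.exp_add, Complex.exp_add]
              ring
      _ = ∫ q : ℝ × ℝ, ∫ t : ℝ,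
          Complex.exp (-Complex.I * ((t * (τ + q.1 + q.2) : ℝ) : ℂ)) * c t *
            (star (f n₁ q.1) * star (g m q.2)) := by
          refine integral_integral_swap ?_
          have h1 : Integrable fun q : ℝ × ℝ => star (f n₁ q.1) * star (g m q.2) :=
            ((Complex.conjLIE.toContinuousLinearEquiv.toContinuousLinearMap.integrable_comp
              (hf n₁))).mul_prod
            ((Complex.conjLIE.toContinuousLinearEquiv.toContinuousLinearMap.integrable_comp (hg m)))
          have h2 := (integrable_cutoff_sq hφ hs hT).mul_prod h1
          have h3 : Continuous fun z : ℝ × ℝ × ℝ =>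
              Complex.exp (-Complex.I * ((z.1 * (τ + z.2.1 + z.2.2) : ℝ) : ℂ)) := by fun_prop
          refine (h2.bdd_mul (c := 1) h3.aestronglyMeasurable
            (Filter.Eventually.of_forall fun z => (norm_exp_neg_I_mul _).le)).congr ?_
          refine Filter.Eventually.of_forall fun z => ?_
          simp only [Function.uncurry, hc]; ring
      _ = _ := by
          congr 1; funext q
          rw [cutHat, integral_mul_const]
  rw [prodTerm, hkey, enorm_mul]
  have h2π : ‖((2 * Real.pi : ℝ) : ℂ)⁻¹‖ₑ ≤ 1 := by
    have h3 : (1 : ℝ) ≤ 2 * Real.pi := by linarith [Real.pi_gt_three]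
    rw [← ofReal_norm, norm_inv, Complex.norm_real, Real.norm_of_nonneg (by positivity),
      ENNReal.ofReal_le_one]
    exact inv_le_one_of_one_le₀ h3
  calc _ ≤ 1 * ‖∫ q : ℝ × ℝ, cutHat φ T (τ + q.1 + q.2) * (star (f n₁ q.1) * star (g m q.2))‖ₑ :=
        mul_le_mul_left h2π _
    _ ≤ _ := by
      rw [one_mul]
      refine (enorm_integral_le_lintegral_enorm _).trans_eq ?_
      refine lintegral_congr fun q => ?_
      rw [enorm_mul, enorm_mul]
      have hst : ∀ z : ℂ, ‖star z‖ₑ = ‖z‖ₑ := fun z => by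
        rw [← ofReal_norm, ← ofReal_norm, norm_star]
      rw [hst, hst]

/-! ### The estimate for arbitrary elements of the space. -/

theorem integrable_of_memZhat {s : ℝ} {f : Freq → ℝ → ℂ} (hf : ∀ n, Measurable (f n))
    (hfin : ZhatNorm s (2 / 3) f < ⊤) (n : Freq) : Integrable (f n) := by
  refine ⟨(hf n).aestronglyMeasurable, ?_⟩
  have h1 : sqNormOne (fun n τ => freqE (-s) n * ‖f n τ‖ₑ) ≠ ⊤ := by
    have hM : jbMass (4 / 3) ≠ ⊤ := jbMass_ne_top (by norm_num)
    have := hfin.ne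
    exact ne_top_of_le_ne_top (by finiteness) (sqNormOne_freqE_le hf)
  have h2 := ENNReal.ne_top_of_tsum_ne_top h1 n
  rw [lintegral_const_mul _ (hf n).enorm] at h2
  rw [hasFiniteIntegral_iff_enorm, lt_top_iff_ne_top]
  intro h3
  rw [h3, ENNReal.mul_top (freqE_pos _ _).ne'] at h2
  exact h2 (by simp)

theorem ell2Lp_congr {p : ℝ≥0∞} {f g : Freq → ℝ → ℂ} (h : ∀ n, f n =ᵐ[volume] g n) :
    ell2Lp p f = ell2Lp p g := by
  rw [ell2Lp, ell2Lp]
  congr 1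
  exact tsum_congr fun n => by rw [eLpNorm_congr_ae (h n)]

theorem ZhatNorm_congr {s b : ℝ} {f g : Freq → ℝ → ℂ} (h : ∀ n, f n =ᵐ[volume] g n) :
    ZhatNorm s b f = ZhatNorm s b g := by
  have hlo : ∀ n, Plo f n =ᵐ[volume] Plo g n := fun n => (h n).indicator
  have hhi : ∀ n, Phi f n =ᵐ[volume] Phi g n := fun n => (h n).indicator
  rw [ZhatNorm, ZhatNorm, XhatNorm, XhatNorm, YhatNorm, YhatNorm]
  congr 1
  · exact ell2Lp_congr fun n => (hlo n).mono fun τ hτ => by simp only [hτ]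
  · congr 1
    · exact ell2Lp_congr fun n => (hhi n).mono fun τ hτ => by simp only [hτ]
    · exact ell2Lp_congr fun n => (hhi n).mono fun τ hτ => by simp only [hτ]

theorem spaceCoeff_congr {f g : Freq → ℝ → ℂ} (h : ∀ n, f n =ᵐ[volume] g n) :
    spaceCoeff f = spaceCoeff g := by
  funext n t
  exact integral_congr_ae ((h n).mono fun τ hτ => by simp only [hτ])

theorem prodTerm_congr {φ : ℝ → ℝ} {T : ℝ} {f g f' g' : Freq → ℝ → ℂ}
    (hf : ∀ n, f n =ᵐ[volume] f' n) (hg : ∀ n, g n =ᵐ[volume] g' n) :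
    prodTerm φ T f g = prodTerm φ T f' g' := by
  funext n τ n₁
  rw [prodTerm, prodTerm, spaceCoeff_congr hf, spaceCoeff_congr hg]

/-- The estimate for arbitrary elements of the space. -/
theorem exists_prodFourier_le {δ : ℝ} (hδ : 0 < δ) (hδ' : δ ≤ 1 / 600) {φ : ℝ → ℝ}
    (hφ : ContDiff ℝ ∞ φ) (hs : ∀ t, t ∉ Set.Icc (-2 : ℝ) 2 → φ t = 0) :
    ∃ C : NNReal, ∀ T : ℝ, 0 < T → T ≤ 1 → ∀ f g : Freq → ℝ → ℂ,
      MemZhat (100 * δ - 2 / 3) (2 / 3) f → MemZhat (100 * δ - 2 / 3) (2 / 3) g →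
        (∀ n, ∀ᵐ τ : ℝ, Summable (prodTerm φ T f g n τ)) ∧
        ZhatNorm (100 * δ - 2 / 3) (2 / 3) (invModulation (prodFourier φ T f g)) ≤
          C * ENNReal.ofReal (T ^ δ) * ZhatNorm (100 * δ - 2 / 3) (2 / 3) f *
            ZhatNorm (100 * δ - 2 / 3) (2 / 3) g := by
  obtain ⟨C₁, hC₁, h₁⟩ := exists_bilinear_ZhatNorm_le hδ hδ'
  obtain ⟨C₂, hC₂, h₂⟩ := exists_norm_cutHat_le hφ hs
  set s := 100 * δ - 2 / 3 with hsd
  refine ⟨(3 * ENNReal.ofReal C₂ * C₁).toNNReal, fun T hT hT' f g hf hg => ?_⟩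
  rw [ENNReal.coe_toNNReal (by finiteness)]
  -- The nonnegative estimates are stated for measurable functions. Every quantity involved depends
  -- only on the classes in τ, so measurable representatives may be used.
  set f' : Freq → ℝ → ℂ := fun n => (hf.aesm n).mk with hf'
  set g' : Freq → ℝ → ℂ := fun n => (hg.aesm n).mk with hg'
  have ef : ∀ n, f n =ᵐ[volume] f' n := fun n => (hf.aesm n).ae_eq_mk
  have eg : ∀ n, g n =ᵐ[volume] g' n := fun n => (hg.aesm n).ae_eq_mk
  have mf : ∀ n, Measurable (f' n) := fun n => (hf.aesm n).stronglyMeasurable_mk.measurable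
  have mg : ∀ n, Measurable (g' n) := fun n => (hg.aesm n).stronglyMeasurable_mk.measurable
  have ff : ZhatNorm s (2 / 3) f' < ⊤ := ZhatNorm_congr ef ▸ hf.finite
  have fg : ZhatNorm s (2 / 3) g' < ⊤ := ZhatNorm_congr eg ▸ hg.finite
  have hP : prodFourier φ T f g = prodFourier φ T f' g' := by
    funext n τ
    rw [prodFourier, prodFourier, prodTerm_congr ef eg]
  rw [hP, prodTerm_congr ef eg, ZhatNorm_congr ef, ZhatNorm_congr eg]
  set B := bil (cutKernel δ) (fun n τ => ‖f' n τ‖ₑ) (fun n τ => ‖g' n τ‖ₑ) with hB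
  have hBm : ∀ n, Measurable (B n) :=
    measurable_bil (kerMeas_cutKernel δ) (fun n => (mf n).enorm) (fun n => (mg n).enorm)
  set κ := ENNReal.ofReal (C₂ * T ^ δ) with hκ
  have hκt : κ ≠ ⊤ := ENNReal.ofReal_ne_top
  have hterm : ∀ n τ, ∑' n₁, ‖prodTerm φ T f' g' n τ n₁‖ₑ ≤ κ * B n τ := by
    intro n τ
    rw [hB, bil, ← ENNReal.tsum_mul_left]
    refine ENNReal.tsum_le_tsum fun n₁ => ?_
    refine (enorm_prodTerm_le hφ.continuous hs hT (integrable_of_memZhat mf ff)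
      (integrable_of_memZhat mg fg) n τ n₁).trans ?_
    rw [← lintegral_const_mul' _ _ hκt]
    refine lintegral_mono fun q => ?_
    have hk : ‖cutHat φ T (τ + q.1 + q.2)‖ₑ ≤ κ * cutKernel δ n τ n₁ q := by
      rw [cutKernel, jbE, hκ, ← ENNReal.ofReal_mul (by positivity), ← ofReal_norm]
      exact ENNReal.ofReal_le_ofReal (h₂ δ T hδ (by linarith) hT hT' _)
    exact (mul_le_mul_left hk _).trans_eq (mul_assoc _ _ _)
  have hE := h₁ f' g' mf mg
  set E := sqNorm (fun n τ => outE s n τ * B n τ) +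
        sqNormOne (fun n τ => (freqE (-s) n * jbE 1 (modulation n τ)) * B n τ) with hEd
  constructor
  · intro n
    have hfin : sqNorm (fun n τ => outE s n τ * B n τ) ≠ ⊤ := by
      refine ne_top_of_le_ne_top ?_ (le_self_add.trans hE)
      have := ff.ne
      have := fg.ne
      finiteness
    filter_upwards [ae_bil_lt_top hBm hfin n] with τ hτ
    have h3 : ∑' n₁, ‖prodTerm φ T f' g' n τ n₁‖ₑ ≠ ⊤ :=
      ne_top_of_le_ne_top (ENNReal.mul_ne_top hκt hτ.ne) (hterm n τ)
    have h4 : Summable fun n₁ => ‖prodTerm φ T f' g' n τ n₁‖₊ :=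
      ENNReal.tsum_coe_ne_top_iff_summable.1 h3
    exact h4.of_nnnorm
  · have hPle : ∀ n τ, ‖prodFourier φ T f' g' n τ‖ₑ ≤ κ * B n τ := fun n τ =>
      enorm_tsum_le_tsum_enorm.trans (hterm n τ)
    refine (ZhatNorm_invModulation_le fun n =>
      Filter.Eventually.of_forall fun τ => hPle n τ).trans ?_
    have e1 : sqNorm (fun n τ => outE s n τ * (κ * B n τ)) +
        sqNormOne (fun n τ => (freqE (-s) n * jbE 1 (modulation n τ)) * (κ * B n τ)) =
        κ ^ 2 * E := by
      rw [hEd, mul_add, ← sqNorm_const_mul hκt, ← sqNormOne_const_mul hκt]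
      congr 2
      · funext n τ; ring
      · funext n τ; ring
    rw [e1]
    calc _ ≤ 3 * (κ ^ 2 * (C₁ * (ZhatNorm s (2 / 3) f' * ZhatNorm s (2 / 3) g')) ^ 2) ^
          (1 / 2 : ℝ) := by gcongr
      _ = 3 * (κ * (C₁ * (ZhatNorm s (2 / 3) f' * ZhatNorm s (2 / 3) g'))) := by
          rw [← mul_pow, sq_rpow_half]
      _ = _ := by
          rw [hκ, ENNReal.ofReal_mul hC₂]; ring

/-! ### Directional derivatives of smooth functions -/

/-- The directional derivative of a function of space and time. -/
def dirDeriv (w : (Fin 2 → ℝ) × ℝ) (u : (Fin 2 → ℝ) → ℝ → ℂ) : (Fin 2 → ℝ) → ℝ → ℂ :=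
  fun x t => fderiv ℝ (fun p : (Fin 2 → ℝ) × ℝ => u p.1 p.2) (x, t) w

/-- Stability under differentiation allows decay bounds to be iterated: bounds for coefficients of
derivatives become decay of the coefficients themselves. -/
theorem IsNice.isNice_dirDeriv {u : (Fin 2 → ℝ) → ℝ → ℂ} (hu : IsNice u) (w : (Fin 2 → ℝ) × ℝ) :
    IsNice (dirDeriv w u) := by
  have hd : ContDiff ℝ ∞ (fderiv ℝ fun p : (Fin 2 → ℝ) × ℝ => u p.1 p.2) :=
    hu.smooth.fderiv_right (by simp)
  refine ⟨hd.clm_apply contDiff_const, fun x t k => ?_, fun k m => ?_⟩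
  · set a : (Fin 2 → ℝ) × ℝ := (fun j => 2 * Real.pi * (k j : ℝ), 0) with ha
    have h1 : (fun p : (Fin 2 → ℝ) × ℝ => u (p + a).1 (p + a).2) = fun p => u p.1 p.2 := by
      funext p
      simp only [ha, Prod.fst_add, Prod.snd_add, add_zero]; exact hu.periodic p.1 p.2 k
    have h2 := fderiv_comp_add_right (𝕜 := ℝ) (f := fun p : (Fin 2 → ℝ) × ℝ => u p.1 p.2)
      (x := (x, t)) a
    have h3 : (x, t) + a = ((fun j => x j + 2 * Real.pi * (k j : ℝ)), t) := by
      simp only [ha, Prod.mk_add_mk, add_zero]; rfl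
    rw [dirDeriv, dirDeriv, ← h3, ← h2]
    exact congrArg (fun L => L w) (congrArg (fun f => fderiv ℝ f (x, t)) h1)
  · obtain ⟨C, hC⟩ := hu.decay k (m + 1)
    refine ⟨‖w‖ * C, fun x t => ?_⟩
    have h1 := norm_iteratedFDeriv_clm_apply_const (c := w) (x := (x, t)) (n := m)
      hd.contDiffAt (by exact_mod_cast le_top)
    rw [norm_iteratedFDeriv_fderiv] at h1
    calc _ ≤ |t| ^ k * (‖w‖ * ‖iteratedFDeriv ℝ (m + 1)
          (fun p : (Fin 2 → ℝ) × ℝ => u p.1 p.2) (x, t)‖) := by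
          gcongr; exact h1
      _ = ‖w‖ * (|t| ^ k * ‖iteratedFDeriv ℝ (m + 1)
          (fun p : (Fin 2 → ℝ) × ℝ => u p.1 p.2) (x, t)‖) := by ring
      _ ≤ _ := by gcongr; exact hC x t

/-! ### Fourier coefficients of decaying continuous functions -/

/-- Continuous functions of space and time with quadratic decay in time. -/
structure Tame (u : (Fin 2 → ℝ) → ℝ → ℂ) : Prop where
  continuous : Continuous fun p : (Fin 2 → ℝ) × ℝ => u p.1 p.2
  decay : ∃ C : ℝ, ∀ x t, ‖u x t‖ ≤ C * (1 + t ^ 2)⁻¹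

theorem IsNice.tame {u : (Fin 2 → ℝ) → ℝ → ℂ} (hu : IsNice u) : Tame u := by
  refine ⟨hu.smooth.continuous, ?_⟩
  obtain ⟨C, hC⟩ := hu.decay 0 0
  obtain ⟨D, hD⟩ := hu.decay 2 0
  refine ⟨C + D, fun x t => ?_⟩
  have h1 := hC x t
  have h2 := hD x t
  rw [norm_iteratedFDeriv_zero] at h1 h2
  rw [sq_abs] at h2
  rw [← div_eq_mul_inv, le_div_iff₀ (by positivity)]
  simp only [pow_zero, one_mul] at h1
  linarith

/-- The fundamental domain of the torus. -/
def box : Set (Fin 2 → ℝ) := Set.Icc 0 fun _ => 2 * Real.pi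

theorem isCompact_box : IsCompact box := isCompact_Icc

theorem volume_box : (volume : Measure (Fin 2 → ℝ)).real box = (2 * Real.pi) ^ 2 := by
  have h : (0 : Fin 2 → ℝ) ≤ fun _ => 2 * Real.pi := fun _ => by positivity
  rw [box, Measure.real, Real.volume_Icc_pi_toReal h]
  simp [sq]

/-- The spatial Fourier coefficient of a function on the torus. -/
def boxCoeff (a : (Fin 2 → ℝ) → ℂ) (n : Freq) : ℂ :=
  (((2 * Real.pi) ^ 2 : ℝ) : ℂ)⁻¹ * ∫ x in box,
    Complex.exp (-Complex.I * ((∑ j, (n j : ℝ) * x j : ℝ) : ℂ)) * a x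

/-- The spatial Fourier coefficients of a function of space and time. -/
def torusCoeff (u : (Fin 2 → ℝ) → ℝ → ℂ) (n : Freq) (t : ℝ) : ℂ := boxCoeff (fun x => u x t) n

theorem norm_boxCoeff_le {a : (Fin 2 → ℝ) → ℂ} {C : ℝ} (h : ∀ x, ‖a x‖ ≤ C) (n : Freq) :
    ‖boxCoeff a n‖ ≤ C := by
  have h1 : ‖∫ x in box, Complex.exp (-Complex.I * ((∑ j, (n j : ℝ) * x j : ℝ) : ℂ)) * a x‖ ≤
      C * (volume : Measure (Fin 2 → ℝ)).real box := by
    refine norm_setIntegral_le_of_norm_le_const isCompact_box.measure_lt_top fun x _ => ?_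
    rw [norm_mul, norm_exp_neg_I_mul, one_mul]
    exact h x
  rw [boxCoeff, norm_mul, norm_inv, Complex.norm_real, Real.norm_of_nonneg (by positivity)]
  rw [volume_box] at h1
  rw [inv_mul_le_iff₀ (by positivity)]
  linarith

theorem norm_torusCoeff_le {u : (Fin 2 → ℝ) → ℝ → ℂ} {C : ℝ}
    (h : ∀ x t, ‖u x t‖ ≤ C * (1 + t ^ 2)⁻¹) (n : Freq) (t : ℝ) :
    ‖torusCoeff u n t‖ ≤ C * (1 + t ^ 2)⁻¹ :=
  norm_boxCoeff_le (fun x => h x t) n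

theorem continuous_torusCoeff {u : (Fin 2 → ℝ) → ℝ → ℂ}
    (hu : Continuous fun p : (Fin 2 → ℝ) × ℝ => u p.1 p.2) (n : Freq) :
    Continuous (torusCoeff u n) := by
  unfold torusCoeff boxCoeff
  refine continuous_const.mul (continuous_parametric_integral_of_continuous ?_ isCompact_box)
  have : Continuous fun p : ℝ × (Fin 2 → ℝ) => u p.2 p.1 := hu.comp continuous_swap
  unfold Function.uncurry
  fun_prop

theorem Tame.integrable_torusCoeff {u : (Fin 2 → ℝ) → ℝ → ℂ} (hu : Tame u) (n : Freq) :
    Integrable (torusCoeff u n) := by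
  obtain ⟨C, hC⟩ := hu.decay
  exact (integrable_inv_one_add_sq.const_mul C).mono'
    (continuous_torusCoeff hu.continuous n).aestronglyMeasurable
    (Filter.Eventually.of_forall fun t => norm_torusCoeff_le hC n t)

theorem Tame.integrable_time {u : (Fin 2 → ℝ) → ℝ → ℂ} (hu : Tame u) (x : Fin 2 → ℝ) :
    Integrable (u x) := by
  obtain ⟨C, hC⟩ := hu.decay
  have hc : Continuous (u x) := hu.continuous.comp (Continuous.prodMk_right x)
  exact (integrable_inv_one_add_sq.const_mul C).mono' hc.aestronglyMeasurable
    (Filter.Eventually.of_forall fun t => hC x t)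

/-- The space-time Fourier transform as the Fourier transform of the spatial coefficients. -/
theorem Tame.stFourier_eq {u : (Fin 2 → ℝ) → ℝ → ℂ} (hu : Tame u) (n : Freq) (τ : ℝ) :
    stFourier u n τ = ((2 * Real.pi : ℝ) : ℂ)⁻¹ *
      ∫ t : ℝ, Complex.exp (-Complex.I * ((t * τ : ℝ) : ℂ)) * torusCoeff u n t := by
  have hswap : ∫ x in box, ∫ t : ℝ,
      Complex.exp (-Complex.I * (((∑ j, (n j : ℝ) * x j) + t * τ : ℝ) : ℂ)) * u x t =
      ∫ t : ℝ, ∫ x in box,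
        Complex.exp (-Complex.I * (((∑ j, (n j : ℝ) * x j) + t * τ : ℝ) : ℂ)) * u x t := by
    refine integral_integral_swap ?_
    obtain ⟨C, hC⟩ := hu.decay
    have : IsFiniteMeasure ((volume : Measure (Fin 2 → ℝ)).restrict box) :=
      ⟨by simpa using isCompact_box.measure_lt_top⟩
    have h1 : Integrable (fun z : (Fin 2 → ℝ) × ℝ => C * (1 + z.2 ^ 2)⁻¹)
        (((volume : Measure (Fin 2 → ℝ)).restrict box).prod volume) :=
      (integrable_inv_one_add_sq.comp_snd _).const_mul C
    have hc := hu.continuous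
    refine h1.mono' ?_ (Filter.Eventually.of_forall fun z => ?_)
    · refine Continuous.aestronglyMeasurable ?_
      unfold Function.uncurry
      fun_prop
    · simp only [Function.uncurry]
      rw [norm_mul, norm_exp_neg_I_mul, one_mul]
      exact hC _ _
  rw [stFourier]
  change _ * (∫ x in box, _) = _
  rw [hswap, ← integral_const_mul, ← integral_const_mul]
  congr 1; funext t
  rw [torusCoeff, boxCoeff, ← integral_const_mul, ← integral_const_mul, ← integral_const_mul,
    ← integral_const_mul]
  congr 1; funext x
  have : -Complex.I * (((∑ j, (n j : ℝ) * x j) + t * τ : ℝ) : ℂ) =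
      -Complex.I * ((t * τ : ℝ) : ℂ) + -Complex.I * ((∑ j, (n j : ℝ) * x j : ℝ) : ℂ) := by
    push_cast; ring
  rw [this, Complex.exp_add]
  push_cast
  field_simp

theorem Tame.exists_norm_stFourier_le {u : (Fin 2 → ℝ) → ℝ → ℂ} (hu : Tame u) :
    ∃ C : ℝ, ∀ n τ, ‖stFourier u n τ‖ ≤ C := by
  obtain ⟨C, hC⟩ := hu.decay
  refine ⟨‖((2 * Real.pi : ℝ) : ℂ)⁻¹‖ * ∫ t : ℝ, C * (1 + t ^ 2)⁻¹, fun n τ => ?_⟩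
  rw [hu.stFourier_eq, norm_mul]
  gcongr
  refine norm_integral_le_of_norm_le (integrable_inv_one_add_sq.const_mul C)
    (Filter.Eventually.of_forall fun t => ?_)
  rw [norm_mul, norm_exp_neg_I_mul, one_mul]
  exact norm_torusCoeff_le hC n t

/-! ### Fourier coefficients of derivatives -/

/-- Divergence theorem for the field whose only nonzero component is F in direction i; the
contributions of opposite faces cancel by periodicity. -/
theorem integral_box_fderiv_eq_zero {F : (Fin 2 → ℝ) → ℂ} (hF : ContDiff ℝ 1 F)
    (hp : ∀ (x : Fin 2 → ℝ) (k : Freq), F (fun j => x j + 2 * Real.pi * (k j : ℝ)) = F x)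
    (i : Fin 2) : ∫ x in box, fderiv ℝ F x (Pi.single i 1) = 0 := by
  have hle : (0 : Fin 2 → ℝ) ≤ fun _ => 2 * Real.pi := fun _ => by positivity
  have hsum : ∀ x, ∑ k, (if k = i then fderiv ℝ F x else 0) (Pi.single k (1 : ℝ)) =
      fderiv ℝ F x (Pi.single i 1) := by
    intro x
    rw [Finset.sum_eq_single i (fun k _ hk => by simp [hk]) (by simp)]
    simp
  have hc : Continuous fun x => fderiv ℝ F x (Pi.single i 1) :=
    (hF.continuous_fderiv (by norm_num)).clm_apply continuous_const
  have h := integral_divergence_of_hasFDerivAt_off_countable' (n := 1) (E := ℂ) 0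
    (fun _ => 2 * Real.pi) hle (fun k => if k = i then F else 0)
    (fun k x => if k = i then fderiv ℝ F x else 0) ∅ Set.countable_empty
    (fun k => by split_ifs <;> [exact hF.continuous.continuousOn; exact continuousOn_const])
    (fun x _ k => by
      split_ifs
      · exact (hF.differentiable (by norm_num) x).hasFDerivAt
      · exact hasFDerivAt_const 0 x)
    (by simp_rw [hsum]; exact hc.continuousOn.integrableOn_compact isCompact_Icc)
  simp_rw [hsum] at h
  rw [box, h]
  refine Finset.sum_eq_zero fun k _ => ?_
  by_cases hk : k = i
  · subst hk
    rw [sub_eq_zero]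
    congr 1; funext x
    simp only [if_true]
    -- Corresponding points of opposite faces differ by one period in direction k.
    have h2 := hp (Fin.insertNth k (0 : ℝ) x) (Pi.single k 1)
    have h3 : (fun j => (Fin.insertNth k (0 : ℝ) x : Fin 2 → ℝ) j +
        2 * Real.pi * (((Pi.single k 1 : Freq) j : ℤ) : ℝ)) =
        Fin.insertNth k (2 * Real.pi) x := by
      funext j
      induction j using Fin.succAboveCases k with
      | x => simp
      | p j => simp
    rw [h3] at h2
    exact h2
  · simp [hk]

theorem exp_periodic (n k : Freq) (x : Fin 2 → ℝ) :
    Complex.exp (-Complex.I * ((∑ j, (n j : ℝ) * (x j + 2 * Real.pi * (k j : ℝ)) : ℝ) : ℂ)) =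
      Complex.exp (-Complex.I * ((∑ j, (n j : ℝ) * x j : ℝ) : ℂ)) := by
  have : -Complex.I * ((∑ j, (n j : ℝ) * (x j + 2 * Real.pi * (k j : ℝ)) : ℝ) : ℂ) =
      -Complex.I * ((∑ j, (n j : ℝ) * x j : ℝ) : ℂ) +
        ((-(∑ j, n j * k j) : ℤ) : ℂ) * (2 * Real.pi * Complex.I) := by
    simp only [Fin.sum_univ_two]
    push_cast; ring
  rw [this, Complex.exp_add, Complex.exp_int_mul_two_pi_mul_I, mul_one]

/-- Integration by parts without boundary terms, from the vanishing integral of the derivative of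
e^{-in·x}u. -/
theorem IsNice.torusCoeff_dirDeriv {u : (Fin 2 → ℝ) → ℝ → ℂ} (hu : IsNice u) (i : Fin 2)
    (n : Freq) (t : ℝ) :
    torusCoeff (dirDeriv (Pi.single i 1, 0) u) n t = Complex.I * n i * torusCoeff u n t := by
  set e : (Fin 2 → ℝ) → ℂ := fun x =>
    Complex.exp (-Complex.I * ((∑ j, (n j : ℝ) * x j : ℝ) : ℂ)) with he
  have hec : ContDiff ℝ 1 e := by
    have h1 : ContDiff ℝ 1 fun x : Fin 2 → ℝ => ∑ j, (n j : ℝ) * x j :=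
      ContDiff.sum fun j _ => contDiff_const.mul (contDiff_apply ℝ ℝ j)
    have h2 : ContDiff ℝ 1 fun x : Fin 2 → ℝ => ((∑ j, (n j : ℝ) * x j : ℝ) : ℂ) :=
      Complex.ofRealCLM.contDiff.comp h1
    exact ContDiff.cexp (contDiff_const.mul h2)
  have huc : ContDiff ℝ 1 fun x => u x t :=
    (hu.smooth.of_le (by exact_mod_cast le_top)).comp (contDiff_id.prodMk contDiff_const)
  have h0 := integral_box_fderiv_eq_zero (hec.mul huc) (fun x k => by
    simp only [he, exp_periodic, hu.periodic]) i
  have hed : ∀ x, fderiv ℝ e x (Pi.single i 1) = -Complex.I * n i * e x := by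
    intro x
    have h1 : HasFDerivAt (fun x : Fin 2 → ℝ => ∑ j, (n j : ℝ) * x j)
        (∑ j, (n j : ℝ) • ContinuousLinearMap.proj (R := ℝ) (φ := fun _ : Fin 2 => ℝ) j) x := by
      refine HasFDerivAt.fun_sum fun j _ => ?_
      exact (hasFDerivAt_apply j x).const_mul _
    have h2 := ((Complex.ofRealCLM.hasFDerivAt.comp x h1).const_mul (-Complex.I)).cexp
    have h3 : HasFDerivAt e _ x := h2
    rw [h3.fderiv]
    fin_cases i <;> simp [he] <;> ring
  have hud : ∀ x, fderiv ℝ (fun x => u x t) x (Pi.single i 1) =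
      dirDeriv (Pi.single i 1, 0) u x t := by
    intro x
    have h1 : HasFDerivAt (fun x : Fin 2 → ℝ => (x, t))
        (ContinuousLinearMap.inl ℝ (Fin 2 → ℝ) ℝ) x := hasFDerivAt_prodMk_left x t
    have h2 := ((hu.smooth.differentiable (by simp)) (x, t)).hasFDerivAt.comp x h1
    have h3 : HasFDerivAt (fun x => u x t) _ x := h2
    rw [h3.fderiv]
    simp [dirDeriv]
  have hder : ∀ x, fderiv ℝ (fun x => e x * u x t) x (Pi.single i 1) =
      e x * dirDeriv (Pi.single i 1, 0) u x t - Complex.I * n i * (e x * u x t) := by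
    intro x
    have h1 := fderiv_fun_mul (hec.differentiable (by norm_num) x)
      (huc.differentiable (by norm_num) x)
    rw [h1]
    simp only [add_apply, smul_apply, smul_eq_mul, hed, hud]
    ring
  simp_rw [hder] at h0
  have hi1 : IntegrableOn (fun x => e x * dirDeriv (Pi.single i 1, 0) u x t) box :=
    (hec.continuous.mul ((hu.isNice_dirDeriv _).smooth.continuous.comp
      (Continuous.prodMk_left t))).continuousOn.integrableOn_compact isCompact_box
  have hi2 : IntegrableOn (fun x => Complex.I * n i * (e x * u x t)) box :=
    (continuous_const.mul (hec.continuous.mul huc.continuous)).continuousOn.integrableOn_compact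
      isCompact_box
  rw [integral_sub hi1 hi2, sub_eq_zero, integral_const_mul] at h0
  rw [torusCoeff, boxCoeff, torusCoeff, boxCoeff, h0]
  ring

theorem IsNice.stFourier_dirDeriv {u : (Fin 2 → ℝ) → ℝ → ℂ} (hu : IsNice u)
    (n : Freq) (τ : ℝ) :
    stFourier (dirDeriv (0, 1) u) n τ = Complex.I * τ * stFourier u n τ := by
  have hinner : ∀ x : Fin 2 → ℝ, ∫ t : ℝ,
      Complex.exp (-Complex.I * (((∑ j, (n j : ℝ) * x j) + t * τ : ℝ) : ℂ)) *
        dirDeriv (0, 1) u x t = Complex.I * τ * ∫ t : ℝ,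
      Complex.exp (-Complex.I * (((∑ j, (n j : ℝ) * x j) + t * τ : ℝ) : ℂ)) * u x t := by
    intro x
    set c : ℝ := ∑ j, (n j : ℝ) * x j with hc
    have hb : ∀ {g : ℝ → ℂ}, Integrable g →
        Integrable fun t : ℝ => Complex.exp (-Complex.I * ((c + t * τ : ℝ) : ℂ)) * g t := by
      intro g hg
      refine hg.bdd_mul (c := 1) (Continuous.aestronglyMeasurable (by fun_prop))
        (Filter.Eventually.of_forall fun t => ?_)
      exact (norm_exp_neg_I_mul _).le
    have hder : ∀ t : ℝ, HasDerivAt (fun t : ℝ => Complex.exp (-Complex.I * ((c + t * τ : ℝ) : ℂ)))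
        (Complex.exp (-Complex.I * ((c + t * τ : ℝ) : ℂ)) * (-Complex.I * τ)) t := by
      intro t
      have h1 : HasDerivAt (fun t : ℝ => c + t * τ) τ t := by
        simpa using ((hasDerivAt_id t).mul_const τ).const_add c
      exact (h1.ofReal_comp.const_mul (-Complex.I)).cexp
    have hud : ∀ t : ℝ, HasDerivAt (u x) (dirDeriv (0, 1) u x t) t := by
      intro t
      have h1 : HasDerivAt (fun t : ℝ => (x, t)) ((0 : Fin 2 → ℝ), (1 : ℝ)) t :=
        (hasDerivAt_const t x).prodMk (hasDerivAt_id t)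
      exact ((hu.smooth.differentiable (by simp)) (x, t)).hasFDerivAt.comp_hasDerivAt t h1
    have hi := hu.tame.integrable_time x
    have hd := (hu.isNice_dirDeriv (0, 1)).tame.integrable_time x
    rw [integral_mul_deriv_eq_deriv_mul_of_integrable (fun t _ => hder t)
      (fun t _ => hud t) (hb hd) ?_ (hb hi)]
    · rw [← integral_const_mul, ← integral_neg]
      congr 1; funext t; ring
    · refine ((hb hi).const_mul (-Complex.I * τ)).congr (Filter.Eventually.of_forall fun t => ?_)
      simp only [Pi.mul_apply]; ring
  rw [stFourier, stFourier]
  simp_rw [hinner]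
  rw [integral_const_mul]
  ring

/-! ### Decay of the Fourier transform of smooth functions -/

theorem IsNice.stFourier_dirDeriv_space {u : (Fin 2 → ℝ) → ℝ → ℂ} (hu : IsNice u) (i : Fin 2)
    (n : Freq) (τ : ℝ) :
    stFourier (dirDeriv (Pi.single i 1, 0) u) n τ = Complex.I * n i * stFourier u n τ := by
  rw [(hu.isNice_dirDeriv _).tame.stFourier_eq, hu.tame.stFourier_eq]
  simp_rw [hu.torusCoeff_dirDeriv]
  rw [mul_left_comm (Complex.I * _), ← integral_const_mul (Complex.I * _)]
  congr 2; funext t; ring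

theorem norm_I_mul_sq_mul (k : ℝ) (z : ℂ) :
    ‖Complex.I * k * (Complex.I * k * z)‖ = k ^ 2 * ‖z‖ := by
  rw [norm_mul, norm_mul, norm_mul, norm_mul, Complex.norm_I, Complex.norm_real, Real.norm_eq_abs,
    ← sq_abs k]
  ring

theorem jbFreq_sq_eq (n : Freq) : jbFreq n ^ 2 = 1 + (n 0 : ℝ) ^ 2 + (n 1 : ℝ) ^ 2 := by
  rw [jbFreq_sq, normSq, Fin.sum_univ_two, add_assoc]

theorem IsNice.exists_norm_torusCoeff_le {u : (Fin 2 → ℝ) → ℝ → ℂ} (hu : IsNice u) :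
    ∃ C : ℝ, ∀ n t, ‖torusCoeff u n t‖ * jbFreq n ^ 2 ≤ C * (1 + t ^ 2)⁻¹ := by
  have h2 : ∀ i, ∃ C : ℝ, ∀ n t, (n i : ℝ) ^ 2 * ‖torusCoeff u n t‖ ≤ C * (1 + t ^ 2)⁻¹ := by
    intro i
    have h := hu.isNice_dirDeriv (Pi.single i 1, 0)
    obtain ⟨C, hC⟩ := (h.isNice_dirDeriv (Pi.single i 1, 0)).tame.decay
    refine ⟨C, fun n t => ?_⟩
    have h1 := norm_torusCoeff_le hC n t
    rw [h.torusCoeff_dirDeriv, hu.torusCoeff_dirDeriv, ← Complex.ofReal_intCast,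
      norm_I_mul_sq_mul] at h1
    exact h1
  obtain ⟨C, hC⟩ := hu.tame.decay
  obtain ⟨C₀, h₀⟩ := h2 0
  obtain ⟨C₁, h₁⟩ := h2 1
  refine ⟨C + C₀ + C₁, fun n t => ?_⟩
  rw [jbFreq_sq_eq]
  have := norm_torusCoeff_le hC n t
  linarith [h₀ n t, h₁ n t]

theorem IsNice.exists_norm_stFourier_mul_le {u : (Fin 2 → ℝ) → ℝ → ℂ} (hu : IsNice u) :
    ∃ C : ℝ, ∀ n τ, ‖stFourier u n τ‖ * (1 + τ ^ 2) ≤ C := by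
  have h := hu.isNice_dirDeriv (0, 1)
  obtain ⟨C, hC⟩ := hu.tame.exists_norm_stFourier_le
  obtain ⟨D, hD⟩ := (h.isNice_dirDeriv (0, 1)).tame.exists_norm_stFourier_le
  refine ⟨C + D, fun n τ => ?_⟩
  have h1 := hD n τ
  rw [h.stFourier_dirDeriv, hu.stFourier_dirDeriv, norm_I_mul_sq_mul] at h1
  linarith [hC n τ]

/-- Two derivatives in each spatial direction, combined with two in time, give exactly the decay
that finiteness of the Z-norm requires below. -/
theorem IsNice.exists_norm_stFourier_le {u : (Fin 2 → ℝ) → ℝ → ℂ} (hu : IsNice u) :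
    ∃ C : ℝ, 0 ≤ C ∧ ∀ n τ, ‖stFourier u n τ‖ ≤ C * (jbFreq n ^ 2)⁻¹ * (jb τ ^ 2)⁻¹ := by
  have h2 : ∀ i, ∃ C : ℝ, ∀ n τ, (n i : ℝ) ^ 2 * ‖stFourier u n τ‖ * (1 + τ ^ 2) ≤ C := by
    intro i
    have h := hu.isNice_dirDeriv (Pi.single i 1, 0)
    obtain ⟨C, hC⟩ := (h.isNice_dirDeriv (Pi.single i 1, 0)).exists_norm_stFourier_mul_le
    refine ⟨C, fun n τ => ?_⟩
    have h1 := hC n τ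
    rw [h.stFourier_dirDeriv_space, hu.stFourier_dirDeriv_space, ← Complex.ofReal_intCast,
      norm_I_mul_sq_mul] at h1
    exact h1
  obtain ⟨C, hC⟩ := hu.exists_norm_stFourier_mul_le
  obtain ⟨C₀, h₀⟩ := h2 0
  obtain ⟨C₁, h₁⟩ := h2 1
  have key : ∀ n τ, ‖stFourier u n τ‖ * (jbFreq n ^ 2 * jb τ ^ 2) ≤ C + C₀ + C₁ := by
    intro n τ
    rw [jbFreq_sq_eq, jb_sq]
    have := hC n τ
    nlinarith [h₀ n τ, h₁ n τ]
  refine ⟨C + C₀ + C₁, le_trans (by positivity) (key 0 0), fun n τ => ?_⟩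
  have hJ := jbFreq_pos n
  have hj := jb_pos τ
  rw [mul_assoc, ← mul_inv, ← div_eq_mul_inv, le_div_iff₀ (by positivity)]
  exact key n τ

theorem Tame.continuous_stFourier {u : (Fin 2 → ℝ) → ℝ → ℂ} (hu : Tame u) (n : Freq) :
    Continuous (stFourier u n) := by
  rw [show stFourier u n = _ from funext fun τ => hu.stFourier_eq n τ]
  refine continuous_const.mul (continuous_of_dominated (bound := fun t => ‖torusCoeff u n t‖)
    (fun τ => ?_) (fun τ => Filter.Eventually.of_forall fun t => ?_)
    (hu.integrable_torusCoeff n).norm (Filter.Eventually.of_forall fun t => by fun_prop))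
  · have := continuous_torusCoeff hu.continuous n
    exact Continuous.aestronglyMeasurable (by fun_prop)
  · rw [norm_mul, norm_exp_neg_I_mul, one_mul]

theorem integrable_inv_jb_sq : Integrable fun τ : ℝ => (jb τ ^ 2)⁻¹ := by
  simp_rw [jb_sq]
  exact integrable_inv_one_add_sq

theorem IsNice.integrable_stFourier {u : (Fin 2 → ℝ) → ℝ → ℂ} (hu : IsNice u) (n : Freq) :
    Integrable (stFourier u n) := by
  obtain ⟨C, -, hC⟩ := hu.exists_norm_stFourier_le
  exact (integrable_inv_jb_sq.const_mul _).mono'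
    (hu.tame.continuous_stFourier n).aestronglyMeasurable
    (Filter.Eventually.of_forall fun τ => hC n τ)

/-- Fourier inversion in time. -/
theorem IsNice.spaceCoeff_stFourier {u : (Fin 2 → ℝ) → ℝ → ℂ} (hu : IsNice u) (n : Freq)
    (t : ℝ) : spaceCoeff (stFourier u) n t = torusCoeff u n t := by
  have hπ := Real.pi_pos
  set a : ℝ → ℂ := torusCoeff u n with ha
  -- `FourierTransform.fourier` carries 2π in the phase, so the inversion theorem is used at
  -- frequency τ/2π.
  have hF : ∀ ξ : ℝ, FourierTransform.fourier a ξ =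
      (2 * Real.pi : ℝ) * stFourier u n (2 * Real.pi * ξ) := by
    intro ξ
    rw [hu.tame.stFourier_eq, Real.fourier_real_eq_integral_exp_smul, ← mul_assoc,
      mul_inv_cancel₀ (by exact_mod_cast (by positivity : (2 * Real.pi : ℝ) ≠ 0)), one_mul]
    congr 1; funext v
    rw [smul_eq_mul]
    congr 2
    push_cast; ring
  have hFi : Integrable (FourierTransform.fourier a) := by
    rw [show FourierTransform.fourier a = _ from funext hF]
    exact ((hu.integrable_stFourier n).comp_mul_left' (by positivity)).const_mul _
  have hinv := (continuous_torusCoeff hu.tame.continuous n).fourierInv_fourier_eq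
    (hu.tame.integrable_torusCoeff n) hFi
  have h1 := congrFun hinv t
  rw [Real.fourierInv_eq'] at h1
  rw [ha, ← h1, spaceCoeff]
  have h2 := Measure.integral_comp_mul_left (fun τ : ℝ =>
    Complex.exp (Complex.I * ((t * τ : ℝ) : ℂ)) * stFourier u n τ) (2 * Real.pi)
  have h3 : ∫ τ : ℝ, Complex.exp (Complex.I * ((t * τ : ℝ) : ℂ)) * stFourier u n τ =
      (2 * Real.pi : ℝ) * ∫ x : ℝ, Complex.exp (Complex.I * ((t * (2 * Real.pi * x) : ℝ) : ℂ)) *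
        stFourier u n (2 * Real.pi * x) := by
    rw [h2, abs_of_pos (by positivity), Complex.real_smul, ← mul_assoc, ← Complex.ofReal_mul,
      mul_inv_cancel₀ (by positivity), Complex.ofReal_one, one_mul]
  rw [h3, ← integral_const_mul]
  congr 1; funext ξ
  rw [hF, smul_eq_mul]
  have h4 : Complex.I * ((t * (2 * Real.pi * ξ) : ℝ) : ℂ) =
      ((2 * Real.pi * inner ℝ ξ t : ℝ) : ℂ) * Complex.I := by
    simp only [RCLike.inner_apply, conj_trivial]
    push_cast; ring
  rw [h4]
  ring

/-! ### Membership in the function space -/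

theorem jb_modulation_le (n : Freq) (τ : ℝ) : jb (modulation n τ) ≤ 2 * (jb τ * jbFreq n ^ 2) := by
  have h1 := one_le_jb τ
  have h2 : jb (normSq n) ≤ jbFreq n ^ 2 := by
    have := jb_le_one_add_abs (normSq n)
    rwa [abs_of_nonneg (normSq_nonneg n), ← jbFreq_sq] at this
  have h3 : 1 ≤ jbFreq n ^ 2 := one_le_pow₀ (one_le_jbFreq n)
  have h4 := jb_add_le τ (normSq n)
  rw [modulation]
  nlinarith

/-- Since ⟨σ⟩ ≤ 2⟨τ⟩⟨n⟩², the weight is traded for decay. The conditions on a and b leave ⟨τ⟩^{-4/3}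
and ⟨n⟩^{-7/6}, which are integrable and square summable. For the X-part, a + 2b = s + 4/3 ≤ 5/6 is
the hypothesis s ≤ -1/2. -/
theorem weight_mul_decay_le {a b : ℝ} (hb : 0 ≤ b) (hb' : b ≤ 2 / 3)
    (hab : a + 2 * b ≤ 5 / 6) (n : Freq) (τ : ℝ) :
    jbFreq n ^ a * jb (modulation n τ) ^ b * ((jbFreq n ^ 2)⁻¹ * (jb τ ^ 2)⁻¹) ≤
      2 * (jbFreq n ^ (-(7 / 6) : ℝ) * jb τ ^ (-(4 / 3) : ℝ)) := by
  have hJ := jbFreq_pos n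
  have hj := jb_pos τ
  have hS := jb_pos (modulation n τ)
  have h1 : jb (modulation n τ) ^ b ≤ 2 * (jb τ ^ b * jbFreq n ^ (2 * b)) := by
    calc _ ≤ (2 * (jb τ * jbFreq n ^ 2)) ^ b :=
          Real.rpow_le_rpow hS.le (jb_modulation_le n τ) hb
      _ = (2 : ℝ) ^ b * (jb τ ^ b * jbFreq n ^ (2 * b)) := by
          rw [Real.mul_rpow (by norm_num) (by positivity), Real.mul_rpow hj.le (by positivity),
            Real.rpow_mul hJ.le, Real.rpow_two]
      _ ≤ _ := by
          gcongr
          calc (2 : ℝ) ^ b ≤ 2 ^ (1 : ℝ) :=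
                Real.rpow_le_rpow_of_exponent_le (by norm_num) (by linarith)
            _ = 2 := Real.rpow_one 2
  calc _ ≤ jbFreq n ^ a * (2 * (jb τ ^ b * jbFreq n ^ (2 * b))) *
        ((jbFreq n ^ 2)⁻¹ * (jb τ ^ 2)⁻¹) := by gcongr
    _ = 2 * (jbFreq n ^ (a + 2 * b + -2) * jb τ ^ (b + -2)) := by
        rw [Real.rpow_add hJ, Real.rpow_add hJ, Real.rpow_add hj, Real.rpow_neg hJ.le,
          Real.rpow_neg hj.le, Real.rpow_two, Real.rpow_two]
        ring
    _ ≤ _ := by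
        gcongr
        · exact one_le_jbFreq n
        · linarith
        · exact one_le_jb τ
        · linarith

theorem enorm_Plo_le (f : Freq → ℝ → ℂ) (n : Freq) (τ : ℝ) : ‖Plo f n τ‖ₑ ≤ ‖f n τ‖ₑ :=
  enorm_indicator_le_enorm_self _ _

theorem enorm_Phi_le (f : Freq → ℝ → ℂ) (n : Freq) (τ : ℝ) : ‖Phi f n τ‖ₑ ≤ ‖f n τ‖ₑ :=
  enorm_indicator_le_enorm_self _ _

theorem lintegral_jbE_ne_top {p : ℝ} (hp : 1 < p) : ∫⁻ τ : ℝ, jbE p τ ≠ ⊤ := jbMass_ne_top hp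

theorem ZhatNorm_lt_top_of_decay {s C : ℝ} (hs : -(2 / 3) < s) (hs' : s ≤ -(1 / 2)) (hC : 0 ≤ C)
    {f : Freq → ℝ → ℂ}
    (hf : ∀ n τ, ‖f n τ‖ ≤ C * (jbFreq n ^ 2)⁻¹ * (jb τ ^ 2)⁻¹) :
    ZhatNorm s (2 / 3) f < ⊤ := by
  set B : Freq → ℝ → ℝ≥0∞ := fun n τ => freqE (7 / 6) n * jbE (4 / 3) τ with hB
  have hsum := tsum_freqE_sq_ne_top (q := 7 / 6) (by norm_num)
  have hB2 : sqNorm B ≠ ⊤ := by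
    have h1 : sqNorm B = (∑' n, freqE (7 / 6) n ^ 2) * ∫⁻ τ : ℝ, jbE (8 / 3) τ := by
      rw [sqNorm, ← ENNReal.tsum_mul_right]
      refine tsum_congr fun n => ?_
      simp_rw [hB, mul_pow]
      rw [lintegral_const_mul' _ _ (by rw [freqE]; finiteness)]
      congr 2; funext τ
      rw [← jbE_half_sq (8 / 3)]; norm_num
    rw [h1]
    exact ENNReal.mul_ne_top hsum (lintegral_jbE_ne_top (by norm_num))
  have hB1 : sqNormOne B ≠ ⊤ := by
    have h1 : sqNormOne B = (∑' n, freqE (7 / 6) n ^ 2) * (∫⁻ τ : ℝ, jbE (4 / 3) τ) ^ 2 := by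
      rw [sqNormOne, ← ENNReal.tsum_mul_right]
      refine tsum_congr fun n => ?_
      rw [hB, lintegral_const_mul' _ _ (by rw [freqE]; finiteness), mul_pow]
    rw [h1]
    exact ENNReal.mul_ne_top hsum (ENNReal.pow_ne_top (lintegral_jbE_ne_top (by norm_num)))
  have hw : ∀ {a b : ℝ}, 0 ≤ b → b ≤ 2 / 3 → a + 2 * b ≤ 5 / 6 → ∀ (z : ℂ) n τ,
      ‖z‖ₑ ≤ ‖f n τ‖ₑ → ‖((jbFreq n ^ a * jb (modulation n τ) ^ b : ℝ) : ℂ) * z‖ₑ ≤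
        ENNReal.ofReal (2 * C) * B n τ := by
    intro a b hb hb' hab z n τ hz
    have hJ := jbFreq_pos n
    have hj := jb_pos τ
    have hS := jb_pos (modulation n τ)
    rw [enorm_ofReal_mul (by positivity), hB]
    simp only [freqE, jbE]
    refine (mul_le_mul_right hz _).trans ?_
    rw [← ofReal_norm, ← ENNReal.ofReal_mul (by positivity), ← ENNReal.ofReal_mul (by positivity),
      ← ENNReal.ofReal_mul (by positivity)]
    refine ENNReal.ofReal_le_ofReal ?_
    calc _ ≤ jbFreq n ^ a * jb (modulation n τ) ^ b * (C * (jbFreq n ^ 2)⁻¹ * (jb τ ^ 2)⁻¹) := by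
          gcongr; exact hf n τ
      _ = C * (jbFreq n ^ a * jb (modulation n τ) ^ b * ((jbFreq n ^ 2)⁻¹ * (jb τ ^ 2)⁻¹)) := by
          ring
      _ ≤ C * (2 * (jbFreq n ^ (-(7 / 6) : ℝ) * jb τ ^ (-(4 / 3) : ℝ))) := by
          exact mul_le_mul_of_nonneg_left (weight_mul_decay_le hb hb' hab n τ) hC
      _ = _ := by ring
  have h2 : ∀ {g : Freq → ℝ → ℂ}, (∀ n τ, ‖g n τ‖ₑ ≤ ENNReal.ofReal (2 * C) * B n τ) →
      ell2Lp 2 g < ⊤ := by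
    intro g hg
    rw [ell2Lp_two]
    refine ENNReal.rpow_lt_top_of_nonneg (by norm_num) ?_
    refine ne_top_of_le_ne_top ?_ (sqNorm_mono hg)
    rw [sqNorm_const_mul ENNReal.ofReal_ne_top]
    finiteness
  have h1 : ∀ {g : Freq → ℝ → ℂ}, (∀ n τ, ‖g n τ‖ₑ ≤ ENNReal.ofReal (2 * C) * B n τ) →
      ell2Lp 1 g < ⊤ := by
    intro g hg
    rw [ell2Lp_one]
    refine ENNReal.rpow_lt_top_of_nonneg (by norm_num) ?_
    refine ne_top_of_le_ne_top ?_ (sqNormOne_mono hg)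
    rw [sqNormOne_const_mul ENNReal.ofReal_ne_top]
    finiteness
  rw [ZhatNorm, XhatNorm, YhatNorm]
  refine ENNReal.add_lt_top.2 ⟨h2 fun n τ => ?_, ENNReal.add_lt_top.2 ⟨h1 fun n τ => ?_,
    h2 fun n τ => ?_⟩⟩
  · exact hw (by norm_num) le_rfl (by linarith) _ n τ (enorm_Plo_le f n τ)
  · simpa only [Real.rpow_zero, mul_one] using hw (a := s) (b := 0) le_rfl (by norm_num)
      (by linarith) _ n τ (enorm_Phi_le f n τ)
  · simpa only [Real.rpow_zero, one_mul] using hw (a := 0) (b := s / 2 + 2 / 3) (by linarith)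
      (by linarith) (by linarith) _ n τ (enorm_Phi_le f n τ)

theorem IsNice.memZhat {s : ℝ} (hs : -(2 / 3) < s) (hs' : s ≤ -(1 / 2))
    {u : (Fin 2 → ℝ) → ℝ → ℂ} (hu : IsNice u) : MemZhat s (2 / 3) (stFourier u) := by
  obtain ⟨C, hC0, hC⟩ := hu.exists_norm_stFourier_le
  exact ⟨fun n => (hu.tame.continuous_stFourier n).aestronglyMeasurable,
    ZhatNorm_lt_top_of_decay hs hs' hC0 hC⟩

/-! ### Parseval's identity on the torus -/

/-- The normalized Haar measure of `(ℝ / ℤ)²`. -/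
abbrev torusMeasure : Measure (UnitAddTorus (Fin 2)) :=
  Measure.pi fun _ => AddCircle.haarAddCircle

/-- The function on `(ℝ / ℤ)²` obtained from a function on the box by rescaling. -/
def torusLift (a : (Fin 2 → ℝ) → ℂ) (y : UnitAddTorus (Fin 2)) : ℂ :=
  a ((2 * Real.pi) • (UnitAddTorus.measurableEquivPiIoc (0 : Fin 2 → ℝ) y).1)

theorem torusLift_coe (a : (Fin 2 → ℝ) → ℂ) {x : Fin 2 → ℝ}
    (hx : ∀ i, x i ∈ Set.Ioc ((0 : Fin 2 → ℝ) i) ((0 : Fin 2 → ℝ) i + 1)) :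
    torusLift a (fun i => (x i : UnitAddCircle)) = a ((2 * Real.pi) • x) := by
  have h := (UnitAddTorus.measurableEquivPiIoc (0 : Fin 2 → ℝ)).apply_symm_apply ⟨x, hx⟩
  rw [UnitAddTorus.coe_symm_measurableEquivPiIoc_apply] at h
  rw [torusLift, h]

theorem two_pi_smul_mem_box {x : Fin 2 → ℝ}
    (hx : ∀ i, x i ∈ Set.Ioc ((0 : Fin 2 → ℝ) i) ((0 : Fin 2 → ℝ) i + 1)) :
    (2 * Real.pi) • x ∈ box := by
  have hπ := Real.pi_pos
  constructor <;> intro i <;> have := hx i <;> simp only [Pi.zero_apply, zero_add, Set.mem_Ioc] at this <;>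
    simp only [Pi.zero_apply, Pi.smul_apply, smul_eq_mul] <;> nlinarith [this.1, this.2]

theorem memLp_torusLift {a : (Fin 2 → ℝ) → ℂ} (ha : Continuous a) :
    MemLp (torusLift a) 2 torusMeasure := by
  obtain ⟨C, hC⟩ := (isCompact_box.image ha.norm).bddAbove
  refine MemLp.of_bound (C := C) (Measurable.aestronglyMeasurable ?_)
    (Filter.Eventually.of_forall fun y => hC ⟨_, two_pi_smul_mem_box
      (UnitAddTorus.measurableEquivPiIoc (0 : Fin 2 → ℝ) y).2, rfl⟩)
  have h : Measurable fun y : UnitAddTorus (Fin 2) =>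
      (UnitAddTorus.measurableEquivPiIoc (0 : Fin 2 → ℝ) y).1 :=
    measurable_subtype_coe.comp (UnitAddTorus.measurableEquivPiIoc (0 : Fin 2 → ℝ)).measurable
  exact ha.measurable.comp (h.const_smul (2 * Real.pi))

/-- Rescaling by 2π; the half-open cube used for the torus differs from the closed one by a null
set. -/
theorem setIntegral_unitBox (a : (Fin 2 → ℝ) → ℂ) :
    ∫ x in {x : Fin 2 → ℝ | ∀ i, x i ∈ Set.Ioc ((0 : Fin 2 → ℝ) i) ((0 : Fin 2 → ℝ) i + 1)},
      a ((2 * Real.pi) • x) = (((2 * Real.pi) ^ 2 : ℝ) : ℂ)⁻¹ * ∫ x in box, a x := by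
  have hπ : 0 < 2 * Real.pi := by positivity
  have h1 : {x : Fin 2 → ℝ | ∀ i, x i ∈ Set.Ioc ((0 : Fin 2 → ℝ) i) ((0 : Fin 2 → ℝ) i + 1)}
      =ᵐ[volume] Set.Icc 0 1 := by
    have := Measure.univ_pi_Ioc_ae_eq_Icc (μ := fun _ : Fin 2 => (volume : Measure ℝ))
      (f := fun _ => 0) (g := fun _ => 1)
    have e : {x : Fin 2 → ℝ | ∀ i, x i ∈ Set.Ioc ((0 : Fin 2 → ℝ) i) ((0 : Fin 2 → ℝ) i + 1)} =
        Set.pi Set.univ fun _ => Set.Ioc (0 : ℝ) 1 := by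
      ext x; simp
    rw [e]
    exact this
  have h2 : (2 * Real.pi) • (Set.Icc 0 1 : Set (Fin 2 → ℝ)) = box := by
    ext x
    rw [Set.mem_smul_set_iff_inv_smul_mem₀ hπ.ne', box, Set.mem_Icc, Set.mem_Icc]
    simp only [Pi.le_def, Pi.zero_apply, Pi.one_apply, Pi.smul_apply, smul_eq_mul]
    refine and_congr (forall_congr' fun i => ?_) (forall_congr' fun i => ?_)
    · rw [le_inv_mul_iff₀ hπ, mul_zero]
    · rw [inv_mul_le_iff₀ hπ, mul_one]
  rw [setIntegral_congr_set h1, Measure.setIntegral_comp_smul_of_pos _ a _ hπ, h2,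
    Complex.real_smul]
  simp

theorem mFourierCoeff_torusLift (a : (Fin 2 → ℝ) → ℂ) (n : Freq) :
    UnitAddTorus.mFourierCoeff (torusLift a) n = boxCoeff a n := by
  rw [UnitAddTorus.mFourierCoeff_eq_integral _ _ 0, boxCoeff, ← setIntegral_unitBox]
  refine setIntegral_congr_fun (MeasurableSet.univ_pi' fun i => measurableSet_Ioc) fun x hx => ?_
  have h1 : UnitAddTorus.mFourier (-n) (fun i => (x i : UnitAddCircle)) =
      Complex.exp (-Complex.I *
        ((∑ j, (n j : ℝ) * ((2 * Real.pi) • x) j : ℝ) : ℂ)) := by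
    change ∏ i, fourier ((-n) i) (x i : UnitAddCircle) = _
    simp_rw [fourier_coe_apply]
    rw [← Complex.exp_sum]
    congr 1
    simp only [Fin.sum_univ_two, Pi.neg_apply, Pi.smul_apply, smul_eq_mul]
    push_cast; ring
  change _ • torusLift a (fun i => (x i : UnitAddCircle)) = _
  rw [h1, torusLift_coe a hx, smul_eq_mul]

/-- Parseval in polarized form: the zeroth coefficient of āb is the normalized inner product. -/
theorem hasSum_star_boxCoeff_mul {a b : (Fin 2 → ℝ) → ℂ} (ha : Continuous a)
    (hb : Continuous b) :
    HasSum (fun n => star (boxCoeff a n) * boxCoeff b n) (boxCoeff (fun x => star (a x) * b x) 0) := by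
  have h := UnitAddTorus.hasSum_prod_mFourierCoeff ((memLp_torusLift ha).toLp _)
    ((memLp_torusLift hb).toLp _)
  have hc : ∀ {a : (Fin 2 → ℝ) → ℂ} (ha : Continuous a) (n : Freq),
      UnitAddTorus.mFourierCoeff ((memLp_torusLift ha).toLp _) n = boxCoeff a n := by
    intro a ha n
    rw [← mFourierCoeff_torusLift]
    exact integral_congr_ae ((memLp_torusLift ha).coeFn_toLp.mono fun y hy => by
      simp only [hy])
  have e : ∫ t, (starRingEnd ℂ) ((memLp_torusLift ha).toLp _ t) * (memLp_torusLift hb).toLp _ t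
      ∂torusMeasure = boxCoeff (fun x => star (a x) * b x) 0 := by
    rw [← mFourierCoeff_torusLift]
    refine integral_congr_ae ?_
    filter_upwards [(memLp_torusLift ha).coeFn_toLp, (memLp_torusLift hb).coeFn_toLp] with y h1 h2
    rw [h1, h2]
    simp [UnitAddTorus.mFourier_zero, torusLift]
  rw [← e]
  refine HasSum.congr_fun h fun n => ?_
  rw [← hc ha, ← hc hb]
  rfl

/-! ### The Fourier transform of the product -/

theorem star_exp_neg_I_mul (x : ℝ) :
    star (Complex.exp (-Complex.I * (x : ℂ))) = Complex.exp (-Complex.I * ((-x : ℝ) : ℂ)) := by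
  rw [← starRingEnd_apply, ← Complex.exp_conj]
  simp

theorem boxCoeff_star (b : (Fin 2 → ℝ) → ℂ) (n : Freq) :
    boxCoeff (fun x => star (b x)) n = star (boxCoeff b (-n)) := by
  rw [boxCoeff, boxCoeff, star_mul', ← starRingEnd_apply (∫ x in box, _), ← integral_conj]
  congr 1
  · rw [← starRingEnd_apply, map_inv₀, Complex.conj_ofReal]
  · refine integral_congr_ae (Filter.Eventually.of_forall fun x => ?_)
    simp only [map_mul]
    rw [starRingEnd_apply, starRingEnd_apply, star_exp_neg_I_mul]
    congr 4
    simp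

/-- The Fourier coefficients of a product of complex conjugates. -/
theorem hasSum_boxCoeff_star_mul_star {a b : (Fin 2 → ℝ) → ℂ} (ha : Continuous a)
    (hb : Continuous b) (n : Freq) :
    HasSum (fun n₁ => star (boxCoeff a n₁) * star (boxCoeff b (-n - n₁)))
      (boxCoeff (fun x => star (a x) * star (b x)) n) := by
  -- Multiplying a by e^{in·x} shifts its coefficients by n and turns the zeroth coefficient in
  -- Parseval's identity into the n-th one.
  set A : (Fin 2 → ℝ) → ℂ := fun x =>
    Complex.exp (-Complex.I * ((-∑ j, (n j : ℝ) * x j : ℝ) : ℂ)) * a x with hA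
  have hAc : Continuous A := by fun_prop
  have h := hasSum_star_boxCoeff_mul hAc hb.star
  have h1 : ∀ m, boxCoeff A (m + n) = boxCoeff a m := by
    intro m
    rw [boxCoeff, boxCoeff]
    congr 2; funext x
    rw [hA, ← mul_assoc, ← Complex.exp_add]
    congr 2
    simp only [Fin.sum_univ_two, Pi.add_apply]
    push_cast; ring
  have h2 : boxCoeff (fun x => star (A x) * star (b x)) 0 =
      boxCoeff (fun x => star (a x) * star (b x)) n := by
    rw [boxCoeff, boxCoeff]
    congr 2; funext x
    rw [hA, star_mul', star_exp_neg_I_mul, neg_neg]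
    simp [mul_assoc]
  rw [← h2]
  refine ((Equiv.addRight n).hasSum_iff.2 h).congr_fun fun m => ?_
  simp only [Function.comp_apply, Equiv.coe_addRight]
  rw [h1, boxCoeff_star, neg_add_rev, sub_eq_add_neg]

theorem norm_cutoff_le {φ : ℝ → ℝ} (h : ∀ t, φ t ∈ Set.Icc (0 : ℝ) 1) (T t : ℝ) :
    ‖cutoff φ T t‖ ≤ 1 := by
  rw [cutoff, Complex.norm_real, Real.norm_of_nonneg (h _).1]
  exact (h _).2

theorem norm_mul_star_mul_le {c z w : ℂ} (hc : ‖c‖ ≤ 1) :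
    ‖(c * star z) * (c * star w)‖ ≤ ‖z‖ * ‖w‖ := by
  rw [norm_mul, norm_mul, norm_mul, norm_star, norm_star]
  have := norm_nonneg c
  calc _ ≤ (1 * ‖z‖) * (1 * ‖w‖) := by gcongr
    _ = _ := by ring

theorem Tame.cutoffProd {φ : ℝ → ℝ} (hφ : Continuous φ) (h : ∀ t, φ t ∈ Set.Icc (0 : ℝ) 1)
    (T : ℝ) {u v : (Fin 2 → ℝ) → ℝ → ℂ} (hu : Tame u) (hv : Tame v) :
    Tame (cutoffProd φ T u v) := by
  obtain ⟨C, hC⟩ := hu.decay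
  obtain ⟨D, hD⟩ := hv.decay
  have hcu := hu.continuous
  have hcv := hv.continuous
  refine ⟨?_, C * D, fun x t => (norm_mul_star_mul_le (norm_cutoff_le h T t)).trans ?_⟩
  · unfold QNLS.cutoffProd cutoff
    fun_prop
  · have h1 : (1 + t ^ 2)⁻¹ ≤ 1 := inv_le_one_of_one_le₀ (by linarith [sq_nonneg t])
    have h0 : 0 < (1 + t ^ 2)⁻¹ := by positivity
    have hC0 : 0 ≤ C := by
      have := (norm_nonneg _).trans (hC x t)
      exact nonneg_of_mul_nonneg_left this h0
    have hD0 : 0 ≤ D := by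
      have := (norm_nonneg _).trans (hD x t)
      exact nonneg_of_mul_nonneg_left this h0
    calc _ ≤ (C * (1 + t ^ 2)⁻¹) * (D * 1) := by
          refine mul_le_mul (hC x t) ((hD x t).trans ?_) (norm_nonneg _) (by positivity)
          gcongr
      _ = _ := by ring

/-- Each factor is square summable because ⟨m⟩^{-4} is summable on ℤ²; the product is dominated by
the sum of the squares. -/
theorem summable_inv_jbFreq_sq_mul (n : Freq) :
    Summable fun n₁ : Freq => (jbFreq n₁ ^ 2)⁻¹ * (jbFreq (-n - n₁) ^ 2)⁻¹ := by
  have h1 : Summable fun m : Freq => ((jbFreq m ^ 2)⁻¹) ^ 2 := by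
    refine (summable_jbFreq_rpow (q := 4) (by norm_num)).congr fun m => ?_
    have h4 : jbFreq m ^ (4 : ℝ) = jbFreq m ^ 4 := by exact_mod_cast Real.rpow_natCast _ 4
    rw [Real.rpow_neg (jbFreq_pos m).le, h4, inv_pow, ← pow_mul]
  have h2 : Summable fun m : Freq => ((jbFreq (-n - m) ^ 2)⁻¹) ^ 2 :=
    (Equiv.subLeft (-n)).summable_iff.2 h1
  refine Summable.of_nonneg_of_le (fun m => ?_) (fun m => ?_) (h1.add h2)
  · have := jbFreq_pos m
    have := jbFreq_pos (-n - m)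
    positivity
  · nlinarith [sq_nonneg ((jbFreq m ^ 2)⁻¹ - (jbFreq (-n - m) ^ 2)⁻¹),
      sq_nonneg ((jbFreq m ^ 2)⁻¹), sq_nonneg ((jbFreq (-n - m) ^ 2)⁻¹)]

/-- For smooth functions, the Fourier transform of the pointwise product is the convolution. -/
theorem stFourier_cutoffProd {φ : ℝ → ℝ} (hφ : Continuous φ)
    (h : ∀ t, φ t ∈ Set.Icc (0 : ℝ) 1) (T : ℝ) {u v : (Fin 2 → ℝ) → ℝ → ℂ} (hu : IsNice u)
    (hv : IsNice v) :
    stFourier (cutoffProd φ T u v) = prodFourier φ T (stFourier u) (stFourier v) := by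
  funext n τ
  rw [(hu.tame.cutoffProd hφ h T hv.tame).stFourier_eq, prodFourier]
  simp_rw [prodTerm, hu.spaceCoeff_stFourier, hv.spaceCoeff_stFourier]
  set F : Freq → ℝ → ℂ := fun n₁ t => Complex.exp (-Complex.I * ((t * τ : ℝ) : ℂ)) *
    ((cutoff φ T t * star (torusCoeff u n₁ t)) *
      (cutoff φ T t * star (torusCoeff v (-n - n₁) t))) with hF
  have hpt : ∀ t, HasSum (fun n₁ => F n₁ t) (Complex.exp (-Complex.I * ((t * τ : ℝ) : ℂ)) *
      torusCoeff (cutoffProd φ T u v) n t) := by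
    intro t
    have h1 := (hasSum_boxCoeff_star_mul_star
      (hu.tame.continuous.comp (Continuous.prodMk_left t))
      (hv.tame.continuous.comp (Continuous.prodMk_left t)) n).mul_left
      (Complex.exp (-Complex.I * ((t * τ : ℝ) : ℂ)) * (cutoff φ T t * cutoff φ T t))
    have h2 : Complex.exp (-Complex.I * ((t * τ : ℝ) : ℂ)) *
        torusCoeff (cutoffProd φ T u v) n t =
        Complex.exp (-Complex.I * ((t * τ : ℝ) : ℂ)) * (cutoff φ T t * cutoff φ T t) *
          boxCoeff (fun x => star (u x t) * star (v x t)) n := by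
      rw [torusCoeff, boxCoeff, boxCoeff, mul_assoc, mul_left_comm (cutoff φ T t * cutoff φ T t),
        ← integral_const_mul (cutoff φ T t * cutoff φ T t)]
      congr 3; funext x
      rw [cutoffProd]; ring
    rw [h2]
    refine h1.congr_fun fun n₁ => ?_
    simp only [hF, torusCoeff, Function.comp_def]
    ring
  obtain ⟨C, hC⟩ := hu.exists_norm_torusCoeff_le
  obtain ⟨D, hD⟩ := hv.exists_norm_torusCoeff_le
  -- A bound that is summable in n₁ and integrable in t justifies exchanging the series with the
  -- time integral.
  have hbd : ∀ n₁ t, ‖F n₁ t‖ ≤ (|C| * |D| * ((jbFreq n₁ ^ 2)⁻¹ * (jbFreq (-n - n₁) ^ 2)⁻¹)) *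
      (1 + t ^ 2)⁻¹ := by
    intro n₁ t
    have hJ1 := jbFreq_pos n₁
    have hJ2 := jbFreq_pos (-n - n₁)
    have ht : (1 + t ^ 2)⁻¹ ≤ 1 := inv_le_one_of_one_le₀ (by linarith [sq_nonneg t])
    have hC1 : ‖torusCoeff u n₁ t‖ ≤ |C| * (1 + t ^ 2)⁻¹ * (jbFreq n₁ ^ 2)⁻¹ := by
      rw [← div_eq_mul_inv _ (jbFreq n₁ ^ 2), le_div_iff₀ (by positivity)]
      exact (hC n₁ t).trans (by gcongr; exact le_abs_self C)
    have hD1 : ‖torusCoeff v (-n - n₁) t‖ ≤ |D| * 1 * (jbFreq (-n - n₁) ^ 2)⁻¹ := by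
      rw [← div_eq_mul_inv _ (jbFreq (-n - n₁) ^ 2), le_div_iff₀ (by positivity)]
      exact (hD _ t).trans (mul_le_mul (le_abs_self D) ht (by positivity) (abs_nonneg D))
    rw [hF]
    simp only
    rw [norm_mul, norm_exp_neg_I_mul, one_mul]
    refine (norm_mul_star_mul_le (norm_cutoff_le h T t)).trans ?_
    refine (mul_le_mul hC1 hD1 (norm_nonneg _) (by positivity)).trans_eq ?_
    ring
  have hint : ∀ n₁, Integrable (F n₁) := by
    intro n₁
    have hcu := continuous_torusCoeff hu.tame.continuous n₁
    have hcv := continuous_torusCoeff hv.tame.continuous (-n - n₁)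
    refine (integrable_inv_one_add_sq.const_mul _).mono' (Continuous.aestronglyMeasurable ?_)
      (Filter.Eventually.of_forall fun t => hbd n₁ t)
    rw [hF]
    unfold cutoff
    fun_prop
  have hsum : Summable fun n₁ => ∫ t, ‖F n₁ t‖ := by
    refine Summable.of_nonneg_of_le (fun n₁ => integral_nonneg fun t => norm_nonneg _)
      (fun n₁ => ?_) (((summable_inv_jbFreq_sq_mul n).mul_left (|C| * |D|)).mul_right
        (∫ t : ℝ, (1 + t ^ 2)⁻¹))
    rw [← integral_const_mul]
    exact integral_mono (hint n₁).norm (integrable_inv_one_add_sq.const_mul _) fun t => hbd n₁ t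
  have hres := hasSum_integral_of_summable_integral_norm hint hsum
  rw [tsum_mul_left, hres.tsum_eq]
  congr 2; funext t
  exact (hpt t).tsum_eq.symm

end QNLS

end

/-! ### The theorem. -/

theorem proposition3p1 (s : ℝ) (hs : -(2 / 3) < s) (hs' : s ≤ -(1 / 2)) :
    ∃ θ : ℝ, 0 < θ ∧
      ∀ φ : ℝ → ℝ, ContDiff ℝ ∞ φ → (∀ t, φ t ∈ Set.Icc (0 : ℝ) 1) →
        (∀ t ∈ Set.Icc (-1 : ℝ) 1, φ t = 1) → (∀ t, t ∉ Set.Icc (-2 : ℝ) 2 → φ t = 0) →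
        ∃ C : NNReal, ∀ T : ℝ, 0 < T → T ≤ 1 / 2 →
          -- functions that are smooth in space and Schwartz in time
          (∀ u v : (Fin 2 → ℝ) → ℝ → ℂ, QNLS.IsNice u → QNLS.IsNice v →
            QNLS.ZhatNorm s (2 / 3)
                (QNLS.invModulation (QNLS.stFourier (QNLS.cutoffProd φ T u v))) ≤
              C * ENNReal.ofReal (T ^ θ) * QNLS.ZhatNorm s (2 / 3) (QNLS.stFourier u) *
                QNLS.ZhatNorm s (2 / 3) (QNLS.stFourier v)) ∧
          -- arbitrary elements of the space, through their Fourier transforms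
          (∀ f g : QNLS.Freq → ℝ → ℂ, QNLS.MemZhat s (2 / 3) f → QNLS.MemZhat s (2 / 3) g →
            (∀ n, ∀ᵐ τ : ℝ, Summable (QNLS.prodTerm φ T f g n τ)) ∧
            QNLS.ZhatNorm s (2 / 3) (QNLS.invModulation (QNLS.prodFourier φ T f g)) ≤
              C * ENNReal.ofReal (T ^ θ) * QNLS.ZhatNorm s (2 / 3) f *
                QNLS.ZhatNorm s (2 / 3) g) := by
  -- With s = 100δ - 2/3 the range of s becomes 0 < δ ≤ 1/600, and θ = δ. The smooth case is the
  -- general one, once the two descriptions of the product are identified.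
  have hδ : 0 < (s + 2 / 3) / 100 := by linarith
  have e : 100 * ((s + 2 / 3) / 100) - 2 / 3 = s := by ring
  refine ⟨(s + 2 / 3) / 100, hδ, fun φ hφ h01 _ hsupp => ?_⟩
  obtain ⟨C, hC⟩ := QNLS.exists_prodFourier_le hδ (by linarith) hφ hsupp
  rw [e] at hC
  refine ⟨C, fun T hT hT' => ⟨fun u v hu hv => ?_, hC T hT (by linarith)⟩⟩
  rw [QNLS.stFourier_cutoffProd hφ.continuous h01 T hu hv]
  exact (hC T hT (by linarith) _ _ (hu.memZhat hs hs') (hv.memZhat hs hs')).2
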